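/- Let $n\ge 3$, let $M^n$ be a compact smooth Riemannian manifold (without boundary) with nonnegative sectional curvature, and let $f\colon M^n\to\mathbb{R}^{n+2}$ be a smooth isometric immersion. For $v$ in the unit sphere $\mathbb{S}^{n+1}\subset\mathbb{R}^{n+2}$ let $\mu_k(v)$ be the number of critical points of index $k$ of the height function $h_v=\langle v,f(\cdot)\rangle\colon M\to\mathbb{R}$, where the index is the number of negative eigenvalues of the Hessian, and let $$\tau_k=\frac{1}{\operatorname{vol}(\mathbb{S}^{n+1})}\int_{\mathbb{S}^{n+1}}\mu_k(v)\,dv .$$ Suppose that $f$ is wide, that is, $$\tau_0+\tau_n=\tau_1+\cdots+\tau_{n-1}.$$ For a normal vector $\beta$ of $f$ at $p$ let $A_\beta\colon T_pM\to T_pM$ be the shape operator, $\langle A_\beta X,Y\rangle=\langle\alpha(X,Y),\beta\rangle$, where $\alpha$ is the second fundamental form. Then at every point $p\in M$ there is an orthonormal basis $\{\xi,\eta\}$ of the normal space of $f$ at $p$ with $A_\xi\ge0$ and $A_\eta\ge0$; and for every such basis, the operators $A=A_\xi$ and $B=A_\eta$ satisfy $$\text{either}\quad \ker A\oplus\ker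 B=T_pM\ \text{ with } A\ne0 \text{ and } B\neq 0,\qquad\text{or}\quad \ker A\cap\ker B\neq0 .$$ -/

import Mathlib

open scoped Manifold ContDiff ENNReal
open Bundle MeasureTheory

noncomputable section

namespace NonnegCodimTwo

/-- Euclidean space `ℝᵐ`. -/
abbrev Euc (m : ℕ) : Type := EuclideanSpace ℝ (Fin m)

/-! ### Sectional curvature of a Riemannian metric, in charts -/

section CoordinateCurvature

variable {n : ℕ}

/-- The partial derivative `∂ᵢ h` of a function on `ℝⁿ`. -/
def partialDeriv (i : Fin n) (h : Euc n → ℝ) (u : Euc n) : ℝ :=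
  fderiv ℝ h u (EuclideanSpace.single i 1)

/-- The Christoffel symbols
`Γᵏᵢⱼ = ½ ∑ₗ gᵏˡ (∂ᵢ gⱼₗ + ∂ⱼ gᵢₗ - ∂ₗ gᵢⱼ)` of a metric `g` given in coordinates. -/
def christoffel (g : Euc n → Matrix (Fin n) (Fin n) ℝ) (k i j : Fin n) (u : Euc n) : ℝ :=
  (1 / 2 : ℝ) * ∑ l, (g u)⁻¹ k l *
    (partialDeriv i (fun w => g w j l) u + partialDeriv j (fun w => g w i l) u
      - partialDeriv l (fun w => g w i j) u)

/-- The coefficients of the curvature tensor `R(∂ᵢ, ∂ⱼ) ∂ₖ = ∑ₗ Rˡᵢⱼₖ ∂ₗ`, where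
`R(X, Y) = ∇_X ∇_Y - ∇_Y ∇_X - ∇_[X, Y]`. -/
def curvatureCoeff (g : Euc n → Matrix (Fin n) (Fin n) ℝ) (l i j k : Fin n) (u : Euc n) : ℝ :=
  partialDeriv i (christoffel g l j k) u - partialDeriv j (christoffel g l i k) u
    + ∑ m, (christoffel g l i m u * christoffel g m j k u
      - christoffel g l j m u * christoffel g m i k u)

/-- The number `⟨R(X, Y) Y, X⟩` at the point `u`, for vectors `X`, `Y` given by their
coordinates. -/
def curvatureQuad (g : Euc n → Matrix (Fin n) (Fin n) ℝ) (u : Euc n) (X Y : Euc n) : ℝ :=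
  ∑ i, ∑ j, ∑ k, ∑ l, ∑ m,
    X i * Y j * Y k * curvatureCoeff g l i j k u * g u l m * X m

end CoordinateCurvature

section Riemannian

variable {n : ℕ} {M : Type*} [TopologicalSpace M] [ChartedSpace (Euc n) M]

/-- The coordinate vector field `∂ᵢ` of the preferred chart at `p`, at the point with
coordinates `u`. -/
def coordVector (p : M) (u : Euc n) (i : Fin n) :
    TangentSpace (𝓡 n) ((extChartAt (𝓡 n) p).symm u) :=
  mfderiv 𝓘(ℝ, Euc n) (𝓡 n) (extChartAt (𝓡 n) p).symm u
    (EuclideanSpace.single i 1 : Euc n)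

variable [RiemannianBundle (fun q : M => TangentSpace (𝓡 n) q)]

/-- The matrix `gᵢⱼ = ⟨∂ᵢ, ∂ⱼ⟩` of the Riemannian metric in the preferred chart at `p`. -/
def chartMetric (p : M) (u : Euc n) : Matrix (Fin n) (Fin n) ℝ :=
  Matrix.of fun i j => inner ℝ (coordVector p u i) (coordVector p u j)

/-- The sectional curvature of the plane spanned by two tangent vectors `X`, `Y` at `p`. It is
computed in the preferred chart at `p`, whose differential at `p` is the identification
`TangentSpace (𝓡 n) p = ℝⁿ`. -/
def sectionalCurvature (p : M) (X Y : TangentSpace (𝓡 n) p) : ℝ :=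
  curvatureQuad (chartMetric p) (extChartAt (𝓡 n) p p) (X : Euc n) (Y : Euc n) /
    (inner ℝ X X * inner ℝ Y Y - inner ℝ X Y ^ 2)

variable (n M) in
/-- All sectional curvatures of `M` are nonnegative. -/
def NonnegSectionalCurvature : Prop :=
  ∀ (p : M) (X Y : TangentSpace (𝓡 n) p),
    LinearIndependent ℝ ![X, Y] → 0 ≤ sectionalCurvature p X Y

variable (n) in
/-- `f : M → ℝᵐ` is a smooth isometric immersion. -/
structure IsIsometricImmersion {m : ℕ} (f : M → Euc m) : Prop where
  smooth : ContMDiff (𝓡 n) 𝓘(ℝ, Euc m) ∞ f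
  isometric : ∀ (p : M) (X Y : TangentSpace (𝓡 n) p),
    inner ℝ (mfderiv (𝓡 n) 𝓘(ℝ, Euc m) f p X : Euc m) (mfderiv (𝓡 n) 𝓘(ℝ, Euc m) f p Y : Euc m)
      = inner ℝ X Y

end Riemannian

/-! ### Second fundamental form and shape operators -/

section Extrinsic

variable {n m : ℕ} {M : Type*} [TopologicalSpace M] [ChartedSpace (Euc n) M]

/-- The second derivative at `p` of a vector-valued function, in the preferred chart at `p`. -/
def chartHessian {V : Type*} [NormedAddCommGroup V] [NormedSpace ℝ V] (f : M → V) (p : M) :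
    TangentSpace (𝓡 n) p →L[ℝ] TangentSpace (𝓡 n) p →L[ℝ] V :=
  (fderiv ℝ (fderiv ℝ (f ∘ (extChartAt (𝓡 n) p).symm)) (extChartAt (𝓡 n) p p) :
    Euc n →L[ℝ] Euc n →L[ℝ] V)

/-- The normal space of the immersion `f` at `p`: the orthogonal complement of the image of the
differential. -/
def normalSpace (f : M → Euc m) (p : M) : Submodule ℝ (Euc m) :=
  (LinearMap.range
    (mfderiv (𝓡 n) 𝓘(ℝ, Euc m) f p : Euc n →L[ℝ] Euc m).toLinearMap)ᗮ

/-- The second fundamental form `α` of `f` at `p`: the normal component of the second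
derivative. -/
def secondFundamentalForm (f : M → Euc m) (p : M) (X Y : TangentSpace (𝓡 n) p) :
    normalSpace (n := n) f p :=
  (normalSpace (n := n) f p).orthogonalProjectionOnto (chartHessian f p X Y)

/-- The bilinear form `(X, Y) ↦ ⟨α(X, Y), β⟩` on the tangent space, for a normal vector `β`. -/
def normalForm (f : M → Euc m) (p : M) (β : normalSpace (n := n) f p) :
    TangentSpace (𝓡 n) p →ₗ[ℝ] TangentSpace (𝓡 n) p →ₗ[ℝ] ℝ :=
  LinearMap.mk₂ ℝ (fun X Y => inner ℝ (secondFundamentalForm f p X Y) β)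
    (fun X X' Y => by simp [secondFundamentalForm, inner_add_left])
    (fun c X Y => by
      rw [secondFundamentalForm, map_smul]
      change inner ℝ ((normalSpace (n := n) f p).orthogonalProjectionOnto
        (c • chartHessian f p X Y)) β = _
      rw [map_smul, inner_smul_left]
      rfl)
    (fun X Y Y' => by simp [secondFundamentalForm, inner_add_left])
    (fun c X Y => by
      rw [secondFundamentalForm, map_smul]
      change inner ℝ ((normalSpace (n := n) f p).orthogonalProjectionOnto
        (c • chartHessian f p X Y)) β = _
      rw [map_smul, inner_smul_left]
      rfl)

instance (p : M) : FiniteDimensional ℝ (TangentSpace (𝓡 n) p) :=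
  inferInstanceAs (FiniteDimensional ℝ (Euc n))

variable [RiemannianBundle (fun q : M => TangentSpace (𝓡 n) q)]

instance (p : M) : CompleteSpace (TangentSpace (𝓡 n) p) :=
  FiniteDimensional.complete ℝ _

/-- The shape operator `A_β` of `f` at `p` in the normal direction `β`; it is the operator with
`⟨A_β X, Y⟩ = ⟨α(X, Y), β⟩`, see `inner_shapeOperator`. -/
def shapeOperator (f : M → Euc m) (p : M) (β : normalSpace (n := n) f p) :
    TangentSpace (𝓡 n) p →ₗ[ℝ] TangentSpace (𝓡 n) p where
  toFun X := (InnerProductSpace.toDual ℝ (TangentSpace (𝓡 n) p)).symm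
    (LinearMap.toContinuousLinearMap (normalForm f p β X))
  map_add' X Y := by simp
  map_smul' c X := by simp

theorem inner_shapeOperator (f : M → Euc m) (p : M) (β : normalSpace (n := n) f p)
    (X Y : TangentSpace (𝓡 n) p) :
    inner ℝ (shapeOperator f p β X) Y = inner ℝ (secondFundamentalForm f p X Y) β := by
  change inner ℝ ((InnerProductSpace.toDual ℝ (TangentSpace (𝓡 n) p)).symm _) Y = _
  rw [InnerProductSpace.toDual_symm_apply]
  rfl

end Extrinsic

/-! ### Type numbers -/

section TypeNumbers

variable {n m : ℕ} {M : Type*} [TopologicalSpace M] [ChartedSpace (Euc n) M]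

/-- The height function `h_v = ⟨v, f(·)⟩`. -/
def heightFunction (f : M → Euc m) (v : Euc m) (q : M) : ℝ := inner ℝ v (f q)

variable (n) in
/-- `p` is a critical point of `h`. -/
def IsCriticalPoint (h : M → ℝ) (p : M) : Prop :=
  mfderiv (𝓡 n) 𝓘(ℝ, ℝ) h p = 0

variable (n) in
/-- The index at `p` of a function `h` with critical point `p`: the number of negative eigenvalues
of the Hessian of `h` at `p`, that is, the maximal dimension of a subspace on which the Hessian is
negative definite. -/
def morseIndex (h : M → ℝ) (p : M) : ℕ :=
  sigNeg
    (LinearMap.BilinMap.toQuadraticMap (chartHessian (n := n) h p).toLinearMap₁₂)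

variable (n) in
/-- `μ_k(v)`: the number of critical points of index `k` of the height function `h_v`. -/
def numCritical (f : M → Euc m) (k : ℕ) (v : Euc m) : ℕ∞ :=
  {p : M | IsCriticalPoint n (heightFunction f v) p ∧
    morseIndex n (heightFunction f v) p = k}.encard

variable (n) in
/-- The type number `τ_k`: the average of `μ_k` over the unit sphere. -/
def typeNumber (f : M → Euc m) (k : ℕ) : ℝ≥0∞ :=
  ⨍⁻ v : Metric.sphere (0 : Euc m) 1,
    ((numCritical n f k (v : Euc m) : ℕ∞) : ℝ≥0∞) ∂(volume : Measure (Euc m)).toSphere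

variable (n) in
/-- `f` is wide: `τ₀ + τₙ = τ₁ + ⋯ + τₙ₋₁`. -/
def IsWide (f : M → Euc m) : Prop :=
  typeNumber n f 0 + typeNumber n f n = ∑ k ∈ Finset.Ioo 0 n, typeNumber n f k

end TypeNumbers

end NonnegCodimTwo

end

open NonnegCodimTwo

/-! Nonnegative curvature and the Gauss equation give ⟨α(X,X), α(Y,Y)⟩ ≥ |α(X,Y)|² ≥ 0. The vectors
α(X,X) therefore make pairwise angles of at most π/2 in the normal plane, so they lie in one
quadrant. Unit vectors ξ, η along the edges of that quadrant have A, B ≥ 0 (`exists_isPositive`).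

The height function of v is critical at p exactly when v is normal there, say v = aξ + bη, and its
Hessian is then aA + bB. If ab ≥ 0 the Hessian is semidefinite, so a nondegenerate critical point of
intermediate index needs ab < 0. The reflected vector −aξ + bη then has a semidefinite Hessian whose
determinant is at least as large in absolute value, because |det(A − B)| ≤ det(A + B) for A, B ≥ 0
(`abs_det_sub_le`, `indefiniteDet_le_definiteDet`). Up to a factor depending only on the base point,
|det| of the Hessian is the Jacobian of the map from the normal bundle to the ambient space. The
area formula thus shows that over every measurable piece of M the critical points of intermediate
index are on average at most as numerous as the extrema (`isBalanced`).

Wideness supplies the reverse inequality over all of M. The comparison is finite and additive over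
disjoint pieces, so equality holds over each piece (`IsBalanced.eq_left`). The densities are
continuous, so they agree at every point and the integrands agree at every normal vector. At v = ξ −
η this is equality between `indefiniteDet (A - B)` and `definiteDet (A + B)`. If A + B is singular,
its kernel is killed by both A and B. Otherwise, in a basis where A + B is the identity, the
eigenvalues of A − B lie in [−1, 1] and their product is ±1, so all are ±1. This makes A and B
complementary projections there (`isCompl_ker_of_abs_det_sub_eq`), and neither is zero because A − B
is not definite (`ker_alternative`).

Two devices keep the integration elementary. Counts of critical points depend only on the direction
of v, so the sphere is replaced by the ambient space with a radial weight (`lintegral_radial_mul`).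
Near a base point u₀ the normal bundle is parametrized by (u, w), where w is the projection of the
normal vector to the normal space at u₀. The area formula is then needed only for maps of a vector
space to itself (`lintegral_encard_fiber`, `abs_det_normalMap`). -/

noncomputable section

namespace NonnegCodimTwo

/-! ### Positive semidefinite matrices -/

section MatrixLemmas

open Matrix Filter Topology

variable {n : ℕ} {A B : Matrix (Fin n) (Fin n) ℝ}

/-- A real symmetric matrix is definite if it is positive or negative definite. -/
def IsDefinite (H : Matrix (Fin n) (Fin n) ℝ) : Prop := H.PosDef ∨ (-H).PosDef

open Classical in
/-- The absolute value of the determinant of a definite matrix, zero for other matrices. -/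
def definiteDet (H : Matrix (Fin n) (Fin n) ℝ) : ℝ := if IsDefinite H then |H.det| else 0

open Classical in
/-- The absolute value of the determinant of a matrix that is not definite, zero for definite
matrices. -/
def indefiniteDet (H : Matrix (Fin n) (Fin n) ℝ) : ℝ := if IsDefinite H then 0 else |H.det|

theorem definiteDet_nonneg (H : Matrix (Fin n) (Fin n) ℝ) : 0 ≤ definiteDet H := by
  unfold definiteDet; split_ifs <;> positivity

theorem indefiniteDet_nonneg (H : Matrix (Fin n) (Fin n) ℝ) : 0 ≤ indefiniteDet H := by
  unfold indefiniteDet; split_ifs <;> positivity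

theorem definiteDet_add_indefiniteDet (H : Matrix (Fin n) (Fin n) ℝ) :
    definiteDet H + indefiniteDet H = |H.det| := by
  unfold definiteDet indefiniteDet; split_ifs <;> simp

theorem IsDefinite.neg {H : Matrix (Fin n) (Fin n) ℝ} (h : IsDefinite H) : IsDefinite (-H) := by
  rcases h with h | h
  · exact Or.inr (by simpa using h)
  · exact Or.inl h

theorem isDefinite_neg {H : Matrix (Fin n) (Fin n) ℝ} : IsDefinite (-H) ↔ IsDefinite H :=
  ⟨fun h => by simpa using h.neg, fun h => h.neg⟩

theorem abs_det_neg (H : Matrix (Fin n) (Fin n) ℝ) : |(-H).det| = |H.det| := by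
  rw [det_neg, abs_mul, abs_pow, abs_neg, abs_one, one_pow, one_mul]

theorem definiteDet_neg (H : Matrix (Fin n) (Fin n) ℝ) : definiteDet (-H) = definiteDet H := by
  unfold definiteDet
  rw [abs_det_neg]
  by_cases h : IsDefinite H
  · rw [if_pos h, if_pos h.neg]
  · rw [if_neg h, if_neg fun h' => h (isDefinite_neg.1 h')]

theorem indefiniteDet_neg (H : Matrix (Fin n) (Fin n) ℝ) :
    indefiniteDet (-H) = indefiniteDet H := by
  unfold indefiniteDet
  rw [abs_det_neg]
  by_cases h : IsDefinite H
  · rw [if_pos h, if_pos h.neg]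
  · rw [if_neg h, if_neg fun h' => h (isDefinite_neg.1 h')]

theorem mulVec_eq_zero_of_posSemidef_add (hA : A.PosSemidef) (hB : B.PosSemidef)
    {x : Fin n → ℝ} (hx : (A + B) *ᵥ x = 0) : A *ᵥ x = 0 ∧ B *ᵥ x = 0 := by
  have h1 : star x ⬝ᵥ (A *ᵥ x) + star x ⬝ᵥ (B *ᵥ x) = 0 := by
    rw [← dotProduct_add, ← add_mulVec, hx, dotProduct_zero]
  have hA0 := hA.dotProduct_mulVec_nonneg x
  have hB0 := hB.dotProduct_mulVec_nonneg x
  exact ⟨(hA.dotProduct_mulVec_zero_iff x).1 (by linarith),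
    (hB.dotProduct_mulVec_zero_iff x).1 (by linarith)⟩

/-- Simultaneous normal form of `A + B` and `A - B`. -/
theorem exists_congr_of_posDef_add (hA : A.PosSemidef) (hB : B.PosSemidef)
    (hP : (A + B).PosDef) :
    ∃ Z C : Matrix (Fin n) (Fin n) ℝ, ∃ hC : C.IsHermitian, Z.det ≠ 0 ∧
      A + B = Zᴴ * Z ∧ A - B = Zᴴ * C * Z ∧ ∀ i, |hC.eigenvalues i| ≤ 1 := by
  open scoped MatrixOrder in
  obtain ⟨Z, hZ⟩ := CStarAlgebra.nonneg_iff_eq_star_mul_self.mp hP.posSemidef.nonneg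
  rw [star_eq_conjTranspose] at hZ
  have hdet : Z.det ≠ 0 := by
    intro h0
    have := hP.det_pos
    rw [hZ, det_mul, h0, mul_zero] at this
    exact lt_irrefl _ this
  have hu : IsUnit Z.det := isUnit_iff_ne_zero.2 hdet
  have hu' : IsUnit Zᴴ.det := by simpa [det_conjTranspose] using hdet
  have key : ∀ D : Matrix (Fin n) (Fin n) ℝ, Zᴴ * ((Z⁻¹)ᴴ * D * Z⁻¹) * Z = D := by
    intro D
    rw [conjTranspose_nonsing_inv]
    calc Zᴴ * (Zᴴ⁻¹ * D * Z⁻¹) * Z = (Zᴴ * Zᴴ⁻¹) * D * (Z⁻¹ * Z) := by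
          simp only [Matrix.mul_assoc]
      _ = D := by rw [mul_nonsing_inv _ hu', nonsing_inv_mul _ hu, Matrix.one_mul, Matrix.mul_one]
  have hone : (Z⁻¹)ᴴ * (A + B) * Z⁻¹ = 1 := by
    rw [hZ, conjTranspose_nonsing_inv]
    calc Zᴴ⁻¹ * (Zᴴ * Z) * Z⁻¹ = (Zᴴ⁻¹ * Zᴴ) * (Z * Z⁻¹) := by simp only [Matrix.mul_assoc]
      _ = 1 := by rw [nonsing_inv_mul _ hu', mul_nonsing_inv _ hu, Matrix.one_mul]
  have hC : ((Z⁻¹)ᴴ * (A - B) * Z⁻¹).IsHermitian :=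
    isHermitian_conjTranspose_mul_mul _ (hA.1.sub hB.1)
  refine ⟨Z, (Z⁻¹)ᴴ * (A - B) * Z⁻¹, hC, hdet, hZ, (key _).symm, fun i => ?_⟩
  set C := (Z⁻¹)ᴴ * (A - B) * Z⁻¹ with hCdef
  -- The matrices 1 + C and 1 − C are twice the transforms of A and B, hence positive semidefinite;
  -- this puts the eigenvalues of C in [−1, 1].
  have h1 : ((2 : ℝ) • ((Z⁻¹)ᴴ * A * Z⁻¹)) = 1 + C := by
    rw [← hone, hCdef, ← add_mul, ← mul_add, two_smul, ← add_mul, ← mul_add]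
    congr 2; abel
  have h2 : ((2 : ℝ) • ((Z⁻¹)ᴴ * B * Z⁻¹)) = 1 - C := by
    rw [← hone, hCdef, ← sub_mul, ← mul_sub, two_smul, ← add_mul, ← mul_add]
    congr 2; abel
  have e := hC.mulVec_eigenvectorBasis i
  set w : Fin n → ℝ := ⇑(hC.eigenvectorBasis i) with hw
  have hww : star w ⬝ᵥ w = 1 := by
    have h := hC.eigenvectorBasis.orthonormal.1 i
    have h2 : inner ℝ (hC.eigenvectorBasis i) (hC.eigenvectorBasis i) = (1 : ℝ) := by
      rw [real_inner_self_eq_norm_sq, h, one_pow]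
    rw [EuclideanSpace.inner_eq_star_dotProduct] at h2
    rw [dotProduct_comm]; exact h2
  have p1 := (hA.conjTranspose_mul_mul_same Z⁻¹).dotProduct_mulVec_nonneg w
  have p2 := (hB.conjTranspose_mul_mul_same Z⁻¹).dotProduct_mulVec_nonneg w
  have q1 : star w ⬝ᵥ ((1 + C) *ᵥ w) = 1 + hC.eigenvalues i := by
    rw [add_mulVec, one_mulVec, e, dotProduct_add, dotProduct_smul, hww]; simp
  have q2 : star w ⬝ᵥ ((1 - C) *ᵥ w) = 1 - hC.eigenvalues i := by
    rw [sub_mulVec, one_mulVec, e, dotProduct_sub, dotProduct_smul, hww]; simp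
  rw [← h1, smul_mulVec, dotProduct_smul, smul_eq_mul] at q1
  rw [← h2, smul_mulVec, dotProduct_smul, smul_eq_mul] at q2
  rw [abs_le]; constructor <;> linarith

/-- This dichotomy becomes the final alternative: a null vector of A + B is a null vector of both
summands, since the two nonnegative quadratic forms add up to zero on it. -/
theorem posDef_add_or_exists (hA : A.PosSemidef) (hB : B.PosSemidef) :
    (A + B).PosDef ∨ ∃ x ≠ 0, A *ᵥ x = 0 ∧ B *ᵥ x = 0 := by
  by_cases h : (A + B).det = 0
  · obtain ⟨x, hx, h0⟩ := exists_mulVec_eq_zero_iff.2 h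
    exact Or.inr ⟨x, hx, mulVec_eq_zero_of_posSemidef_add hA hB h0⟩
  · exact Or.inl ((hA.add hB).posDef_iff_det_ne_zero.2 h)

/-- In the simultaneous normal form the quotient of the two sides is the product of the |λᵢ| ≤ 1. If
A + B is singular, A and B share a null vector and the left side vanishes. -/
theorem abs_det_sub_le (hA : A.PosSemidef) (hB : B.PosSemidef) :
    |(A - B).det| ≤ (A + B).det := by
  rcases posDef_add_or_exists hA hB with hP | ⟨x, hx, hAx, hBx⟩
  · obtain ⟨Z, C, hC, -, h1, h2, h3⟩ := exists_congr_of_posDef_add hA hB hP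
    rw [h1, h2, det_mul, det_mul, det_mul, det_conjTranspose, star_trivial,
      hC.det_eq_prod_eigenvalues, abs_mul, abs_mul]
    simp only [RCLike.ofReal_real_eq_id, id, Finset.abs_prod]
    have : ∏ i, |hC.eigenvalues i| ≤ 1 :=
      Finset.prod_le_one (fun i _ => abs_nonneg _) (fun i _ => h3 i)
    calc |Z.det| * (∏ i, |hC.eigenvalues i|) * |Z.det| ≤ |Z.det| * 1 * |Z.det| := by gcongr
      _ = Z.det * Z.det := by rw [mul_one, abs_mul_abs_self]
  · have : (A - B).det = 0 :=
      exists_mulVec_eq_zero_iff.1 ⟨x, hx, by rw [sub_mulVec, hAx, hBx, sub_zero]⟩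
    rw [this, abs_zero]
    exact (hA.add hB).det_nonneg

/-- If `|det (A - B)| = det (A + B) ≠ 0`, the two matrices are complementary. -/
theorem isCompl_ker_of_abs_det_sub_eq (hA : A.PosSemidef) (hB : B.PosSemidef)
    (hP : (A + B).PosDef) (h : |(A - B).det| = (A + B).det) :
    IsCompl (LinearMap.ker A.mulVecLin) (LinearMap.ker B.mulVecLin) := by
  obtain ⟨Z, C, hC, hZ, h1, h2, h3⟩ := exists_congr_of_posDef_add hA hB hP
  have hprod : ∏ i, |hC.eigenvalues i| = 1 := by
    rw [h1, h2, det_mul, det_mul, det_mul, det_conjTranspose, star_trivial,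
      hC.det_eq_prod_eigenvalues, abs_mul, abs_mul] at h
    simp only [RCLike.ofReal_real_eq_id, id, Finset.abs_prod] at h
    have hz : |Z.det| * |Z.det| ≠ 0 := by positivity
    rw [← abs_mul_abs_self Z.det] at h
    apply mul_left_cancel₀ hz
    linarith
  -- Factors in [0, 1] with product 1 are all 1. Hence C is a symmetric involution, and D = A − B, S
  -- = A + B satisfy D S⁻¹ D = S.
  have hev : ∀ i, |hC.eigenvalues i| = 1 := by
    intro i
    refine le_antisymm (h3 i) ?_
    rw [← hprod, ← Finset.mul_prod_erase _ _ (Finset.mem_univ i)]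
    exact mul_le_of_le_one_right (abs_nonneg _)
      (Finset.prod_le_one (fun i _ => abs_nonneg _) (fun i _ => h3 i))
  have hCC : C * C = 1 := by
    have hs := hC.spectral_theorem
    have hd : diagonal (RCLike.ofReal (K := ℝ) ∘ hC.eigenvalues) *
        diagonal (RCLike.ofReal (K := ℝ) ∘ hC.eigenvalues) = 1 := by
      rw [diagonal_mul_diagonal, ← diagonal_one]
      congr 1
      ext i
      simpa using (abs_mul_abs_self (hC.eigenvalues i)).symm.trans (by rw [hev i, one_mul])
    rw [hs, ← map_mul, hd, map_one]
  have hPu : IsUnit (A + B).det := isUnit_iff_ne_zero.2 hP.det_pos.ne'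
  have hu : IsUnit Z.det := isUnit_iff_ne_zero.2 hZ
  have hu' : IsUnit Zᴴ.det := by simpa [det_conjTranspose] using hZ
  have hPi : (A + B)⁻¹ = Z⁻¹ * Zᴴ⁻¹ := by rw [h1, Matrix.mul_inv_rev]
  have hDD : (A - B) * (A + B)⁻¹ * (A - B) = A + B := by
    rw [h2, hPi, h1]
    calc Zᴴ * C * Z * (Z⁻¹ * Zᴴ⁻¹) * (Zᴴ * C * Z)
        = Zᴴ * C * (Z * Z⁻¹) * (Zᴴ⁻¹ * Zᴴ) * (C * Z) := by simp only [Matrix.mul_assoc]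
      _ = Zᴴ * (C * C) * Z := by
          rw [mul_nonsing_inv _ hu, nonsing_inv_mul _ hu']
          simp only [Matrix.mul_assoc, Matrix.mul_one]
      _ = Zᴴ * Z := by rw [hCC, Matrix.mul_one]
  have hSD : (A + B) * (A + B)⁻¹ * (A - B) = A - B := by
    rw [mul_nonsing_inv _ hPu, Matrix.one_mul]
  have hDS : (A - B) * (A + B)⁻¹ * (A + B) = A - B := by
    rw [Matrix.mul_assoc, nonsing_inv_mul _ hPu, Matrix.mul_one]
  have hSS : (A + B) * (A + B)⁻¹ * (A + B) = A + B := by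
    rw [mul_nonsing_inv _ hPu, Matrix.one_mul]
  -- With S and D as sum and difference, 4 A S⁻¹ B = (S + D) S⁻¹ (S − D) = S − D + D − S = 0.
  have hAB : A * (A + B)⁻¹ * B = 0 := by
    have : (4 : ℝ) • (A * (A + B)⁻¹ * B) =
        (A + B) * (A + B)⁻¹ * (A + B) - (A + B) * (A + B)⁻¹ * (A - B)
        + (A - B) * (A + B)⁻¹ * (A + B) - (A - B) * (A + B)⁻¹ * (A - B) := by
      generalize (A + B)⁻¹ = Q
      simp only [add_mul, mul_add, sub_mul, mul_sub]
      module
    rw [hSS, hSD, hDS, hDD] at this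
    have h4 : (4 : ℝ) • (A * (A + B)⁻¹ * B) = 0 := by rw [this]; abel
    exact (smul_eq_zero.1 h4).resolve_left (by norm_num)
  have hBA : B * (A + B)⁻¹ * A = 0 := by
    have : (4 : ℝ) • (B * (A + B)⁻¹ * A) =
        (A + B) * (A + B)⁻¹ * (A + B) + (A + B) * (A + B)⁻¹ * (A - B)
        - (A - B) * (A + B)⁻¹ * (A + B) - (A - B) * (A + B)⁻¹ * (A - B) := by
      generalize (A + B)⁻¹ = Q
      simp only [add_mul, mul_add, sub_mul, mul_sub]
      module
    rw [hSS, hSD, hDS, hDD] at this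
    have h4 : (4 : ℝ) • (B * (A + B)⁻¹ * A) = 0 := by rw [this]; abel
    exact (smul_eq_zero.1 h4).resolve_left (by norm_num)
  rw [isCompl_iff, disjoint_iff, codisjoint_iff]
  constructor
  · rw [Submodule.eq_bot_iff]
    rintro x ⟨hx1, hx2⟩
    simp only [SetLike.mem_coe, LinearMap.mem_ker, mulVecLin_apply] at hx1 hx2
    by_contra hx
    have := hP.dotProduct_mulVec_pos hx
    rw [add_mulVec, hx1, hx2, add_zero, dotProduct_zero] at this
    exact lt_irrefl _ this
  · rw [Submodule.eq_top_iff']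
    intro x
    rw [Submodule.mem_sup]
    -- The splitting is x = S⁻¹Bx + S⁻¹Ax with S = A + B. The products A S⁻¹ B and B S⁻¹ A vanish,
    -- so the summands lie in the two kernels.
    refine ⟨((A + B)⁻¹ * B) *ᵥ x, ?_, ((A + B)⁻¹ * A) *ᵥ x, ?_, ?_⟩
    · simp only [LinearMap.mem_ker, mulVecLin_apply, mulVec_mulVec, ← Matrix.mul_assoc]
      rw [hAB, zero_mulVec]
    · simp only [LinearMap.mem_ker, mulVecLin_apply, mulVec_mulVec, ← Matrix.mul_assoc]
      rw [hBA, zero_mulVec]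
    · rw [← add_mulVec, ← mul_add, add_comm B A, nonsing_inv_mul _ hPu, one_mulVec]

theorem isDefinite_of_posSemidef {H : Matrix (Fin n) (Fin n) ℝ} (hH : H.PosSemidef)
    (hdet : H.det ≠ 0) : IsDefinite H :=
  Or.inl (hH.posDef_iff_det_ne_zero.2 hdet)

theorem definiteDet_eq_of_posSemidef {H : Matrix (Fin n) (Fin n) ℝ} (hH : H.PosSemidef) :
    definiteDet H = |H.det| := by
  unfold definiteDet
  split_ifs with h
  · rfl
  · by_contra h0
    exact h (isDefinite_of_posSemidef hH fun h1 => h0 (by rw [h1, abs_zero]))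

theorem indefiniteDet_eq_of_posSemidef {H : Matrix (Fin n) (Fin n) ℝ} (hH : H.PosSemidef) :
    indefiniteDet H = 0 := by
  have := definiteDet_add_indefiniteDet H
  rw [definiteDet_eq_of_posSemidef hH] at this
  linarith

theorem indefiniteDet_le_abs_det (H : Matrix (Fin n) (Fin n) ℝ) : indefiniteDet H ≤ |H.det| := by
  have := definiteDet_add_indefiniteDet H
  linarith [definiteDet_nonneg H]

/-- The comparison of indefinite and definite determinants under a reflection of the normal
plane. -/
theorem indefiniteDet_le_definiteDet (hA : A.PosSemidef) (hB : B.PosSemidef) (a b : ℝ) :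
    indefiniteDet (a • A + b • B) ≤ definiteDet (-a • A + b • B) := by
  -- With equal signs the left matrix is semidefinite and contributes nothing; with opposite signs
  -- the right one is semidefinite and `abs_det_sub_le` applies. Replacing H by −H reduces all sign
  -- patterns to b ≥ 0.
  have pos : ∀ a b : ℝ, 0 ≤ a → 0 ≤ b →
      indefiniteDet (a • A + b • B) ≤ definiteDet (-a • A + b • B) := by
    intro a b ha hb
    rw [indefiniteDet_eq_of_posSemidef ((hA.smul ha).add (hB.smul hb))]
    exact definiteDet_nonneg _
  have neg : ∀ a b : ℝ, 0 ≤ a → 0 ≤ b →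
      indefiniteDet ((-a) • A + b • B) ≤ definiteDet (a • A + b • B) := by
    intro a b ha hb
    have h1 := hA.smul ha
    have h2 := hB.smul hb
    rw [definiteDet_eq_of_posSemidef (h1.add h2), ← indefiniteDet_neg]
    refine (indefiniteDet_le_abs_det _).trans ?_
    have : -(-a • A + b • B) = a • A - b • B := by rw [neg_smul]; abel
    rw [this]
    exact (abs_det_sub_le h1 h2).trans (le_abs_self _)
  rcases le_total 0 a with ha | ha <;> rcases le_total 0 b with hb | hb
  · exact pos a b ha hb
  · have := neg a (-b) ha (by linarith)
    rw [← indefiniteDet_neg, ← definiteDet_neg]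
    have e1 : -(a • A + b • B) = -a • A + -b • B := by rw [neg_smul, neg_smul]; abel
    have e2 : -(-a • A + b • B) = a • A + -b • B := by rw [neg_smul, neg_smul]; abel
    rw [e1, e2]; exact this
  · have := neg (-a) b (by linarith) hb
    rwa [neg_neg] at this
  · have := pos (-a) (-b) (by linarith) (by linarith)
    rw [← indefiniteDet_neg, ← definiteDet_neg]
    have e1 : -(a • A + b • B) = -a • A + -b • B := by rw [neg_smul, neg_smul]; abel
    have e2 : -(-a • A + b • B) = - -a • A + -b • B := by module
    rw [e1, e2]; exact this

/-- The equality case of the comparison. -/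
theorem ker_alternative (hA : A.PosSemidef) (hB : B.PosSemidef)
    (h : indefiniteDet (A - B) = definiteDet (A + B)) :
    (IsCompl (LinearMap.ker A.mulVecLin) (LinearMap.ker B.mulVecLin) ∧ A ≠ 0 ∧ B ≠ 0) ∨
      ∃ x ≠ 0, A *ᵥ x = 0 ∧ B *ᵥ x = 0 := by
  rcases posDef_add_or_exists hA hB with hP | hx
  · left
    rw [definiteDet_eq_of_posSemidef hP.posSemidef, abs_of_pos hP.det_pos] at h
    -- The common value det(A + B) is positive, whereas `indefiniteDet` vanishes on definite
    -- matrices. If A or B were zero, A − B would be definite.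
    have hnd : ¬ IsDefinite (A - B) := by
      intro hd
      have := hP.det_pos
      rw [← h, indefiniteDet, if_pos hd] at this
      exact lt_irrefl _ this
    rw [indefiniteDet, if_neg hnd] at h
    refine ⟨isCompl_ker_of_abs_det_sub_eq hA hB hP h, ?_, ?_⟩
    · rintro rfl
      exact hnd (Or.inr (by simpa using hP))
    · rintro rfl
      exact hnd (Or.inl (by simpa using hP))
  · exact Or.inr hx

/-! ### Openness of definiteness and continuity of the truncated determinants -/

theorem eventually_posDef {H : Matrix (Fin n) (Fin n) ℝ} (hH : H.PosDef) :
    ∀ᶠ H' in 𝓝[{H' : Matrix (Fin n) (Fin n) ℝ | H'.IsHermitian}] H, H'.PosDef := by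
  have hcont : Continuous fun z : Matrix (Fin n) (Fin n) ℝ × (Fin n → ℝ) =>
      z.2 ⬝ᵥ (z.1 *ᵥ z.2) := by fun_prop
  have hc : IsCompact (Metric.sphere (0 : Fin n → ℝ) 1) := isCompact_sphere _ _
  -- Compactness of the unit sphere makes positivity of the form persist on one neighbourhood for
  -- all unit vectors at once; homogeneity extends it to all nonzero vectors.
  have := hc.eventually_forall_of_forall_eventually (x₀ := H)
    (P := fun H' x => 0 < x ⬝ᵥ (H' *ᵥ x)) (by
      intro x hx
      have hx0 : x ≠ 0 := by
        rintro rfl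
        simp at hx
      exact hcont.continuousAt.eventually_const_lt
        (by simpa using hH.dotProduct_mulVec_pos hx0))
  filter_upwards [nhdsWithin_le_nhds this, self_mem_nhdsWithin] with H' h1 h2
  refine .of_dotProduct_mulVec_pos h2 fun x hx => ?_
  have hn : 0 < ‖x‖ := norm_pos_iff.2 hx
  have h3 := h1 (‖x‖⁻¹ • x) (by simp [norm_smul, hn.ne'])
  rw [mulVec_smul, dotProduct_smul, smul_dotProduct, smul_eq_mul, smul_eq_mul] at h3
  rw [star_trivial]
  have h4 : 0 < ‖x‖⁻¹ := inv_pos.2 hn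
  exact (mul_pos_iff_of_pos_left h4).1 ((mul_pos_iff_of_pos_left h4).1 h3)

theorem eventually_not_posSemidef {H : Matrix (Fin n) (Fin n) ℝ} (hH : H.IsHermitian)
    (h : ¬ H.PosSemidef) : ∀ᶠ H' in 𝓝 H, ¬ H'.PosSemidef := by
  rw [posSemidef_iff_dotProduct_mulVec] at h
  push Not at h
  obtain ⟨x, hx⟩ := h hH
  have hcont : Continuous fun H' : Matrix (Fin n) (Fin n) ℝ => star x ⬝ᵥ (H' *ᵥ x) := by
    fun_prop
  filter_upwards [hcont.continuousAt.eventually_lt_const hx] with H' h1 h2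
  exact absurd (h2.dotProduct_mulVec_nonneg x) (not_le.2 h1)

/-- Among symmetric matrices the definite ones form an open set, and a singular matrix is approached
with |det| tending to zero, so truncation creates no jump. A nonsingular indefinite matrix has a
neighbourhood of non-definite ones. -/
theorem continuousOn_definiteDet :
    ContinuousOn (definiteDet (n := n)) {H | H.IsHermitian} := by
  have hd : Continuous fun H : Matrix (Fin n) (Fin n) ℝ => |H.det| := by fun_prop
  intro H hH
  by_cases h : IsDefinite H
  · have : ∀ᶠ H' in 𝓝[{H' : Matrix (Fin n) (Fin n) ℝ | H'.IsHermitian}] H, IsDefinite H' := by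
      rcases h with h | h
      · filter_upwards [eventually_posDef h] with H' h' using Or.inl h'
      · have ht : Tendsto (fun H' : Matrix (Fin n) (Fin n) ℝ => -H')
            (𝓝[{H' : Matrix (Fin n) (Fin n) ℝ | H'.IsHermitian}] H)
            (𝓝[{H' : Matrix (Fin n) (Fin n) ℝ | H'.IsHermitian}] (-H)) :=
          tendsto_nhdsWithin_of_tendsto_nhds_of_eventually_within _
            ((continuous_neg.tendsto H).mono_left nhdsWithin_le_nhds)
            (by filter_upwards [self_mem_nhdsWithin] with H' h' using h'.neg)
        filter_upwards [ht.eventually (eventually_posDef h)] with H' h' using Or.inr h'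
    refine (hd.continuousAt.continuousWithinAt).congr_of_eventuallyEq ?_ ?_
    · filter_upwards [this] with H' h'
      rw [definiteDet, if_pos h']
    · rw [definiteDet, if_pos h]
  · have hz : definiteDet H = 0 := by rw [definiteDet, if_neg h]
    by_cases h0 : H.det = 0
    · rw [ContinuousWithinAt, hz]
      refine tendsto_of_tendsto_of_tendsto_of_le_of_le (tendsto_const_nhds (x := (0 : ℝ)))
        (h := fun H : Matrix (Fin n) (Fin n) ℝ => |H.det|) ?_ (fun _ => definiteDet_nonneg _) ?_
      · have := (hd.tendsto H).mono_left (nhdsWithin_le_nhds (s := {H | H.IsHermitian}))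
        rwa [h0, abs_zero] at this
      · intro H'
        have := definiteDet_add_indefiniteDet H'
        have := indefiniteDet_nonneg H'
        linarith
    · have h1 : ¬ H.PosSemidef := fun hp => h (isDefinite_of_posSemidef hp h0)
      have h2 : ¬ (-H).PosSemidef := fun hp => h (isDefinite_neg.1
        (isDefinite_of_posSemidef hp (by simpa [det_neg] using h0)))
      have e1 := eventually_not_posSemidef hH h1
      have e2 := (continuous_neg.tendsto H).eventually
        (eventually_not_posSemidef hH.neg h2)
      refine (continuousWithinAt_const (b := (0 : ℝ))).congr_of_eventuallyEq ?_ hz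
      filter_upwards [nhdsWithin_le_nhds e1, nhdsWithin_le_nhds e2] with H' h1' h2'
      rw [definiteDet, if_neg]
      rintro (h' | h')
      · exact h1' h'.posSemidef
      · exact h2' h'.posSemidef

theorem continuousOn_indefiniteDet :
    ContinuousOn (indefiniteDet (n := n)) {H | H.IsHermitian} := by
  have hd : Continuous fun H : Matrix (Fin n) (Fin n) ℝ => |H.det| := by fun_prop
  refine (hd.continuousOn.sub continuousOn_definiteDet).congr fun H _ => ?_
  rw [Pi.sub_apply, ← definiteDet_add_indefiniteDet H]; ring

/-! ### The index of a nondegenerate form -/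

variable {Q : QuadraticForm ℝ (Euc n)} {H : Matrix (Fin n) (Fin n) ℝ}

/-- Index zero only says that the form is positive semidefinite; nondegeneracy upgrades this to
definiteness. The companion statement for index n needs no such hypothesis. -/
theorem sigNeg_eq_zero_iff (hH : H.IsHermitian) (hdet : H.det ≠ 0)
    (hQ : ∀ x : Euc n, Q x = x.ofLp ⬝ᵥ (H *ᵥ x.ofLp)) : sigNeg Q = 0 ↔ H.PosDef := by
  constructor
  · intro h
    refine (PosSemidef.posDef_iff_det_ne_zero ?_).2 hdet
    refine .of_dotProduct_mulVec_nonneg hH fun x => ?_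
    by_contra! hx
    have hx' : Q (WithLp.toLp 2 x) < 0 := by rw [hQ]; simpa using hx
    have hne : WithLp.toLp 2 x ≠ 0 := by
      intro h0; rw [h0] at hx'; simp at hx'
    have hle := le_sigNeg_of_negDef (Q := Q) (V := Submodule.span ℝ {WithLp.toLp 2 x}) (by
      rintro ⟨y, hy⟩ hy0
      obtain ⟨c, rfl⟩ := Submodule.mem_span_singleton.1 hy
      have hc : c ≠ 0 := by
        rintro rfl
        exact hy0 (by simp)
      simp only [QuadraticMap.restrict_apply, _root_.neg_apply, QuadraticMap.map_smul,
        smul_eq_mul]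
      have := mul_self_pos.2 hc
      nlinarith)
    rw [finrank_span_singleton hne, h] at hle
    omega
  · intro h
    obtain ⟨V, hV, hneg⟩ := exists_finrank_eq_sigNeg_and_negDef Q
    rw [← hV]
    have : V = ⊥ := by
      rw [Submodule.eq_bot_iff]
      intro x hx
      by_contra hx0
      have h1 := hneg ⟨x, hx⟩ (by simpa using hx0)
      simp only [QuadraticMap.restrict_apply, _root_.neg_apply] at h1
      rw [hQ] at h1
      have h2 := h.dotProduct_mulVec_pos (x := x.ofLp) (by simpa using hx0)
      rw [star_trivial] at h2
      linarith
    rw [this, finrank_bot]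

theorem sigNeg_eq_card_iff (hH : H.IsHermitian)
    (hQ : ∀ x : Euc n, Q x = x.ofLp ⬝ᵥ (H *ᵥ x.ofLp)) : sigNeg Q = n ↔ (-H).PosDef := by
  constructor
  · intro h
    obtain ⟨V, hV, hneg⟩ := exists_finrank_eq_sigNeg_and_negDef Q
    rw [h] at hV
    have hVt : V = ⊤ := Submodule.eq_top_of_finrank_eq (by rw [hV]; simp)
    refine .of_dotProduct_mulVec_pos hH.neg fun x hx => ?_
    have := hneg ⟨WithLp.toLp 2 x, by rw [hVt]; trivial⟩ (by simpa using hx)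
    simp only [QuadraticMap.restrict_apply, _root_.neg_apply, hQ] at this
    simpa [neg_mulVec] using this
  · intro h
    refine le_antisymm ?_ ?_
    · have := sigPos_le_finrank (-Q)
      simpa using this
    · have := le_sigNeg_of_negDef (Q := Q) (V := ⊤) (by
        rintro ⟨x, hx⟩ hx0
        simp only [QuadraticMap.restrict_apply, _root_.neg_apply, hQ]
        have h2 := h.dotProduct_mulVec_pos (x := x.ofLp) (by simpa using hx0)
        simpa [neg_mulVec] using h2)
      simpa using this

end MatrixLemmas

/-! ### The area formula with multiplicity -/

section AreaFormula

open Set Filter Topology Function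

variable {E : Type*} [NormedAddCommGroup E] [NormedSpace ℝ E] [FiniteDimensional ℝ E]
  [MeasurableSpace E] [BorelSpace E] (μ : Measure E) [μ.IsAddHaarMeasure]

/-- A function with invertible derivatives is injective on the pieces of a countable measurable
partition. -/
theorem exists_partition_injOn {G : E → E} {G' : E → E →L[ℝ] E} {A : Set E}
    (hG : ∀ x ∈ A, HasFDerivWithinAt G (G' x) A x) (hdet : ∀ x ∈ A, (G' x).det ≠ 0) :
    ∃ t : ℕ → Set E, Pairwise (Disjoint on t) ∧ (∀ n, MeasurableSet (t n)) ∧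
      (A ⊆ ⋃ n, t n) ∧ ∀ n, InjOn G (A ∩ t n) := by
  rcases A.eq_empty_or_nonempty with rfl | hne
  · exact ⟨fun _ => ∅, fun _ _ _ => by simp [Function.onFun], fun _ => MeasurableSet.empty,
      empty_subset _, fun _ => by simp⟩
  -- In dimension zero the inverse has norm zero and yields no positive constant below, so this case
  -- uses a single piece.
  rcases subsingleton_or_nontrivial E with hE | hE
  · refine ⟨fun n => if n = 0 then univ else ∅, ?_, ?_, ?_, fun n => injOn_of_subsingleton _ _⟩
    · intro i j hij
      simp only [Function.onFun]
      split_ifs with h1 h2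
      · exact absurd (h1.trans h2.symm) hij
      · simp
      · simp
      · simp
    · intro n
      dsimp only
      split_ifs
      · exact MeasurableSet.univ
      · exact MeasurableSet.empty
    · intro x _
      exact mem_iUnion.2 ⟨0, by simp⟩
  -- A map closer to an invertible L than ‖L⁻¹‖⁻¹ is injective. The partition lemma wants a constant
  -- for every L, so singular ones get the dummy value 1.
  have hδ : ∀ L : E →L[ℝ] E, ∃ δ : NNReal, δ ≠ 0 ∧ (L.det ≠ 0 →
      ∀ (s : Set E) (f : E → E), ApproximatesLinearOn f L s δ → InjOn f s) := by
    intro L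
    by_cases hL : L.det = 0
    · exact ⟨1, one_ne_zero, fun h => absurd hL h⟩
    · let e := L.toContinuousLinearEquivOfDetNeZero hL
      have he : (e : E →L[ℝ] E) = L := by ext; rfl
      have hpos : (0 : NNReal) < ‖(e.symm : E →L[ℝ] E)‖₊⁻¹ := by
        rw [inv_pos]
        exact e.nnnorm_symm_pos
      refine ⟨‖(e.symm : E →L[ℝ] E)‖₊⁻¹ / 2, (half_pos hpos).ne', fun _ s f hf => ?_⟩
      rw [← he] at hf
      exact hf.injOn (Or.inr (half_lt_self hpos))
  choose δ hδ0 hδ1 using hδ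
  obtain ⟨t, L, h1, h2, h3, h4, h5⟩ :=
    exists_partition_approximatesLinearOn_of_hasFDerivWithinAt G A G' hG δ hδ0
  refine ⟨t, h1, h2, h3, fun n => ?_⟩
  obtain ⟨y, hy, hLy⟩ := h5 hne n
  exact hδ1 (L n) (by rw [hLy]; exact hdet y hy) _ _ (h4 n)

/-- Each piece meets a fiber in at most one point, so the multiplicity is the sum of the indicators
of the images. -/
theorem encard_fiber_eq_tsum {X : Type*} {G : X → X} {A : Set X} {t : ℕ → Set X}
    (hd : Pairwise (Disjoint on t)) (hA : A ⊆ ⋃ n, t n) (hinj : ∀ n, InjOn G (A ∩ t n)) (y : X) :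
    (({x | x ∈ A ∧ G x = y}.encard : ℕ∞) : ℝ≥0∞) =
      ∑' n, (G '' (A ∩ t n)).indicator (fun _ => (1 : ℝ≥0∞)) y := by
  have hU : {x | x ∈ A ∧ G x = y} = ⋃ n, {x | x ∈ A ∩ t n ∧ G x = y} := by
    ext x
    simp only [mem_ofPred_eq, mem_iUnion, mem_inter_iff]
    constructor
    · rintro ⟨hx, hy⟩
      obtain ⟨n, hn⟩ := mem_iUnion.1 (hA hx)
      exact ⟨n, ⟨hx, hn⟩, hy⟩
    · rintro ⟨n, ⟨hx, -⟩, hy⟩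
      exact ⟨hx, hy⟩
  have key := ENNReal.tsum_biUnion' (f := fun _ : X => (1 : ℝ≥0∞)) (S := (univ : Set ℕ))
    (t := fun n => {x | x ∈ A ∩ t n ∧ G x = y}) (by
      intro i _ j _ hij
      exact (hd hij).mono (fun x hx => hx.1.2) (fun x hx => hx.1.2))
  simp only [biUnion_univ, ENNReal.tsum_set_one] at key
  rw [hU, key, tsum_univ (fun n => (({x | x ∈ A ∩ t n ∧ G x = y}.encard : ℕ∞) : ℝ≥0∞))]
  refine tsum_congr fun n => ?_
  by_cases hy : y ∈ G '' (A ∩ t n)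
  · obtain ⟨x, hx, rfl⟩ := hy
    rw [indicator_of_mem (mem_image_of_mem G hx)]
    have : {z | z ∈ A ∩ t n ∧ G z = G x} = {x} := by
      ext z
      simp only [mem_ofPred_eq, mem_singleton_iff]
      exact ⟨fun hz => hinj n hz.1 hx hz.2, fun hz => by rw [hz]; exact ⟨hx, rfl⟩⟩
    rw [this, encard_singleton]; simp
  · rw [indicator_of_notMem hy]
    have : {z | z ∈ A ∩ t n ∧ G z = y} = ∅ := by
      ext z
      simp only [mem_ofPred_eq, mem_empty_iff_false, iff_false]
      exact fun hz => hy ⟨z, hz.1, hz.2⟩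
    rw [this, encard_empty]; simp

/-- The number of preimages under a map with invertible derivatives is measurable. -/
theorem measurable_encard_fiber {G : E → E} {G' : E → E →L[ℝ] E} {A : Set E}
    (hA : MeasurableSet A)
    (hG : ∀ x ∈ A, HasFDerivWithinAt G (G' x) A x) (hdet : ∀ x ∈ A, (G' x).det ≠ 0) :
    Measurable fun y => (({x | x ∈ A ∧ G x = y}.encard : ℕ∞) : ℝ≥0∞) := by
  obtain ⟨t, h1, h2, h3, h4⟩ := exists_partition_injOn hG hdet
  simp_rw [encard_fiber_eq_tsum h1 h3 h4]
  refine Measurable.tsum fun n => measurable_const.indicator ?_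
  exact measurable_image_of_fderivWithin (hA.inter (h2 n))
    (fun x hx => (hG x hx.1).mono inter_subset_left) (h4 n)

/-- The area formula for a map with invertible derivatives. -/
theorem lintegral_encard_fiber {G : E → E} {G' : E → E →L[ℝ] E} {A : Set E}
    (hA : MeasurableSet A)
    (hG : ∀ x ∈ A, HasFDerivWithinAt G (G' x) A x) (hdet : ∀ x ∈ A, (G' x).det ≠ 0)
    {ρ : E → ℝ≥0∞} (hρ : Measurable ρ) :
    ∫⁻ y, ρ y * (({x | x ∈ A ∧ G x = y}.encard : ℕ∞) : ℝ≥0∞) ∂μ =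
      ∫⁻ x in A, ENNReal.ofReal |(G' x).det| * ρ (G x) ∂μ := by
  obtain ⟨t, h1, h2, h3, h4⟩ := exists_partition_injOn hG hdet
  have hm : ∀ n, MeasurableSet (G '' (A ∩ t n)) := fun n =>
    measurable_image_of_fderivWithin (hA.inter (h2 n))
      (fun x hx => (hG x hx.1).mono inter_subset_left) (h4 n)
  have hAt : A = ⋃ n, A ∩ t n := by rw [← inter_iUnion, inter_eq_self_of_subset_left h3]
  calc ∫⁻ y, ρ y * (({x | x ∈ A ∧ G x = y}.encard : ℕ∞) : ℝ≥0∞) ∂μ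
      = ∫⁻ y, ∑' n, (G '' (A ∩ t n)).indicator ρ y ∂μ := by
        refine lintegral_congr fun y => ?_
        rw [encard_fiber_eq_tsum h1 h3 h4, ← ENNReal.tsum_mul_left]
        refine tsum_congr fun n => ?_
        by_cases hy : y ∈ G '' (A ∩ t n)
        · rw [indicator_of_mem hy, indicator_of_mem hy, mul_one]
        · rw [indicator_of_notMem hy, indicator_of_notMem hy, mul_zero]
    _ = ∑' n, ∫⁻ y in G '' (A ∩ t n), ρ y ∂μ := by
        rw [lintegral_tsum fun n => (hρ.indicator (hm n)).aemeasurable]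
        exact tsum_congr fun n => lintegral_indicator (hm n) _
    _ = ∑' n, ∫⁻ x in A ∩ t n, ENNReal.ofReal |(G' x).det| * ρ (G x) ∂μ :=
        tsum_congr fun n => lintegral_image_eq_lintegral_abs_det_fderiv_mul μ
          (hA.inter (h2 n)) (fun x hx => (hG x hx.1).mono inter_subset_left) (h4 n) ρ
    _ = ∫⁻ x in A, ENNReal.ofReal |(G' x).det| * ρ (G x) ∂μ := by
        conv_rhs => rw [hAt]
        rw [lintegral_iUnion (fun n => hA.inter (h2 n))
          (fun i j hij => (h1 hij).mono inter_subset_right inter_subset_right)]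

end AreaFormula

/-! ### Polar coordinates -/

section Polar

open Set Measure

variable {E : Type*} [NormedAddCommGroup E] [NormedSpace ℝ E] [FiniteDimensional ℝ E]
  [MeasurableSpace E] [BorelSpace E] (μ : Measure E) [μ.IsAddHaarMeasure]

/-- Integration of a function of degree zero against a radial weight. -/
theorem lintegral_radial_mul [Nontrivial E] {ρ : ℝ → ℝ≥0∞} (hρ : Measurable ρ)
    {g : E → ℝ≥0∞} (hg : AEMeasurable g μ) (hhom : ∀ (r : ℝ) (v : E), 0 < r → g (r • v) = g v)
    (hfin : ∫⁻ r, ρ (r : ℝ) ∂(volumeIoiPow (Module.finrank ℝ E - 1)) ≠ ⊤) :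
    ∫⁻ v, ρ ‖v‖ * g v ∂μ =
      (∫⁻ r, ρ (r : ℝ) ∂(volumeIoiPow (Module.finrank ℝ E - 1))) *
        ∫⁻ v : Metric.sphere (0 : E) 1, g v ∂μ.toSphere := by
  have hms : MeasurableSet ({0}ᶜ : Set E) := (measurableSet_singleton _).compl
  have hmp := μ.measurePreserving_homeomorphUnitSphereProd
  have hemb := (homeomorphUnitSphereProd E).measurableEmbedding
  let F : Metric.sphere (0 : E) 1 × Ioi (0 : ℝ) → ℝ≥0∞ := fun z => ρ z.2 * g z.1
  have hF : ∀ x : ({0}ᶜ : Set E), F (homeomorphUnitSphereProd E x) = ρ ‖(x : E)‖ * g x := by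
    intro x
    have hx : 0 < ‖(x : E)‖ := norm_pos_iff.2 x.2
    simp only [F, homeomorphUnitSphereProd_apply_snd_coe, homeomorphUnitSphereProd_apply_fst_coe]
    rw [hhom _ _ (inv_pos.2 hx)]
  have h0 : ∫⁻ v, ρ ‖v‖ * g v ∂μ = ∫⁻ x : ({0}ᶜ : Set E), ρ ‖(x : E)‖ * g x ∂(μ.comap (↑)) := by
    rw [lintegral_subtype_comap hms (fun x => ρ ‖x‖ * g x), restrict_compl_singleton]
  have hFm : AEMeasurable F (μ.toSphere.prod (volumeIoiPow (Module.finrank ℝ E - 1))) := by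
    rw [← hmp.map_eq, hemb.aemeasurable_map_iff]
    have : (F ∘ homeomorphUnitSphereProd E) = (fun v => ρ ‖v‖ * g v) ∘ ((↑) : ({0}ᶜ : Set E) → E) :=
      funext hF
    rw [this]
    refine AEMeasurable.comp_quasiMeasurePreserving (ν := μ) ?_ ?_
    · exact (hρ.comp measurable_norm).aemeasurable.mul hg
    · refine ⟨measurable_subtype_coe, ?_⟩
      rw [(MeasurableEmbedding.subtype_coe hms).map_comap]
      exact Measure.absolutelyContinuous_of_le Measure.restrict_le_self
  rw [h0]
  simp_rw [← hF]
  rw [hmp.lintegral_comp_emb hemb F, lintegral_prod _ hFm, mul_comm]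
  simp only [F]
  -- Finiteness of the radial factor lets it move inside the sphere integral without measurability
  -- of the restriction of g to the sphere.
  rw [← lintegral_mul_const' _ _ hfin]
  refine lintegral_congr fun v => ?_
  have hρ' : Measurable fun y : Ioi (0 : ℝ) => ρ y := hρ.comp measurable_subtype_coe
  rw [lintegral_mul_const _ hρ', mul_comm]

end Polar

/-! ### Local parametrization of the normal bundle of an immersed patch -/

section Patch

open Set Filter Topology

/-- The matrix is block triangular with an identity block for the second factor. -/
theorem det_prod_snd {X Y : Type*} [NormedAddCommGroup X] [NormedSpace ℝ X]
    [FiniteDimensional ℝ X] [NormedAddCommGroup Y] [NormedSpace ℝ Y] [FiniteDimensional ℝ Y]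
    (L : X × Y →L[ℝ] X) :
    (L.prod (ContinuousLinearMap.snd ℝ X Y)).det =
      (L.comp (ContinuousLinearMap.inl ℝ X Y)).det := by
  let b := Module.finBasis ℝ X
  let c := Module.finBasis ℝ Y
  have h : LinearMap.toMatrix (b.prod c) (b.prod c)
      (L.prod (ContinuousLinearMap.snd ℝ X Y)).toLinearMap =
      Matrix.fromBlocks
        (LinearMap.toMatrix b b (L.comp (ContinuousLinearMap.inl ℝ X Y)).toLinearMap)
        (LinearMap.toMatrix c b (L.comp (ContinuousLinearMap.inr ℝ X Y)).toLinearMap) 0 1 := by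
    ext i j
    rcases i with i | i <;> rcases j with j | j <;>
      simp [LinearMap.toMatrix_apply, Matrix.one_apply, Finsupp.single_apply, eq_comm]
  rw [ContinuousLinearMap.det, ContinuousLinearMap.det, ← LinearMap.det_toMatrix (b.prod c), h,
    Matrix.det_fromBlocks_zero₂₁, Matrix.det_one, mul_one, LinearMap.det_toMatrix]

theorem inverse_apply_of_det_ne_zero {X : Type*} [NormedAddCommGroup X] [NormedSpace ℝ X]
    [FiniteDimensional ℝ X] {L : X →L[ℝ] X} (hL : L.det ≠ 0) (x : X) :
    L.inverse (L x) = x ∧ L (L.inverse x) = x := by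
  let e := L.toContinuousLinearEquivOfDetNeZero hL
  have he : (e : X →L[ℝ] X) = L := by ext; rfl
  rw [← he, ContinuousLinearMap.inverse_equiv]
  simp

theorem differentiableAt_inverse_of_det_ne_zero {X : Type*} [NormedAddCommGroup X]
    [NormedSpace ℝ X] [FiniteDimensional ℝ X] {L : X →L[ℝ] X} (hL : L.det ≠ 0) :
    DifferentiableAt ℝ (ContinuousLinearMap.inverse : (X →L[ℝ] X) → X →L[ℝ] X) L := by
  have : CompleteSpace X := FiniteDimensional.complete ℝ X
  let e := L.toContinuousLinearEquivOfDetNeZero hL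
  have he : (e : X →L[ℝ] X) = L := by ext; rfl
  rw [← he]
  exact (contDiffAt_map_inverse (n := 1) e).differentiableAt (by norm_num)

/-- The adjoint as a continuous linear map over `ℝ`. -/
def adjointL (n m : ℕ) : (Euc n →L[ℝ] Euc m) →L[ℝ] (Euc m →L[ℝ] Euc n) :=
  LinearMap.toContinuousLinearMap
    { toFun := fun L => ContinuousLinearMap.adjoint L
      map_add' := fun _ _ => map_add _ _ _
      map_smul' := fun c L => by simp }

variable {n m : ℕ}

/-- The matrix of second derivatives of `⟨F, v⟩` at `u`. -/
def hess (F : Euc n → Euc m) (u : Euc n) (v : Euc m) : Matrix (Fin n) (Fin n) ℝ :=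
  Matrix.of fun i j => inner ℝ (fderiv ℝ (fderiv ℝ F) u (EuclideanSpace.single i 1)
    (EuclideanSpace.single j 1)) v

theorem hess_add (F : Euc n → Euc m) (u : Euc n) (v w : Euc m) :
    hess F u (v + w) = hess F u v + hess F u w := by
  ext i j; simp [hess, inner_add_right]

theorem hess_smul (F : Euc n → Euc m) (u : Euc n) (c : ℝ) (v : Euc m) :
    hess F u (c • v) = c • hess F u v := by
  ext i j; simp [hess, inner_smul_right]

theorem hess_sub (F : Euc n → Euc m) (u : Euc n) (v w : Euc m) :
    hess F u (v - w) = hess F u v - hess F u w := by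
  ext i j; simp [hess, inner_sub_right]

theorem sum_smul_single (x : Euc n) :
    x = ∑ i, x i • (EuclideanSpace.single i (1 : ℝ) : Euc n) := by
  ext j; simp [Pi.single_apply]

theorem dotProduct_hess_mulVec (F : Euc n → Euc m) (u : Euc n) (v : Euc m) (x y : Euc n) :
    x.ofLp ⬝ᵥ (Matrix.mulVec (hess F u v) y.ofLp) =
      inner ℝ (fderiv ℝ (fderiv ℝ F) u x y) v := by
  conv_rhs => rw [sum_smul_single x, sum_smul_single y]
  simp only [map_sum, map_smul, _root_.sum_apply, _root_.smul_apply,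
    sum_inner, real_inner_smul_left, Matrix.mulVec, dotProduct, Finset.mul_sum, hess,
    Matrix.of_apply, Finset.smul_sum]
  rw [Finset.sum_comm]
  refine Finset.sum_congr rfl fun i _ => Finset.sum_congr rfl fun j _ => ?_
  ring

/-- `u` is a critical point of the height function `⟨F, v⟩`. -/
def IsCritVec (F : Euc n → Euc m) (u : Euc n) (v : Euc m) : Prop :=
  ∀ x, inner ℝ (fderiv ℝ F u x) v = 0

variable (F : Euc n → Euc m) (u₀ : Euc n)

/-- The normal space at the base point. -/
abbrev baseNormal : Submodule ℝ (Euc m) := (LinearMap.range (fderiv ℝ F u₀).toLinearMap)ᗮ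

/-- The pairing of the tangent spaces at `u` and at the base point. -/
def pairing (u : Euc n) : Euc n →L[ℝ] Euc n :=
  (ContinuousLinearMap.adjoint (fderiv ℝ F u)).comp (fderiv ℝ F u₀)

/-- The coordinate of the tangential part, at the base point, of the normal vector at `z.1` with
normal part `z.2`. -/
def tangentPart (z : Euc n × baseNormal F u₀) : Euc n :=
  -(pairing F u₀ z.1).inverse (ContinuousLinearMap.adjoint (fderiv ℝ F z.1) (z.2 : Euc m))

/-- The normal vector at `z.1` whose projection to the normal space at the base point is `z.2`. -/
def normalVec (z : Euc n × baseNormal F u₀) : Euc m :=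
  fderiv ℝ F u₀ (tangentPart F u₀ z) + z.2

/-- The normal vector in coordinates of the ambient space. -/
def normalMap (z : Euc n × baseNormal F u₀) : Euc n × baseNormal F u₀ :=
  (tangentPart F u₀ z, z.2)

theorem inner_pairing (u x y : Euc n) :
    inner ℝ x (pairing F u₀ u y) = inner ℝ (fderiv ℝ F u x) (fderiv ℝ F u₀ y) := by
  rw [pairing, ContinuousLinearMap.comp_apply, ContinuousLinearMap.adjoint_inner_right]

theorem inner_base (w : baseNormal F u₀) (x : Euc n) :
    inner ℝ (fderiv ℝ F u₀ x) (w : Euc m) = 0 :=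
  (Submodule.mem_orthogonal _ _).1 w.2 _ ⟨x, rfl⟩

variable {F u₀}

/-- Orthogonality to the tangent space at u is a linear equation for the tangential coordinate x,
with coefficient `pairing F u₀ u`; where that is invertible, each normal part w has exactly one
solution. -/
theorem isCritVec_iff {u : Euc n} (hu : (pairing F u₀ u).det ≠ 0) (x : Euc n)
    (w : baseNormal F u₀) :
    IsCritVec F u (fderiv ℝ F u₀ x + w) ↔ tangentPart F u₀ (u, w) = x := by
  have h1 : IsCritVec F u (fderiv ℝ F u₀ x + w) ↔
      pairing F u₀ u x + ContinuousLinearMap.adjoint (fderiv ℝ F u) (w : Euc m) = 0 := by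
    constructor
    · intro h
      refine ext_inner_left ℝ fun y => ?_
      rw [inner_add_right, inner_pairing, ContinuousLinearMap.adjoint_inner_right,
        ← inner_add_right, h y, inner_zero_right]
    · intro h y
      rw [inner_add_right, ← inner_pairing, ← ContinuousLinearMap.adjoint_inner_right,
        ← inner_add_right, h, inner_zero_right]
  rw [h1, tangentPart]
  constructor
  · intro h
    rw [← neg_eq_of_add_eq_zero_right h, map_neg, (inverse_apply_of_det_ne_zero hu x).1, neg_neg]
  · rintro rfl
    rw [map_neg, (inverse_apply_of_det_ne_zero hu _).2, neg_add_cancel]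

theorem isCritVec_normalVec {z : Euc n × baseNormal F u₀} (hu : (pairing F u₀ z.1).det ≠ 0) :
    IsCritVec F z.1 (normalVec F u₀ z) :=
  (isCritVec_iff hu _ _).2 rfl

theorem norm_le_norm_normalVec (z : Euc n × baseNormal F u₀) : ‖z.2‖ ≤ ‖normalVec F u₀ z‖ := by
  have h := norm_add_sq_eq_norm_sq_add_norm_sq_of_inner_eq_zero _ _
    (inner_base F u₀ z.2 (tangentPart F u₀ z))
  have h2 : ‖(z.2 : Euc m)‖ ^ 2 ≤ ‖normalVec F u₀ z‖ ^ 2 := by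
    rw [normalVec]; nlinarith [sq_nonneg ‖fderiv ℝ F u₀ (tangentPart F u₀ z)‖]
  have := abs_le_of_sq_le_sq' h2 (norm_nonneg _)
  exact this.2

theorem pairing_base_det (h : Function.Injective (fderiv ℝ F u₀)) :
    (pairing F u₀ u₀).det ≠ 0 := by
  have hinj : Function.Injective (pairing F u₀ u₀).toLinearMap := by
    rw [← LinearMap.ker_eq_bot, Submodule.eq_bot_iff]
    intro x hx
    have hx' : pairing F u₀ u₀ x = 0 := hx
    have := inner_pairing F u₀ u₀ x x
    rw [hx', inner_zero_right, eq_comm, inner_self_eq_zero] at this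
    exact h (this.trans (map_zero _).symm)
  have := LinearEquiv.isUnit_det' (LinearEquiv.ofInjectiveEndo _ hinj)
  exact this.ne_zero

/-! ### Smoothness and Jacobian of the normal bundle parametrization -/

section Smooth

variable {U : Set (Euc n)} (hU : IsOpen U) (hF : ContDiffOn ℝ ∞ F U)
include hU hF

theorem contDiffOn_fderiv_patch : ContDiffOn ℝ ∞ (fderiv ℝ F) U :=
  hF.fderiv_of_isOpen hU (by norm_num)

theorem hasFDerivAt_fderiv_patch {u : Euc n} (hu : u ∈ U) :
    HasFDerivAt (fderiv ℝ F) (fderiv ℝ (fderiv ℝ F) u) u :=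
  (((contDiffOn_fderiv_patch hU hF).differentiableOn (by norm_num)).differentiableAt
    (hU.mem_nhds hu)).hasFDerivAt

theorem continuousOn_hess_patch :
    ContinuousOn (fun z : Euc n × Euc m => hess F z.1 z.2) (U ×ˢ univ) := by
  have h : ContinuousOn (fderiv ℝ (fderiv ℝ F)) U :=
    ((contDiffOn_fderiv_patch hU hF).fderiv_of_isOpen hU (m := ∞) (by norm_num)).continuousOn
  have h' : ContinuousOn (fun z : Euc n × Euc m => fderiv ℝ (fderiv ℝ F) z.1) (U ×ˢ univ) :=
    h.comp continuousOn_fst fun z hz => hz.1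
  refine continuousOn_pi.2 fun i => continuousOn_pi.2 fun j => ?_
  exact ((h'.clm_apply continuousOn_const).clm_apply continuousOn_const).inner continuousOn_snd

theorem isHermitian_hess {u : Euc n} (hu : u ∈ U) (v : Euc m) : (hess F u v).IsHermitian := by
  have hs : IsSymmSndFDerivAt ℝ F u :=
    (hF.contDiffAt (hU.mem_nhds hu)).isSymmSndFDerivAt (by
      rw [minSmoothness_of_isRCLikeNormedField]; exact WithTop.coe_le_coe.2 (le_top : (2 : ℕ∞) ≤ ⊤))
  ext i j
  simp only [Matrix.conjTranspose_apply, hess, Matrix.of_apply, star_trivial]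
  rw [hs]

theorem continuousOn_pairing : ContinuousOn (pairing F u₀) U := by
  have h := (contDiffOn_fderiv_patch hU hF).continuousOn
  exact ((adjointL n m).continuous.comp_continuousOn h).clm_comp continuousOn_const

theorem isOpen_pairing_ne : IsOpen {u | u ∈ U ∧ (pairing F u₀ u).det ≠ 0} := by
  have h := (ContinuousLinearMap.continuous_det.comp_continuousOn
    (continuousOn_pairing (u₀ := u₀) hU hF)).isOpen_inter_preimage hU isOpen_ne (t := {x | x ≠ 0})
  exact h

theorem differentiableAt_tangentPart {z : Euc n × baseNormal F u₀} (hz : z.1 ∈ U)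
    (hdet : (pairing F u₀ z.1).det ≠ 0) : DifferentiableAt ℝ (tangentPart F u₀) z := by
  have h1 : DifferentiableAt ℝ (fun z : Euc n × baseNormal F u₀ => fderiv ℝ F z.1) z :=
    (hasFDerivAt_fderiv_patch hU hF hz).differentiableAt.comp z differentiableAt_fst
  have h2 : DifferentiableAt ℝ
      (fun z : Euc n × baseNormal F u₀ => adjointL n m (fderiv ℝ F z.1)) z :=
    (adjointL n m).differentiableAt.comp z h1
  have h3 : DifferentiableAt ℝ
      (fun z : Euc n × baseNormal F u₀ => pairing F u₀ z.1) z :=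
    h2.clm_comp (differentiableAt_const _)
  have h4 : DifferentiableAt ℝ
      (fun z : Euc n × baseNormal F u₀ => (pairing F u₀ z.1).inverse) z :=
    DifferentiableAt.comp (g := ContinuousLinearMap.inverse)
      (f := fun z : Euc n × baseNormal F u₀ => pairing F u₀ z.1) z
      (differentiableAt_inverse_of_det_ne_zero hdet) h3
  have h5 : DifferentiableAt ℝ (fun z : Euc n × baseNormal F u₀ => (z.2 : Euc m)) z :=
    (baseNormal F u₀).subtypeL.differentiableAt.comp z differentiableAt_snd
  exact (h4.clm_apply (h2.clm_apply h5)).neg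

theorem differentiableAt_normalVec {z : Euc n × baseNormal F u₀} (hz : z.1 ∈ U)
    (hdet : (pairing F u₀ z.1).det ≠ 0) : DifferentiableAt ℝ (normalVec F u₀) z := by
  have h5 : DifferentiableAt ℝ (fun z : Euc n × baseNormal F u₀ => (z.2 : Euc m)) z :=
    (baseNormal F u₀).subtypeL.differentiableAt.comp z differentiableAt_snd
  exact ((fderiv ℝ F u₀).differentiableAt.comp z
    (differentiableAt_tangentPart hU hF hz hdet)).add h5

/-- This is the Weingarten formula: differentiate ⟨dF(x), N⟩ = 0 along the base direction h, for the
normal field N with fixed normal part w. -/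
theorem inner_pairing_fderiv_tangentPart {z : Euc n × baseNormal F u₀} (hz : z.1 ∈ U)
    (hdet : (pairing F u₀ z.1).det ≠ 0) (h x : Euc n) :
    inner ℝ x (pairing F u₀ z.1 (fderiv ℝ (tangentPart F u₀) z (h, 0))) =
      - inner ℝ (fderiv ℝ (fderiv ℝ F) z.1 h x) (normalVec F u₀ z) := by
  have hT := (differentiableAt_tangentPart hU hF hz hdet).hasFDerivAt
  have h1 : HasFDerivAt (fun z : Euc n × baseNormal F u₀ => fderiv ℝ F z.1 x)
      (((fderiv ℝ (fderiv ℝ F) z.1).comp (ContinuousLinearMap.fst ℝ _ _)).flip x) z := by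
    have := ((hasFDerivAt_fderiv_patch hU hF hz).comp z hasFDerivAt_fst).clm_apply
      (hasFDerivAt_const x z)
    refine this.congr_fderiv ?_
    ext y
    · simp
    · simp
  have h2 : HasFDerivAt (normalVec F u₀)
      ((fderiv ℝ F u₀).comp (fderiv ℝ (tangentPart F u₀) z) +
        (baseNormal F u₀).subtypeL.comp (ContinuousLinearMap.snd ℝ _ _)) z :=
    ((fderiv ℝ F u₀).hasFDerivAt.comp z hT).add
      ((baseNormal F u₀).subtypeL.hasFDerivAt.comp z hasFDerivAt_snd)
  have h3 := h1.inner ℝ h2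
  have hev : (fun z : Euc n × baseNormal F u₀ => inner ℝ (fderiv ℝ F z.1 x) (normalVec F u₀ z))
      =ᶠ[𝓝 z] fun _ => (0 : ℝ) := by
    have ho : IsOpen {z : Euc n × baseNormal F u₀ | z.1 ∈ {u | u ∈ U ∧ (pairing F u₀ u).det ≠ 0}} :=
      (isOpen_pairing_ne hU hF).preimage continuous_fst
    filter_upwards [ho.mem_nhds ⟨hz, hdet⟩] with y hy
    exact isCritVec_normalVec hy.2 x
  have h4 := (h3.congr_of_eventuallyEq hev.symm).unique (hasFDerivAt_const (0 : ℝ) z)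
  have h5 := DFunLike.congr_fun h4 ((h, 0) : Euc n × baseNormal F u₀)
  simp at h5
  rw [inner_pairing]
  linarith

/-- The second component of the map is w itself, so only the base derivative of the tangential part
matters. Composed with the pairing it is minus the transposed Hessian, by the Weingarten formula. -/
theorem abs_det_normalMap {z : Euc n × baseNormal F u₀} (hz : z.1 ∈ U)
    (hdet : (pairing F u₀ z.1).det ≠ 0) :
    |((fderiv ℝ (tangentPart F u₀) z).prod (ContinuousLinearMap.snd ℝ _ _)).det| =
      |(hess F z.1 (normalVec F u₀ z)).det| / |(pairing F u₀ z.1).det| := by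
  rw [det_prod_snd, eq_div_iff (abs_ne_zero.2 hdet), mul_comm, ← abs_mul]
  set L := (fderiv ℝ (tangentPart F u₀) z).comp (ContinuousLinearMap.inl ℝ _ _) with hL
  have e : (pairing F u₀ z.1).det * L.det =
      LinearMap.det ((pairing F u₀ z.1).toLinearMap ∘ₗ L.toLinearMap) := by
    rw [LinearMap.det_comp]
  let b := (EuclideanSpace.basisFun (Fin n) ℝ).toBasis
  rw [e, ← LinearMap.det_toMatrix b]
  have hM : LinearMap.toMatrix b b ((pairing F u₀ z.1).toLinearMap ∘ₗ L.toLinearMap) =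
      -(hess F z.1 (normalVec F u₀ z)).transpose := by
    ext i j
    rw [LinearMap.toMatrix_apply]
    have := inner_pairing_fderiv_tangentPart hU hF hz hdet (EuclideanSpace.single j 1)
      (EuclideanSpace.single i 1)
    rw [EuclideanSpace.inner_single_left] at this
    simp only [Matrix.neg_apply, Matrix.transpose_apply, hess, Matrix.of_apply]
    rw [← this]
    simp [b, hL]
  rw [hM, abs_det_neg, Matrix.det_transpose]

end Smooth

end Patch

/-! ### Counting critical points of height functions on a patch -/

section PatchCount

open Set Filter Topology

variable {n m : ℕ} {F : Euc n → Euc m} {u₀ : Euc n}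

/-- Decomposition of the ambient space into the tangent and normal space at the base point. -/
def frameEquiv (hinj : Function.Injective (fderiv ℝ F u₀)) :
    (Euc n × baseNormal F u₀) ≃L[ℝ] Euc m :=
  (LinearEquiv.ofBijective
    ((fderiv ℝ F u₀).toLinearMap.coprod (baseNormal F u₀).subtype) (by
      constructor
      · rw [← LinearMap.ker_eq_bot, Submodule.eq_bot_iff]
        rintro ⟨x, w⟩ h
        have h' : fderiv ℝ F u₀ x + (w : Euc m) = 0 := h
        have hn := norm_add_sq_eq_norm_sq_add_norm_sq_of_inner_eq_zero _ _ (inner_base F u₀ w x)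
        rw [h', norm_zero] at hn
        have h1 : ‖fderiv ℝ F u₀ x‖ = 0 := by nlinarith [norm_nonneg (fderiv ℝ F u₀ x)]
        have h2 : ‖(w : Euc m)‖ = 0 := by nlinarith [norm_nonneg (w : Euc m)]
        have h3 : x = 0 := hinj ((norm_eq_zero.1 h1).trans (map_zero _).symm)
        have h4 : w = 0 := Subtype.ext (norm_eq_zero.1 h2)
        rw [h3, h4]; rfl
      · intro v
        obtain ⟨a, ⟨x, rfl⟩, b, hb, rfl⟩ :=
          (LinearMap.range (fderiv ℝ F u₀).toLinearMap).exists_add_mem_mem_orthogonal v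
        exact ⟨(x, ⟨b, hb⟩), rfl⟩)).toContinuousLinearEquiv

theorem frameEquiv_apply (hinj : Function.Injective (fderiv ℝ F u₀))
    (z : Euc n × baseNormal F u₀) : frameEquiv hinj z = fderiv ℝ F u₀ z.1 + z.2 := rfl

theorem frameEquiv_normalMap (hinj : Function.Injective (fderiv ℝ F u₀))
    (z : Euc n × baseNormal F u₀) :
    frameEquiv hinj (normalMap F u₀ z) = normalVec F u₀ z := rfl

variable (F u₀) in
/-- The reference measure on the total space of the normal bundle of the patch. -/
def patchMeasure : Measure (Euc n × baseNormal F u₀) :=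
  (volume : Measure (Euc n)).prod Measure.addHaar

instance : (patchMeasure F u₀).IsAddHaarMeasure := by unfold patchMeasure; infer_instance

/-- Uniqueness of Haar measure. Only c ≠ 0, ∞ matters: the factor is common to both sides of every
comparison. -/
theorem exists_volume_eq_smul_map (hinj : Function.Injective (fderiv ℝ F u₀)) :
    ∃ c : ℝ≥0∞, c ≠ 0 ∧ c ≠ ⊤ ∧
      (volume : Measure (Euc m)) = c • (patchMeasure F u₀).map (frameEquiv hinj) := by
  have : ((patchMeasure F u₀).map (frameEquiv hinj)).IsAddHaarMeasure :=
    (frameEquiv hinj).isAddHaarMeasure_map _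
  exact ⟨_, by exact_mod_cast (Measure.addHaarScalarFactor_pos_of_isAddHaarMeasure _ _).ne',
    ENNReal.coe_ne_top, Measure.isAddLeftInvariant_eq_smul _ _⟩

variable (F) in
/-- The critical points `u ∈ S` of `⟨F, v⟩` with Hessian in the class `K`. -/
def critSet (K : Matrix (Fin n) (Fin n) ℝ → Prop) (S : Set (Euc n)) (v : Euc m) :
    Set (Euc n) := {u | u ∈ S ∧ IsCritVec F u v ∧ K (hess F u v)}

variable (F u₀) in
/-- The normal vectors over `S` with Hessian in the class `K`. -/
def normalClass (K : Matrix (Fin n) (Fin n) ℝ → Prop) (S : Set (Euc n)) :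
    Set (Euc n × baseNormal F u₀) := {z | z.1 ∈ S ∧ K (hess F z.1 (normalVec F u₀ z))}

/-- Critical points of ⟨F, v⟩ are the base points of the normal vectors equal to v. Projection to
the base is injective on such a fiber because v determines w. -/
theorem encard_critSet (hinj : Function.Injective (fderiv ℝ F u₀))
    (K : Matrix (Fin n) (Fin n) ℝ → Prop) {S : Set (Euc n)}
    (hS : ∀ u ∈ S, (pairing F u₀ u).det ≠ 0) (v : Euc m) :
    (critSet F K S v).encard =
      {z | z ∈ normalClass F u₀ K S ∧ normalMap F u₀ z = (frameEquiv hinj).symm v}.encard := by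
  have himg : critSet F K S v = Prod.fst ''
      {z | z ∈ normalClass F u₀ K S ∧ normalMap F u₀ z = (frameEquiv hinj).symm v} := by
    ext u
    constructor
    · rintro ⟨hu, hc, hK⟩
      set y := (frameEquiv hinj).symm v with hy
      have hv : v = fderiv ℝ F u₀ y.1 + y.2 := by
        rw [← frameEquiv_apply hinj, hy, ContinuousLinearEquiv.apply_symm_apply]
      have ht : tangentPart F u₀ (u, y.2) = y.1 := by
        rw [← isCritVec_iff (hS u hu), ← hv]; exact hc
      have hnv : normalVec F u₀ (u, y.2) = v := by rw [normalVec, ht, ← hv]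
      refine ⟨(u, y.2), ⟨⟨hu, ?_⟩, ?_⟩, rfl⟩
      · dsimp only; rw [hnv]; exact hK
      · rw [normalMap, ht]
    · rintro ⟨z, ⟨⟨hz, hK⟩, hG⟩, rfl⟩
      have hnv : normalVec F u₀ z = v := by
        rw [← frameEquiv_normalMap hinj, hG, ContinuousLinearEquiv.apply_symm_apply]
      rw [← hnv]
      exact ⟨hz, isCritVec_normalVec (hS _ hz), hK⟩
  rw [himg, InjOn.encard_image]
  rintro z ⟨-, hz⟩ z' ⟨-, hz'⟩ h
  have h2 : (normalMap F u₀ z).2 = (normalMap F u₀ z').2 := by rw [hz, hz']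
  exact Prod.ext h h2

/-! ### The area formula for counts of critical points -/

section Smooth

variable {U : Set (Euc n)} (hU : IsOpen U) (hF : ContDiffOn ℝ ∞ F U)
  (hinj : Function.Injective (fderiv ℝ F u₀)) {S : Set (Euc n)}
  (hS : ∀ u ∈ S, u ∈ U ∧ (pairing F u₀ u).det ≠ 0)
include hU hF hS

theorem hasFDerivWithinAt_normalMap {A : Set (Euc n × baseNormal F u₀)}
    {z : Euc n × baseNormal F u₀} (hz : z.1 ∈ S) :
    HasFDerivWithinAt (normalMap F u₀)
      ((fderiv ℝ (tangentPart F u₀) z).prod (ContinuousLinearMap.snd ℝ _ _)) A z :=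
  ((differentiableAt_tangentPart hU hF (hS _ hz).1 (hS _ hz).2).hasFDerivAt.prodMk
    hasFDerivAt_snd).hasFDerivWithinAt

theorem det_normalMap_ne_zero {z : Euc n × baseNormal F u₀} (hz : z.1 ∈ S)
    (hdet : (hess F z.1 (normalVec F u₀ z)).det ≠ 0) :
    ((fderiv ℝ (tangentPart F u₀) z).prod (ContinuousLinearMap.snd ℝ _ _)).det ≠ 0 := by
  rw [← abs_ne_zero, abs_det_normalMap hU hF (hS _ hz).1 (hS _ hz).2]
  exact div_ne_zero (abs_ne_zero.2 hdet) (abs_ne_zero.2 (hS _ hz).2)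

include hinj in
theorem measurable_encard_critSet {K : Matrix (Fin n) (Fin n) ℝ → Prop}
    (hK : ∀ H, K H → H.det ≠ 0) (hA : MeasurableSet (normalClass F u₀ K S)) :
    Measurable fun v => (((critSet F K S v).encard : ℕ∞) : ℝ≥0∞) := by
  have := measurable_encard_fiber hA
    (fun z hz => hasFDerivWithinAt_normalMap hU hF hS hz.1)
    (fun z hz => det_normalMap_ne_zero hU hF hS hz.1 (hK _ hz.2))
  simp_rw [encard_critSet hinj K (fun u hu => (hS u hu).2)]
  exact this.comp (frameEquiv hinj).symm.continuous.measurable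

theorem lintegral_encard_critSet {c : ℝ≥0∞} (hc : (volume : Measure (Euc m)) =
      c • (patchMeasure F u₀).map (frameEquiv hinj))
    {K : Matrix (Fin n) (Fin n) ℝ → Prop}
    (hK : ∀ H, K H → H.det ≠ 0) (hA : MeasurableSet (normalClass F u₀ K S))
    {ρ : Euc m → ℝ≥0∞} (hρ : Measurable ρ) :
    ∫⁻ v, ρ v * (((critSet F K S v).encard : ℕ∞) : ℝ≥0∞) =
      c * ∫⁻ z in normalClass F u₀ K S,
        ENNReal.ofReal (|(hess F z.1 (normalVec F u₀ z)).det| / |(pairing F u₀ z.1).det|) *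
          ρ (normalVec F u₀ z) ∂patchMeasure F u₀ := by
  have hm := measurable_encard_critSet hU hF hinj hS hK hA
  have hm' : Measurable fun v => ρ v * (((critSet F K S v).encard : ℕ∞) : ℝ≥0∞) := hρ.mul hm
  rw [hc, lintegral_smul_measure, lintegral_map hm' (frameEquiv hinj).continuous.measurable,
    smul_eq_mul]
  congr 1
  have h := lintegral_encard_fiber (patchMeasure F u₀) hA
    (fun z hz => hasFDerivWithinAt_normalMap hU hF hS hz.1)
    (fun z hz => det_normalMap_ne_zero hU hF hS hz.1 (hK _ hz.2))
    (hρ.comp (frameEquiv hinj).continuous.measurable)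
  calc _ = ∫⁻ y, (ρ ∘ frameEquiv hinj) y *
        (({x | x ∈ normalClass F u₀ K S ∧ normalMap F u₀ x = y}.encard : ℕ∞) : ℝ≥0∞)
          ∂patchMeasure F u₀ := by
        refine lintegral_congr fun y => ?_
        rw [encard_critSet hinj K (fun u hu => (hS u hu).2),
          ContinuousLinearEquiv.symm_apply_apply, Function.comp_apply]
    _ = _ := by
        rw [h]
        refine setLIntegral_congr_fun hA fun z hz => ?_
        rw [abs_det_normalMap hU hF (hS _ hz.1).1 (hS _ hz.1).2, Function.comp_apply,
          frameEquiv_normalMap]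

include hinj in
/-- Almost no height function has a degenerate critical point. -/
theorem volume_degenerate_eq_zero :
    volume {v : Euc m | ∃ u ∈ S, IsCritVec F u v ∧ (hess F u v).det = 0} = 0 := by
  obtain ⟨c, -, -, hc⟩ := exists_volume_eq_smul_map hinj
  set Z := normalClass F u₀ (fun H => H.det = 0) S with hZ
  -- The equidimensional case of Sard's theorem: the Jacobian vanishes exactly where the Hessian is
  -- singular.
  have h0 : patchMeasure F u₀ (normalMap F u₀ '' Z) = 0 := by
    refine addHaar_image_eq_zero_of_det_fderivWithin_eq_zero _
      (fun z hz => hasFDerivWithinAt_normalMap hU hF hS hz.1) fun z hz => ?_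
    rw [← abs_eq_zero, abs_det_normalMap hU hF (hS _ hz.1).1 (hS _ hz.1).2]
    have : (hess F z.1 (normalVec F u₀ z)).det = 0 := hz.2
    rw [this, abs_zero, zero_div]
  have hsub : {v : Euc m | ∃ u ∈ S, IsCritVec F u v ∧ (hess F u v).det = 0} ⊆
      (frameEquiv hinj).symm ⁻¹' (normalMap F u₀ '' Z) := by
    rintro v ⟨u, hu, hcr, hd⟩
    have hne : (critSet F (fun H => H.det = 0) S v).encard ≠ 0 :=
      encard_ne_zero.2 ⟨u, hu, hcr, hd⟩
    rw [encard_critSet hinj _ (fun u hu => (hS u hu).2), encard_ne_zero] at hne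
    obtain ⟨z, hz, hG⟩ := hne
    exact ⟨z, hz, hG⟩
  refine measure_mono_null hsub ?_
  have hpre : (frameEquiv hinj) ⁻¹' ((frameEquiv hinj).symm ⁻¹' (normalMap F u₀ '' Z)) =
      normalMap F u₀ '' Z := by
    ext y; simp
  have hemb : MeasurableEmbedding (frameEquiv hinj) :=
    (frameEquiv hinj).toHomeomorph.measurableEmbedding
  rw [hc, Measure.smul_apply, hemb.map_apply, hpre, h0, smul_zero]

end Smooth

end PatchCount

/-! ### Densities of the type numbers on a patch -/

section Density

open Set Filter Topology

/-- A radial cutoff function. -/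
def cutoff (r : ℝ) : ℝ := max 0 (4 - r)

theorem continuous_cutoff : Continuous cutoff := by unfold cutoff; fun_prop

theorem cutoff_nonneg (r : ℝ) : 0 ≤ cutoff r := le_max_left _ _

variable {n m : ℕ} {F : Euc n → Euc m} {u₀ : Euc n}

variable (F u₀) in
/-- The density of a function `Φ` of the Hessian on the normal bundle of the patch. -/
def normalDensity (Φ : Matrix (Fin n) (Fin n) ℝ → ℝ) (z : Euc n × baseNormal F u₀) : ℝ :=
  Φ (hess F z.1 (normalVec F u₀ z)) / |(pairing F u₀ z.1).det| * cutoff ‖normalVec F u₀ z‖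

variable (F u₀) in
/-- The density of a function `Φ` of the Hessian on the patch. -/
def baseDensity (Φ : Matrix (Fin n) (Fin n) ℝ → ℝ) (u : Euc n) : ℝ :=
  ∫ w in Metric.closedBall (0 : baseNormal F u₀) 4, normalDensity F u₀ Φ (u, w) ∂Measure.addHaar

theorem normalDensity_nonneg {Φ : Matrix (Fin n) (Fin n) ℝ → ℝ} (hΦ : ∀ H, 0 ≤ Φ H)
    (z : Euc n × baseNormal F u₀) : 0 ≤ normalDensity F u₀ Φ z :=
  mul_nonneg (div_nonneg (hΦ _) (abs_nonneg _)) (cutoff_nonneg _)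

/-- Projection to the base normal space shortens vectors, so the cutoff is already zero when |w| ≥
4. For this reason `baseDensity` may integrate over a fixed compact ball instead of the whole fiber.
-/
theorem normalDensity_eq_zero (Φ : Matrix (Fin n) (Fin n) ℝ → ℝ)
    {z : Euc n × baseNormal F u₀} (hz : 4 ≤ ‖z.2‖) : normalDensity F u₀ Φ z = 0 := by
  have : cutoff ‖normalVec F u₀ z‖ = 0 :=
    max_eq_left (by linarith [norm_le_norm_normalVec z])
  rw [normalDensity, this, mul_zero]

theorem baseDensity_nonneg {Φ : Matrix (Fin n) (Fin n) ℝ → ℝ} (h0 : ∀ H, 0 ≤ Φ H) (u : Euc n) :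
    0 ≤ baseDensity F u₀ Φ u :=
  integral_nonneg fun _ => normalDensity_nonneg h0 _

/-! ### Continuity of the densities -/

section Smooth

variable {U : Set (Euc n)} (hU : IsOpen U) (hF : ContDiffOn ℝ ∞ F U)
include hU hF

variable (u₀) in
theorem continuousOn_hess_normalVec :
    ContinuousOn (fun z : Euc n × baseNormal F u₀ => hess F z.1 (normalVec F u₀ z))
      ({u | u ∈ U ∧ (pairing F u₀ u).det ≠ 0} ×ˢ univ) := by
  intro z hz
  have h1 : ContinuousAt (normalVec F u₀) z :=
    (differentiableAt_normalVec hU hF hz.1.1 hz.1.2).continuousAt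
  have h2 : ContinuousAt (fun z : Euc n × baseNormal F u₀ => (z.1, normalVec F u₀ z)) z :=
    continuousAt_fst.prodMk h1
  have h3 : ContinuousAt (fun y : Euc n × Euc m => hess F y.1 y.2) (z.1, normalVec F u₀ z) :=
    (continuousOn_hess_patch hU hF).continuousAt
      ((hU.prod isOpen_univ).mem_nhds (mem_prod.2 ⟨hz.1.1, mem_univ _⟩))
  exact (Tendsto.comp h3 h2).mono_left nhdsWithin_le_nhds

variable (u₀) in
theorem continuousOn_normalDensity {Φ : Matrix (Fin n) (Fin n) ℝ → ℝ}
    (hΦ : ContinuousOn Φ {H | H.IsHermitian}) :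
    ContinuousOn (normalDensity F u₀ Φ)
      ({u | u ∈ U ∧ (pairing F u₀ u).det ≠ 0} ×ˢ univ) := by
  have h1 : ContinuousOn (normalVec F u₀) ({u | u ∈ U ∧ (pairing F u₀ u).det ≠ 0} ×ˢ univ) :=
    fun z hz => (differentiableAt_normalVec hU hF hz.1.1
      hz.1.2).continuousAt.continuousWithinAt
  have h2 := hΦ.comp (continuousOn_hess_normalVec u₀ hU hF)
    (fun z hz => isHermitian_hess hU hF hz.1.1 _)
  have h3 : ContinuousOn (fun z : Euc n × baseNormal F u₀ => |(pairing F u₀ z.1).det|)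
      ({u | u ∈ U ∧ (pairing F u₀ u).det ≠ 0} ×ˢ univ) :=
    ((ContinuousLinearMap.continuous_det.comp_continuousOn
      (continuousOn_pairing (u₀ := u₀) hU hF)).comp continuousOn_fst fun z hz => hz.1.1).abs
  exact (h2.div h3 fun z hz => abs_ne_zero.2 hz.1.2).mul
    (continuous_cutoff.comp_continuousOn h1.norm)

theorem continuous_normalDensity_fiber {Φ : Matrix (Fin n) (Fin n) ℝ → ℝ}
    (hΦ : ContinuousOn Φ {H | H.IsHermitian}) {u : Euc n} (hu : u ∈ U)
    (hdet : (pairing F u₀ u).det ≠ 0) :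
    Continuous fun w => normalDensity F u₀ Φ (u, w) :=
  (continuousOn_normalDensity u₀ hU hF hΦ).comp_continuous (Continuous.prodMk_right u)
    fun _ => ⟨⟨hu, hdet⟩, trivial⟩

/-- An integral over a fixed compact ball of a jointly continuous integrand depends continuously on
the parameter. Continuity later turns equality almost everywhere into equality at the base point. -/
theorem continuousOn_baseDensity {Φ : Matrix (Fin n) (Fin n) ℝ → ℝ}
    (hΦ : ContinuousOn Φ {H | H.IsHermitian}) :
    ContinuousOn (baseDensity F u₀ Φ) {u | u ∈ U ∧ (pairing F u₀ u).det ≠ 0} := by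
  rw [continuousOn_iff_continuous_domRestrict]
  have hlc : LocallyCompactSpace {u | u ∈ U ∧ (pairing F u₀ u).det ≠ 0} :=
    (isOpen_pairing_ne hU hF).locallyCompactSpace
  have hc : Continuous fun z : {u | u ∈ U ∧ (pairing F u₀ u).det ≠ 0} × baseNormal F u₀ =>
      normalDensity F u₀ Φ ((z.1 : Euc n), z.2) :=
    (continuousOn_normalDensity u₀ hU hF hΦ).comp_continuous (by fun_prop)
      fun z => ⟨z.1.2, trivial⟩
  exact continuous_parametric_integral_of_continuous
    (f := fun (u : {u | u ∈ U ∧ (pairing F u₀ u).det ≠ 0}) (w : baseNormal F u₀) =>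
      normalDensity F u₀ Φ ((u : Euc n), w)) hc (isCompact_closedBall _ _)

theorem ofReal_baseDensity {Φ : Matrix (Fin n) (Fin n) ℝ → ℝ}
    (hΦ : ContinuousOn Φ {H | H.IsHermitian}) (h0 : ∀ H, 0 ≤ Φ H) {u : Euc n} (hu : u ∈ U)
    (hdet : (pairing F u₀ u).det ≠ 0) :
    ENNReal.ofReal (baseDensity F u₀ Φ u) =
      ∫⁻ w, ENNReal.ofReal (normalDensity F u₀ Φ (u, w)) ∂Measure.addHaar := by
  have hc := continuous_normalDensity_fiber hU hF hΦ hu hdet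
  rw [baseDensity, ofReal_integral_eq_lintegral_ofReal
    (hc.continuousOn.integrableOn_compact (isCompact_closedBall _ _))
    (Eventually.of_forall fun w => normalDensity_nonneg h0 _)]
  refine setLIntegral_eq_of_support_subset ?_
  intro w hw
  by_contra hw'
  apply hw
  dsimp only
  rw [normalDensity_eq_zero, ENNReal.ofReal_zero]
  rw [Metric.mem_closedBall, dist_zero_right, not_le] at hw'
  exact hw'.le

end Smooth

/-! ### Reflection of the normal planes -/

/-- An orthonormal frame of the normal plane at `u` with positive semidefinite second fundamental
forms. -/
structure IsNonnegFrame (F : Euc n → Euc m) (u : Euc n) (ξ η : Euc m) : Prop where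
  norm_left : ‖ξ‖ = 1
  norm_right : ‖η‖ = 1
  inner_eq : inner ℝ ξ η = 0
  crit_left : IsCritVec F u ξ
  crit_right : IsCritVec F u η
  span : ∀ v, IsCritVec F u v → v = inner ℝ ξ v • ξ + inner ℝ η v • η
  psd_left : (hess F u ξ).PosSemidef
  psd_right : (hess F u η).PosSemidef

/-- The reflection in the hyperplane orthogonal to the unit vector `ξ`. -/
def reflectVec (ξ : Euc m) : Euc m →ₗ[ℝ] Euc m :=
  LinearMap.id - (2 : ℝ) • ((innerₛₗ ℝ ξ).smulRight ξ)

theorem reflectVec_apply (ξ v : Euc m) : reflectVec ξ v = v - (2 * inner ℝ ξ v) • ξ := by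
  simp [reflectVec, mul_smul]

theorem reflectVec_reflectVec {ξ : Euc m} (h : ‖ξ‖ = 1) (v : Euc m) :
    reflectVec ξ (reflectVec ξ v) = v := by
  simp only [reflectVec_apply, inner_sub_right, inner_smul_right, real_inner_self_eq_norm_sq, h]
  module

theorem norm_reflectVec {ξ : Euc m} (h : ‖ξ‖ = 1) (v : Euc m) : ‖reflectVec ξ v‖ = ‖v‖ := by
  have : ‖reflectVec ξ v‖ ^ 2 = ‖v‖ ^ 2 := by
    rw [← real_inner_self_eq_norm_sq, ← real_inner_self_eq_norm_sq, reflectVec_apply]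
    simp only [inner_sub_right, inner_sub_left, inner_smul_right, real_inner_smul_left,
      real_inner_self_eq_norm_sq ξ, h, real_inner_comm v ξ]
    rw [real_inner_comm ξ v]
    ring
  exact (pow_left_inj₀ (norm_nonneg _) (norm_nonneg _) two_ne_zero).1 this

theorem IsCritVec.add {u : Euc n} {v w : Euc m} (hv : IsCritVec F u v) (hw : IsCritVec F u w) :
    IsCritVec F u (v + w) := fun x => by rw [inner_add_right, hv, hw, add_zero]

theorem IsCritVec.smul {u : Euc n} {v : Euc m} (c : ℝ) (hv : IsCritVec F u v) :
    IsCritVec F u (c • v) := fun x => by rw [inner_smul_right, hv, mul_zero]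

theorem IsNonnegFrame.isCritVec_reflectVec {u : Euc n} {ξ η v : Euc m}
    (h : IsNonnegFrame F u ξ η) (hv : IsCritVec F u v) : IsCritVec F u (reflectVec ξ v) := by
  rw [reflectVec_apply, sub_eq_add_neg, ← neg_smul]
  exact hv.add (h.crit_left.smul _)

theorem IsNonnegFrame.reflectVec_eq {u : Euc n} {ξ η v : Euc m}
    (h : IsNonnegFrame F u ξ η) (hv : IsCritVec F u v) :
    reflectVec ξ v = -inner ℝ ξ v • ξ + inner ℝ η v • η := by
  rw [reflectVec_apply]
  conv_lhs => enter [1]; rw [h.span v hv]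
  module

/-- The reflection only reverses the ξ-component of v, so this is the matrix comparison for the
forms of ξ and η. -/
theorem IsNonnegFrame.indefiniteDet_le {u : Euc n} {ξ η v : Euc m}
    (h : IsNonnegFrame F u ξ η) (hv : IsCritVec F u v) :
    indefiniteDet (hess F u v) ≤ definiteDet (hess F u (reflectVec ξ v)) := by
  rw [h.reflectVec_eq hv]
  conv_lhs => rw [h.span v hv]
  simp only [hess_add, hess_smul]
  exact indefiniteDet_le_definiteDet h.psd_left h.psd_right _ _

variable (F u₀) in
/-- `normalVec` over a fixed point as a linear map. -/
def normalLin (u : Euc n) : baseNormal F u₀ →ₗ[ℝ] Euc m :=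
  (fderiv ℝ F u₀).toLinearMap ∘ₗ
    (-((pairing F u₀ u).inverse.toLinearMap ∘ₗ
      (ContinuousLinearMap.adjoint (fderiv ℝ F u)).toLinearMap)) ∘ₗ (baseNormal F u₀).subtype +
    (baseNormal F u₀).subtype

variable (F u₀) in
/-- The reflection transported to the normal space at the base point. -/
def baseReflection (u : Euc n) (ξ : Euc m) : baseNormal F u₀ →ₗ[ℝ] baseNormal F u₀ :=
  (baseNormal F u₀).orthogonalProjectionOnto.toLinearMap ∘ₗ reflectVec ξ ∘ₗ normalLin F u₀ u

theorem projection_normalVec (u : Euc n) (w : baseNormal F u₀) :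
    (baseNormal F u₀).orthogonalProjectionOnto (normalVec F u₀ (u, w)) = w := by
  rw [normalVec, map_add, Submodule.orthogonalProjectionOnto_mem_subspace_eq_self,
    Submodule.orthogonalProjectionOnto_orthogonal_apply_eq_zero, zero_add]
  exact ⟨_, rfl⟩

/-- With `projection_normalVec` this identifies the normal space at u with the one at the base
point, so that reflections at u can be transported there. -/
theorem normalVec_projection {u : Euc n} (hdet : (pairing F u₀ u).det ≠ 0) {v : Euc m}
    (hv : IsCritVec F u v) :
    normalVec F u₀ (u, (baseNormal F u₀).orthogonalProjectionOnto v) = v := by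
  obtain ⟨a, ⟨x, rfl⟩, b, hb, rfl⟩ :=
    (LinearMap.range (fderiv ℝ F u₀).toLinearMap).exists_add_mem_mem_orthogonal v
  have hp : (baseNormal F u₀).orthogonalProjectionOnto ((fderiv ℝ F u₀).toLinearMap x + b) =
      ⟨b, hb⟩ := by
    rw [map_add, Submodule.orthogonalProjectionOnto_orthogonal_apply_eq_zero,
      zero_add]
    · exact Submodule.orthogonalProjectionOnto_mem_subspace_eq_self ⟨b, hb⟩
    · exact ⟨_, rfl⟩
  rw [hp, normalVec, (isCritVec_iff hdet x ⟨b, hb⟩).1 hv]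
  rfl

theorem IsNonnegFrame.normalVec_baseReflection {u : Euc n} {ξ η : Euc m}
    (h : IsNonnegFrame F u ξ η) (hdet : (pairing F u₀ u).det ≠ 0) (w : baseNormal F u₀) :
    normalVec F u₀ (u, baseReflection F u₀ u ξ w) = reflectVec ξ (normalVec F u₀ (u, w)) :=
  normalVec_projection hdet (h.isCritVec_reflectVec (isCritVec_normalVec (z := (u, w)) hdet))

/-- The identification with the normal space at u need not be isometric, but a conjugate of an
involution is an involution; its determinant is ±1 and Haar measure is preserved. -/
theorem IsNonnegFrame.measurePreserving_baseReflection {u : Euc n} {ξ η : Euc m}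
    (h : IsNonnegFrame F u ξ η) (hdet : (pairing F u₀ u).det ≠ 0) :
    MeasurePreserving (baseReflection F u₀ u ξ) (Measure.addHaar : Measure (baseNormal F u₀))
      Measure.addHaar := by
  have hinv : baseReflection F u₀ u ξ ∘ₗ baseReflection F u₀ u ξ = LinearMap.id := by
    ext1 w
    have h1 : baseReflection F u₀ u ξ (baseReflection F u₀ u ξ w) =
      (baseNormal F u₀).orthogonalProjectionOnto
        (reflectVec ξ (normalVec F u₀ (u, baseReflection F u₀ u ξ w))) := rfl
    rw [LinearMap.comp_apply, h1, h.normalVec_baseReflection hdet,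
      reflectVec_reflectVec h.norm_left, projection_normalVec]
    rfl
  have hd : LinearMap.det (baseReflection F u₀ u ξ) * LinearMap.det (baseReflection F u₀ u ξ)
      = 1 := by
    rw [← LinearMap.det_comp, hinv, LinearMap.det_id]
  have hne : LinearMap.det (baseReflection F u₀ u ξ) ≠ 0 := by
    intro h0; rw [h0, mul_zero] at hd; exact zero_ne_one hd
  have habs : |(LinearMap.det (baseReflection F u₀ u ξ))⁻¹| = 1 := by
    rw [abs_inv]
    rcases mul_self_eq_one_iff.1 hd with h1 | h1 <;> rw [h1] <;> simp
  refine ⟨(LinearMap.continuous_of_finiteDimensional _).measurable, ?_⟩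
  rw [Measure.map_linearMap_addHaar_eq_smul_addHaar _ hne, habs, ENNReal.ofReal_one, one_smul]

theorem IsNonnegFrame.normalDensity_le {u : Euc n} {ξ η : Euc m}
    (h : IsNonnegFrame F u ξ η) (hdet : (pairing F u₀ u).det ≠ 0) (w : baseNormal F u₀) :
    normalDensity F u₀ indefiniteDet (u, w) ≤
      normalDensity F u₀ definiteDet (u, baseReflection F u₀ u ξ w) := by
  unfold normalDensity
  rw [h.normalVec_baseReflection hdet, norm_reflectVec h.norm_left]
  refine mul_le_mul_of_nonneg_right ?_ (cutoff_nonneg _)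
  refine div_le_div_of_nonneg_right ?_ (abs_nonneg _)
  exact h.indefiniteDet_le (isCritVec_normalVec (z := (u, w)) hdet)

/-! ### Comparison of the densities and its equality case -/

section Smooth

variable {U : Set (Euc n)} (hU : IsOpen U) (hF : ContDiffOn ℝ ∞ F U)
include hU hF

theorem IsNonnegFrame.lintegral_reflection {u : Euc n} {ξ η : Euc m}
    (h : IsNonnegFrame F u ξ η) (hu : u ∈ U) (hdet : (pairing F u₀ u).det ≠ 0) :
    ∫⁻ w, ENNReal.ofReal (normalDensity F u₀ definiteDet (u, baseReflection F u₀ u ξ w))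
        ∂Measure.addHaar =
      ENNReal.ofReal (baseDensity F u₀ definiteDet u) := by
  rw [ofReal_baseDensity hU hF continuousOn_definiteDet definiteDet_nonneg hu hdet]
  exact (h.measurePreserving_baseReflection hdet).lintegral_comp
    (f := fun w => ENNReal.ofReal (normalDensity F u₀ definiteDet (u, w)))
    (continuous_normalDensity_fiber hU hF continuousOn_definiteDet hu hdet).measurable.ennreal_ofReal

theorem IsNonnegFrame.baseDensity_le {u : Euc n} {ξ η : Euc m}
    (h : IsNonnegFrame F u ξ η) (hu : u ∈ U) (hdet : (pairing F u₀ u).det ≠ 0) :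
    baseDensity F u₀ indefiniteDet u ≤ baseDensity F u₀ definiteDet u := by
  rw [← ENNReal.ofReal_le_ofReal_iff (baseDensity_nonneg definiteDet_nonneg u),
    ← h.lintegral_reflection hU hF hu hdet,
    ofReal_baseDensity hU hF continuousOn_indefiniteDet indefiniteDet_nonneg hu hdet]
  exact lintegral_mono fun w => ENNReal.ofReal_le_ofReal (h.normalDensity_le hdet w)

/-- Equality of the densities at the base point forces equality in the comparison of
determinants. -/
theorem IsNonnegFrame.indefiniteDet_eq {ξ η : Euc m}
    (h : IsNonnegFrame F u₀ ξ η) (hu : u₀ ∈ U) (hdet : (pairing F u₀ u₀).det ≠ 0)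
    (heq : baseDensity F u₀ indefiniteDet u₀ = baseDensity F u₀ definiteDet u₀) :
    indefiniteDet (hess F u₀ ξ - hess F u₀ η) = definiteDet (hess F u₀ ξ + hess F u₀ η) := by
  have hc1 := continuous_normalDensity_fiber hU hF continuousOn_indefiniteDet hu hdet
  have hc2 := (continuous_normalDensity_fiber hU hF continuousOn_definiteDet hu hdet).comp
    (LinearMap.continuous_of_finiteDimensional (baseReflection F u₀ u₀ ξ))
  have hae := ae_eq_of_ae_le_of_lintegral_le (μ := Measure.addHaar)
    (f := fun w => ENNReal.ofReal (normalDensity F u₀ indefiniteDet (u₀, w)))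
    (g := fun w => ENNReal.ofReal
      (normalDensity F u₀ definiteDet (u₀, baseReflection F u₀ u₀ ξ w)))
    (Eventually.of_forall fun w => ENNReal.ofReal_le_ofReal (h.normalDensity_le hdet w))
    (by rw [← ofReal_baseDensity hU hF continuousOn_indefiniteDet indefiniteDet_nonneg hu hdet]
        exact ENNReal.ofReal_ne_top)
    hc2.measurable.ennreal_ofReal.aemeasurable
    (by rw [h.lintegral_reflection hU hF hu hdet, ← heq,
          ofReal_baseDensity hU hF continuousOn_indefiniteDet indefiniteDet_nonneg hu hdet])
  -- Haar measure charges every nonempty open set, so continuous functions that agree almost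
  -- everywhere agree everywhere.
  have hall := (Continuous.ae_eq_iff_eq _ (ENNReal.continuous_ofReal.comp hc1)
    (ENNReal.continuous_ofReal.comp hc2)).1 hae
  -- Equality is tested at v = ξ − η, whose reflection is −(ξ + η); the sign disappears because
  -- `definiteDet` is even.
  have hcrit : IsCritVec F u₀ (ξ - η) := by
    rw [sub_eq_add_neg, ← neg_one_smul ℝ η]
    exact h.crit_left.add (h.crit_right.smul _)
  have hw := normalVec_projection hdet hcrit
  set w := (baseNormal F u₀).orthogonalProjectionOnto (ξ - η)
  have h1 := congrFun hall w
  simp only [Function.comp_apply] at h1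
  rw [ENNReal.ofReal_eq_ofReal_iff (normalDensity_nonneg indefiniteDet_nonneg _)
    (normalDensity_nonneg definiteDet_nonneg _)] at h1
  unfold normalDensity at h1
  rw [h.normalVec_baseReflection hdet, norm_reflectVec h.norm_left, hw,
    h.reflectVec_eq hcrit] at h1
  -- Here ‖ξ − η‖ ≤ 2 lies inside the support radius 4, so the cutoff can be cancelled.
  have hcut : cutoff ‖ξ - η‖ ≠ 0 := by
    have := norm_sub_le ξ η
    rw [h.norm_left, h.norm_right] at this
    have : 0 < cutoff ‖ξ - η‖ := lt_max_of_lt_right (by linarith)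
    exact this.ne'
  have h2 := mul_right_cancel₀ hcut h1
  have h3 := (div_left_inj' (abs_ne_zero.2 hdet)).1 h2
  rw [inner_sub_right, inner_sub_right, real_inner_comm ξ η, h.inner_eq,
    real_inner_self_eq_norm_sq, real_inner_self_eq_norm_sq, h.norm_left, h.norm_right] at h3
  rw [← hess_sub, h3, ← definiteDet_neg (hess F u₀ ξ + _), ← hess_add, ← neg_one_smul ℝ (hess _ _ _),
    ← hess_smul]
  congr 2
  module

end Smooth

end Density

/-! ### Comparison of the type numbers on a patch -/

section PatchComparison

open Set Filter Topology

/-- Nondegenerate symmetric matrices that are not definite. -/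
def IsIndefinite {n : ℕ} (H : Matrix (Fin n) (Fin n) ℝ) : Prop := ¬ IsDefinite H ∧ H.det ≠ 0

theorem IsDefinite.det_ne_zero {n : ℕ} {H : Matrix (Fin n) (Fin n) ℝ} (h : IsDefinite H) :
    H.det ≠ 0 := by
  rcases h with h | h
  · exact h.det_pos.ne'
  · rw [← abs_ne_zero, ← abs_det_neg, abs_ne_zero]
    exact h.det_pos.ne'

/-- The radial weight on the ambient space. -/
def weight {m : ℕ} (v : Euc m) : ℝ≥0∞ := ENNReal.ofReal (cutoff ‖v‖)

theorem measurable_weight {m : ℕ} : Measurable (weight (m := m)) :=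
  (continuous_cutoff.comp continuous_norm).measurable.ennreal_ofReal

variable {n m : ℕ} {F : Euc n → Euc m} {u₀ : Euc n}
  {U : Set (Euc n)} (hU : IsOpen U) (hF : ContDiffOn ℝ ∞ F U)

/-! ### Measurability and integral formulas for definite and indefinite critical points -/

section Measurability

variable {S : Set (Euc n)} (hSm : MeasurableSet S)
  (hS : ∀ u ∈ S, u ∈ U ∧ (pairing F u₀ u).det ≠ 0)
include hU hF hSm hS

/-- The Hessian is symmetric and varies continuously over the good points, so a condition open among
symmetric matrices cuts out an open set of normal vectors; restriction to S keeps it measurable. -/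
theorem measurableSet_normalClass_of_open {K : Matrix (Fin n) (Fin n) ℝ → Prop}
    (hK : ∀ H : Matrix (Fin n) (Fin n) ℝ, H.IsHermitian → K H →
      ∀ᶠ H' in 𝓝[{H' : Matrix (Fin n) (Fin n) ℝ | H'.IsHermitian}] H, K H') :
    MeasurableSet (normalClass F u₀ K S) := by
  have ho : IsOpen {z : Euc n × baseNormal F u₀ |
      z ∈ {u | u ∈ U ∧ (pairing F u₀ u).det ≠ 0} ×ˢ (univ : Set (baseNormal F u₀)) ∧
        K (hess F z.1 (normalVec F u₀ z))} := by
    have hV := (isOpen_pairing_ne (u₀ := u₀) hU hF).prod (isOpen_univ (X := baseNormal F u₀))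
    rw [isOpen_iff_mem_nhds]
    rintro z ⟨hz, hKz⟩
    have hc : Tendsto (fun z : Euc n × baseNormal F u₀ => hess F z.1 (normalVec F u₀ z)) (𝓝 z)
        (𝓝 (hess F z.1 (normalVec F u₀ z))) :=
      (continuousOn_hess_normalVec u₀ hU hF).continuousAt (hV.mem_nhds hz)
    have ht := tendsto_nhdsWithin_of_tendsto_nhds_of_eventually_within
      (s := {H' : Matrix (Fin n) (Fin n) ℝ | H'.IsHermitian}) _ hc (by
        filter_upwards [hV.mem_nhds hz] with y hy using isHermitian_hess hU hF hy.1.1 _)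
    filter_upwards [hV.mem_nhds hz, ht.eventually (hK _ (isHermitian_hess hU hF hz.1.1 _) hKz)]
      with y h1 h2 using ⟨h1, h2⟩
  have : normalClass F u₀ K S = (S ×ˢ univ) ∩ {z : Euc n × baseNormal F u₀ |
      z ∈ {u | u ∈ U ∧ (pairing F u₀ u).det ≠ 0} ×ˢ (univ : Set (baseNormal F u₀)) ∧
        K (hess F z.1 (normalVec F u₀ z))} := by
    ext z
    constructor
    · rintro ⟨h1, h2⟩
      exact ⟨⟨h1, trivial⟩, ⟨hS _ h1, trivial⟩, h2⟩
    · rintro ⟨⟨h1, -⟩, -, h2⟩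
      exact ⟨h1, h2⟩
  rw [this]
  exact (hSm.prod MeasurableSet.univ).inter ho.measurableSet

theorem measurableSet_normalClass_posDef :
    MeasurableSet (normalClass F u₀ (fun H => H.PosDef) S) :=
  measurableSet_normalClass_of_open hU hF hSm hS fun _ _ h => eventually_posDef h

theorem measurableSet_normalClass_negDef :
    MeasurableSet (normalClass F u₀ (fun H => (-H).PosDef) S) :=
  measurableSet_normalClass_of_open hU hF hSm hS fun H _ h => by
    have ht : Tendsto (fun H' : Matrix (Fin n) (Fin n) ℝ => -H')
        (𝓝[{H' : Matrix (Fin n) (Fin n) ℝ | H'.IsHermitian}] H)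
        (𝓝[{H' : Matrix (Fin n) (Fin n) ℝ | H'.IsHermitian}] (-H)) :=
      tendsto_nhdsWithin_of_tendsto_nhds_of_eventually_within _
        ((continuous_neg.tendsto H).mono_left nhdsWithin_le_nhds)
        (by filter_upwards [self_mem_nhdsWithin] with H' h' using h'.neg)
    exact ht.eventually (eventually_posDef h)

theorem measurableSet_normalClass_indefinite :
    MeasurableSet (normalClass F u₀ IsIndefinite S) := by
  have h1 := measurableSet_normalClass_posDef hU hF hSm hS
  have h2 := measurableSet_normalClass_negDef hU hF hSm hS
  have h3 : MeasurableSet (normalClass F u₀ (fun H => H.det ≠ 0) S) :=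
    measurableSet_normalClass_of_open hU hF hSm hS fun H _ h => by
      have hd : Continuous fun H : Matrix (Fin n) (Fin n) ℝ => H.det := by fun_prop
      exact nhdsWithin_le_nhds (hd.continuousAt.eventually_ne h)
  have : normalClass F u₀ IsIndefinite S = (normalClass F u₀ (fun H => H.det ≠ 0) S \
      normalClass F u₀ (fun H => H.PosDef) S) \ normalClass F u₀ (fun H => (-H).PosDef) S := by
    ext z
    simp only [normalClass, IsIndefinite, IsDefinite, Set.mem_sdiff, mem_ofPred_eq]
    tauto
  rw [this]
  exact (h3.diff h1).diff h2

/-- Integrating a class function over the normal bundle, fiber by fiber. -/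
theorem lintegral_normalClass_eq {K : Matrix (Fin n) (Fin n) ℝ → Prop}
    {Φ : Matrix (Fin n) (Fin n) ℝ → ℝ} (hΦ : ContinuousOn Φ {H | H.IsHermitian})
    (hΦK : ∀ H, K H → Φ H = |H.det|) (hΦK' : ∀ H, ¬ K H → Φ H = 0)
    (hK : MeasurableSet (normalClass F u₀ K S)) :
    ∫⁻ z in normalClass F u₀ K S,
        ENNReal.ofReal (|(hess F z.1 (normalVec F u₀ z)).det| / |(pairing F u₀ z.1).det|) *
          weight (normalVec F u₀ z) ∂patchMeasure F u₀ =
      ∫⁻ u in S, ENNReal.ofReal (baseDensity F u₀ Φ u) := by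
  classical
  have h0 : ∀ H, 0 ≤ Φ H := fun H => by
    by_cases h : K H
    · rw [hΦK H h]; exact abs_nonneg _
    · rw [hΦK' H h]
  have hSu : MeasurableSet (S ×ˢ (univ : Set (baseNormal F u₀))) := hSm.prod MeasurableSet.univ
  have hsub : S ×ˢ (univ : Set (baseNormal F u₀)) ⊆
      {u | u ∈ U ∧ (pairing F u₀ u).det ≠ 0} ×ˢ univ := fun z hz => ⟨hS _ hz.1, trivial⟩
  have hm : AEMeasurable (fun z => ENNReal.ofReal (normalDensity F u₀ Φ z))
      (((volume : Measure (Euc n)).restrict S).prod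
        (Measure.addHaar : Measure (baseNormal F u₀))) := by
    have h := ((continuousOn_normalDensity u₀ hU hF hΦ).mono hsub).aemeasurable
      (μ := patchMeasure F u₀) hSu
    have h' := h.ennreal_ofReal
    rwa [patchMeasure, ← Measure.prod_restrict, Measure.restrict_univ] at h'
  calc _ = ∫⁻ z in S ×ˢ (univ : Set (baseNormal F u₀)),
        ENNReal.ofReal (normalDensity F u₀ Φ z) ∂patchMeasure F u₀ := by
        rw [← lintegral_indicator hK, ← lintegral_indicator hSu]
        refine lintegral_congr fun z => ?_
        by_cases hz : z.1 ∈ S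
        · rw [indicator_of_mem (s := S ×ˢ (univ : Set (baseNormal F u₀))) ⟨hz, trivial⟩]
          by_cases hKz : K (hess F z.1 (normalVec F u₀ z))
          · rw [indicator_of_mem (s := normalClass F u₀ K S) ⟨hz, hKz⟩, weight,
              ← ENNReal.ofReal_mul (by positivity), normalDensity, hΦK _ hKz]
          · rw [indicator_of_notMem (s := normalClass F u₀ K S) (fun h => hKz h.2),
              normalDensity, hΦK' _ hKz, zero_div, zero_mul, ENNReal.ofReal_zero]
        · rw [indicator_of_notMem (s := normalClass F u₀ K S) (fun h => hz h.1),
            indicator_of_notMem (s := S ×ˢ (univ : Set (baseNormal F u₀))) (fun h => hz h.1)]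
    _ = ∫⁻ u in S, ∫⁻ w, ENNReal.ofReal (normalDensity F u₀ Φ (u, w)) ∂Measure.addHaar := by
        rw [patchMeasure, ← Measure.prod_restrict, Measure.restrict_univ, lintegral_prod _ hm]
    _ = _ := by
        refine setLIntegral_congr_fun hSm fun u hu => ?_
        exact (ofReal_baseDensity hU hF hΦ h0 (hS u hu).1 (hS u hu).2).symm

theorem lintegral_indefinite_eq (hinj : Function.Injective (fderiv ℝ F u₀))
    {c : ℝ≥0∞} (hc : (volume : Measure (Euc m)) =
      c • (patchMeasure F u₀).map (frameEquiv hinj)) :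
    ∫⁻ v, weight v * (((critSet F IsIndefinite S v).encard : ℕ∞) : ℝ≥0∞) =
      c * ∫⁻ u in S, ENNReal.ofReal (baseDensity F u₀ indefiniteDet u) := by
  have hm := measurableSet_normalClass_indefinite hU hF hSm hS
  rw [lintegral_encard_critSet hU hF hinj hS hc (fun H h => h.2) hm measurable_weight,
    lintegral_normalClass_eq hU hF hSm hS continuousOn_indefiniteDet ?_ ?_ hm]
  · intro H h
    rw [indefiniteDet, if_neg h.1]
  · intro H h
    unfold indefiniteDet
    split_ifs with h1
    · rfl
    · by_contra h2
      exact h ⟨h1, fun h3 => h2 (by rw [h3, abs_zero])⟩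

theorem lintegral_definite_eq (hn : 0 < n) (hinj : Function.Injective (fderiv ℝ F u₀))
    {c : ℝ≥0∞} (hc : (volume : Measure (Euc m)) =
      c • (patchMeasure F u₀).map (frameEquiv hinj)) :
    (∫⁻ v, weight v * (((critSet F (fun H => H.PosDef) S v).encard : ℕ∞) : ℝ≥0∞)) +
      ∫⁻ v, weight v * (((critSet F (fun H => (-H).PosDef) S v).encard : ℕ∞) : ℝ≥0∞) =
      c * ∫⁻ u in S, ENNReal.ofReal (baseDensity F u₀ definiteDet u) := by
  have h1 := measurableSet_normalClass_posDef (u₀ := u₀) hU hF hSm hS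
  have h2 := measurableSet_normalClass_negDef (u₀ := u₀) hU hF hSm hS
  have hun : normalClass F u₀ IsDefinite S = normalClass F u₀ (fun H => H.PosDef) S ∪
      normalClass F u₀ (fun H => (-H).PosDef) S := by
    ext z
    simp only [normalClass, IsDefinite, mem_union, mem_ofPred_eq]
    tauto
  -- Positive dimension is essential: the empty matrix is both positive and negative definite. A
  -- diagonal entry separates the two classes.
  have hdis : Disjoint (normalClass F u₀ (fun H => H.PosDef) S)
      (normalClass F u₀ (fun H => (-H).PosDef) S) := by
    rw [Set.disjoint_left]
    rintro z ⟨-, hz1⟩ ⟨-, hz2⟩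
    have a := hz1.diag_pos (i := ⟨0, hn⟩)
    have b := hz2.diag_pos (i := ⟨0, hn⟩)
    rw [Matrix.neg_apply] at b
    linarith
  rw [lintegral_encard_critSet hU hF hinj hS hc (fun H h => h.det_pos.ne') h1 measurable_weight,
    lintegral_encard_critSet hU hF hinj hS hc (fun H h => IsDefinite.det_ne_zero (Or.inr h)) h2
      measurable_weight, ← mul_add, ← lintegral_union h2 hdis, ← hun,
    lintegral_normalClass_eq hU hF hSm hS continuousOn_definiteDet ?_ ?_ (hun ▸ h1.union h2)]
  · intro H h
    rw [definiteDet, if_pos h]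
  · intro H h
    rw [definiteDet, if_neg h]

end Measurability

include hU hF in
/-- The comparison of the numbers of indefinite and definite critical points on small patches. -/
theorem exists_patch (hn : 0 < n) (hu₀ : u₀ ∈ U) (hinj : Function.Injective (fderiv ℝ F u₀))
    (hframe : ∀ u ∈ U, ∃ ξ η, IsNonnegFrame F u ξ η) :
    ∃ V : Set (Euc n), IsOpen V ∧ u₀ ∈ V ∧ V ⊆ U ∧
      (∀ S : Set (Euc n), MeasurableSet S → S ⊆ V →
        (Measurable fun v => (((critSet F (fun H => H.PosDef) S v).encard : ℕ∞) : ℝ≥0∞)) ∧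
        (Measurable fun v => (((critSet F (fun H => (-H).PosDef) S v).encard : ℕ∞) : ℝ≥0∞)) ∧
        (Measurable fun v => (((critSet F IsIndefinite S v).encard : ℕ∞) : ℝ≥0∞)) ∧
        volume {v : Euc m | ∃ u ∈ S, IsCritVec F u v ∧ (hess F u v).det = 0} = 0 ∧
        ∫⁻ v, weight v * (((critSet F IsIndefinite S v).encard : ℕ∞) : ℝ≥0∞) ≤
          (∫⁻ v, weight v * (((critSet F (fun H => H.PosDef) S v).encard : ℕ∞) : ℝ≥0∞)) +
          ∫⁻ v, weight v * (((critSet F (fun H => (-H).PosDef) S v).encard : ℕ∞) : ℝ≥0∞) ∧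
        (∫⁻ v, weight v * (((critSet F (fun H => H.PosDef) S v).encard : ℕ∞) : ℝ≥0∞)) +
          ∫⁻ v, weight v * (((critSet F (fun H => (-H).PosDef) S v).encard : ℕ∞) : ℝ≥0∞) < ⊤) ∧
      (∫⁻ v, weight v * (((critSet F IsIndefinite V v).encard : ℕ∞) : ℝ≥0∞) =
          (∫⁻ v, weight v * (((critSet F (fun H => H.PosDef) V v).encard : ℕ∞) : ℝ≥0∞)) +
          ∫⁻ v, weight v * (((critSet F (fun H => (-H).PosDef) V v).encard : ℕ∞) : ℝ≥0∞) →
        ∀ ξ η, IsNonnegFrame F u₀ ξ η →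
          indefiniteDet (hess F u₀ ξ - hess F u₀ η) =
            definiteDet (hess F u₀ ξ + hess F u₀ η)) := by
  obtain ⟨c, hc0, hctop, hc⟩ := exists_volume_eq_smul_map hinj
  have hV₀ := isOpen_pairing_ne (u₀ := u₀) hU hF
  have hmem : u₀ ∈ {u | u ∈ U ∧ (pairing F u₀ u).det ≠ 0} := ⟨hu₀, pairing_base_det hinj⟩
  -- The closed ball stays where the pairing is invertible, so the densities are integrable by
  -- compactness and the comparison is between finite quantities.
  obtain ⟨r, hr, hball⟩ := Metric.nhds_basis_closedBall.mem_iff.1 (hV₀.mem_nhds hmem)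
  have hsub : Metric.ball u₀ r ⊆ {u | u ∈ U ∧ (pairing F u₀ u).det ≠ 0} :=
    Metric.ball_subset_closedBall.trans hball
  have hcd : ContinuousOn (baseDensity F u₀ definiteDet)
    {u | u ∈ U ∧ (pairing F u₀ u).det ≠ 0} := continuousOn_baseDensity hU hF continuousOn_definiteDet
  have hci : ContinuousOn (baseDensity F u₀ indefiniteDet)
    {u | u ∈ U ∧ (pairing F u₀ u).det ≠ 0} :=
      continuousOn_baseDensity hU hF continuousOn_indefiniteDet
  have hle : ∀ u, u ∈ U → (pairing F u₀ u).det ≠ 0 →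
      baseDensity F u₀ indefiniteDet u ≤ baseDensity F u₀ definiteDet u := by
    intro u hu hdet
    obtain ⟨ξ, η, h⟩ := hframe u hu
    exact h.baseDensity_le hU hF hu hdet
  have hfin : ∀ S ⊆ Metric.ball u₀ r,
      ∫⁻ u in S, ENNReal.ofReal (baseDensity F u₀ definiteDet u) < ⊤ := by
    intro S hS
    refine lt_of_le_of_lt (lintegral_mono_set (hS.trans Metric.ball_subset_closedBall)) ?_
    exact ((hcd.mono hball).integrableOn_compact (isCompact_closedBall _ _)).lintegral_lt_top
  have hmono : ∀ S ⊆ Metric.ball u₀ r, MeasurableSet S →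
      ∫⁻ u in S, ENNReal.ofReal (baseDensity F u₀ indefiniteDet u) ≤
      ∫⁻ u in S, ENNReal.ofReal (baseDensity F u₀ definiteDet u) := by
    intro S hS hSm
    exact setLIntegral_mono' hSm fun u hu =>
      ENNReal.ofReal_le_ofReal (hle u (hsub (hS hu)).1 (hsub (hS hu)).2)
  refine ⟨Metric.ball u₀ r, Metric.isOpen_ball, Metric.mem_ball_self hr,
    fun u hu => (hsub hu).1, ?_, ?_⟩
  · intro S hSm hSV
    have hS : ∀ u ∈ S, u ∈ U ∧ (pairing F u₀ u).det ≠ 0 := fun u hu => hsub (hSV hu)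
    refine ⟨?_, ?_, ?_, ?_, ?_, ?_⟩
    · exact measurable_encard_critSet hU hF hinj hS (fun H h => h.det_pos.ne')
        (measurableSet_normalClass_posDef hU hF hSm hS)
    · exact measurable_encard_critSet hU hF hinj hS
        (fun H h => IsDefinite.det_ne_zero (Or.inr h))
        (measurableSet_normalClass_negDef hU hF hSm hS)
    · exact measurable_encard_critSet hU hF hinj hS (fun H h => h.2)
        (measurableSet_normalClass_indefinite hU hF hSm hS)
    · exact volume_degenerate_eq_zero hU hF hinj hS
    · rw [lintegral_definite_eq hU hF hSm hS hn hinj hc,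
        lintegral_indefinite_eq hU hF hSm hS hinj hc]
      exact mul_le_mul' le_rfl (hmono S hSV hSm)
    · rw [lintegral_definite_eq hU hF hSm hS hn hinj hc]
      exact ENNReal.mul_lt_top hctop.lt_top (hfin S hSV)
  · intro heq ξ η h
    have hSm : MeasurableSet (Metric.ball u₀ r) := measurableSet_ball
    rw [lintegral_definite_eq hU hF hSm (fun u hu => hsub hu) hn hinj hc,
      lintegral_indefinite_eq hU hF hSm (fun u hu => hsub hu) hinj hc,
      ENNReal.mul_right_inj hc0 hctop] at heq
    -- Once the factor c is cancelled, two ordered densities have the same finite integral. They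
    -- agree almost everywhere, hence by continuity on the whole ball and in particular at its
    -- centre.
    have hae := ae_eq_of_ae_le_of_lintegral_le (μ := volume.restrict (Metric.ball u₀ r))
      (f := fun u => ENNReal.ofReal (baseDensity F u₀ indefiniteDet u))
      (g := fun u => ENNReal.ofReal (baseDensity F u₀ definiteDet u))
      ((ae_restrict_iff' hSm).2 (Eventually.of_forall fun u hu =>
        ENNReal.ofReal_le_ofReal (hle u (hsub hu).1 (hsub hu).2)))
      ((hmono _ subset_rfl hSm).trans_lt (hfin _ subset_rfl)).ne
      ((hcd.mono hsub).aemeasurable hSm).ennreal_ofReal heq.ge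
    have hEq := Measure.eqOn_open_of_ae_eq hae Metric.isOpen_ball
      (ENNReal.continuous_ofReal.comp_continuousOn (hci.mono hsub))
      (ENNReal.continuous_ofReal.comp_continuousOn (hcd.mono hsub)) (Metric.mem_ball_self hr)
    rw [ENNReal.ofReal_eq_ofReal_iff (baseDensity_nonneg indefiniteDet_nonneg _)
      (baseDensity_nonneg definiteDet_nonneg _)] at hEq
    exact h.indefiniteDet_eq hU hF hu₀ (pairing_base_det hinj) hEq

end PatchComparison

/-! ### The Gauss equation in coordinates -/

section Gauss

open Set Filter Topology

theorem differentiableAt_det {k n : ℕ} {A : Euc n → Matrix (Fin k) (Fin k) ℝ} {u : Euc n}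
    (hA : ∀ i j, DifferentiableAt ℝ (fun w => A w i j) u) :
    DifferentiableAt ℝ (fun w => (A w).det) u := by
  simp only [Matrix.det_apply]
  refine DifferentiableAt.fun_sum fun σ _ => DifferentiableAt.const_smul ?_ _
  exact (HasFDerivAt.finsetProd (g := fun i w => A w (σ i) i)
    fun i _ => (hA (σ i) i).hasFDerivAt).differentiableAt

theorem differentiableAt_inv_apply {k n : ℕ} {A : Euc n → Matrix (Fin k) (Fin k) ℝ} {u : Euc n}
    (hA : ∀ i j, DifferentiableAt ℝ (fun w => A w i j) u) (hdet : (A u).det ≠ 0)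
    (i j : Fin k) : DifferentiableAt ℝ (fun w => (A w)⁻¹ i j) u := by
  simp only [Matrix.inv_def, Ring.inverse_eq_inv', Matrix.smul_apply, smul_eq_mul,
    Matrix.adjugate_apply]
  refine ((differentiableAt_det hA).inv hdet).mul (differentiableAt_det fun a b => ?_)
  by_cases h : a = j
  · subst h
    simp only [Matrix.updateRow_self]
    exact differentiableAt_const _
  · simp only [Matrix.updateRow_ne h]
    exact hA a b

variable {n m : ℕ} {F : Euc n → Euc m} {U : Set (Euc n)} {g : Euc n → Matrix (Fin n) (Fin n) ℝ}

/-- The coordinate vector fields of the immersed patch. -/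
def d1 (F : Euc n → Euc m) (i : Fin n) (u : Euc n) : Euc m :=
  fderiv ℝ F u (EuclideanSpace.single i 1)

/-- The second partial derivatives of the immersed patch. -/
def d2 (F : Euc n → Euc m) (i j : Fin n) (u : Euc n) : Euc m :=
  fderiv ℝ (fderiv ℝ F) u (EuclideanSpace.single i 1) (EuclideanSpace.single j 1)

/-! ### Christoffel symbols and curvature of an induced metric -/

section Derivatives

variable (hU : IsOpen U) (hF : ContDiffOn ℝ ∞ F U)
include hU hF

theorem hasFDerivAt_d1 (i : Fin n) {u : Euc n} (hu : u ∈ U) :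
    HasFDerivAt (d1 F i) ((fderiv ℝ (fderiv ℝ F) u).flip (EuclideanSpace.single i 1)) u := by
  have := (hasFDerivAt_fderiv_patch hU hF hu).clm_apply
    (hasFDerivAt_const (EuclideanSpace.single i (1 : ℝ)) u)
  refine this.congr_fderiv ?_
  ext y
  simp

theorem d2_eq (i j : Fin n) {u : Euc n} (hu : u ∈ U) :
    d2 F i j u = fderiv ℝ (d1 F j) u (EuclideanSpace.single i 1) := by
  rw [(hasFDerivAt_d1 hU hF j hu).fderiv]; rfl

theorem d2_comm (i j : Fin n) {u : Euc n} (hu : u ∈ U) : d2 F i j u = d2 F j i u := by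
  have hs : IsSymmSndFDerivAt ℝ F u :=
    (hF.contDiffAt (hU.mem_nhds hu)).isSymmSndFDerivAt (by
      rw [minSmoothness_of_isRCLikeNormedField]
      exact WithTop.coe_le_coe.2 (le_top : (2 : ℕ∞) ≤ ⊤))
  exact hs _ _

theorem contDiffOn_d1 (i : Fin n) : ContDiffOn ℝ ∞ (d1 F i) U :=
  (contDiffOn_fderiv_patch hU hF).clm_apply contDiffOn_const

theorem differentiableAt_d2 (i j : Fin n) {u : Euc n} (hu : u ∈ U) :
    DifferentiableAt ℝ (d2 F i j) u := by
  have h := (hasFDerivAt_fderiv_patch hU (contDiffOn_d1 hU hF j) hu).differentiableAt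
  have h2 := h.clm_apply (differentiableAt_const (EuclideanSpace.single i (1 : ℝ)))
  refine h2.congr_of_eventuallyEq ?_
  filter_upwards [hU.mem_nhds hu] with w hw using d2_eq hU hF i j hw

/-- Third derivatives commute. -/
theorem fderiv_d2_comm (i j k : Fin n) {u : Euc n} (hu : u ∈ U) :
    fderiv ℝ (d2 F j k) u (EuclideanSpace.single i 1) =
      fderiv ℝ (d2 F i k) u (EuclideanSpace.single j 1) := by
  have key : ∀ a b : Fin n, fderiv ℝ (d2 F b k) u (EuclideanSpace.single a 1) =
      d2 (d1 F k) a b u := by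
    intro a b
    rw [d2_eq hU (contDiffOn_d1 hU hF k) a b hu]
    congr 1
    refine Filter.EventuallyEq.fderiv_eq ?_
    filter_upwards [hU.mem_nhds hu] with w hw using d2_eq hU hF b k hw
  rw [key, key, d2_comm hU (contDiffOn_d1 hU hF k) i j hu]

variable (hg : ∀ u ∈ U, ∀ i j, g u i j = inner ℝ (d1 F i u) (d1 F j u))
include hg

theorem hasFDerivAt_metric (i j : Fin n) {u : Euc n} (hu : u ∈ U) :
    DifferentiableAt ℝ (fun w => g w i j) u ∧ ∀ l, partialDeriv l (fun w => g w i j) u =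
      inner ℝ (d2 F l i u) (d1 F j u) + inner ℝ (d1 F i u) (d2 F l j u) := by
  have h := (hasFDerivAt_d1 hU hF i hu).inner ℝ (hasFDerivAt_d1 hU hF j hu)
  have h' := h.congr_of_eventuallyEq (f₁ := fun w => g w i j) (by
    filter_upwards [hU.mem_nhds hu] with w hw using hg w hw i j)
  refine ⟨h'.differentiableAt, fun l => ?_⟩
  rw [partialDeriv, h'.fderiv]
  simp [d2, add_comm]

/-- Each metric derivative is a sum of two products of second and first derivatives of F. Since
second derivatives commute, the three of them combine to 2⟨∂ᵢ∂ⱼF, ∂ₗF⟩. -/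
theorem christoffel_eq (k i j : Fin n) {u : Euc n} (hu : u ∈ U) :
    christoffel g k i j u = ∑ l, (g u)⁻¹ k l * inner ℝ (d2 F i j u) (d1 F l u) := by
  rw [christoffel, Finset.mul_sum]
  refine Finset.sum_congr rfl fun l _ => ?_
  rw [(hasFDerivAt_metric hU hF hg j l hu).2, (hasFDerivAt_metric hU hF hg i l hu).2,
    (hasFDerivAt_metric hU hF hg i j hu).2, d2_comm hU hF j i hu, d2_comm hU hF l i hu,
    d2_comm hU hF l j hu, real_inner_comm (d2 F i l u) (d1 F j u)]
  ring

variable (hdet : ∀ u ∈ U, (g u).det ≠ 0)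
include hdet

theorem sum_metric_christoffel (p j k : Fin n) {u : Euc n} (hu : u ∈ U) :
    ∑ l, g u p l * christoffel g l j k u = inner ℝ (d2 F j k u) (d1 F p u) := by
  have h1 : g u * (g u)⁻¹ = 1 := Matrix.mul_nonsing_inv _ (isUnit_iff_ne_zero.2 (hdet u hu))
  calc ∑ l, g u p l * christoffel g l j k u
      = ∑ l, ∑ q, g u p l * (g u)⁻¹ l q * inner ℝ (d2 F j k u) (d1 F q u) := by
        refine Finset.sum_congr rfl fun l _ => ?_
        rw [christoffel_eq hU hF hg l j k hu, Finset.mul_sum]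
        exact Finset.sum_congr rfl fun q _ => by ring
    _ = ∑ q, (g u * (g u)⁻¹) p q * inner ℝ (d2 F j k u) (d1 F q u) := by
        rw [Finset.sum_comm]
        refine Finset.sum_congr rfl fun q _ => ?_
        rw [Matrix.mul_apply, Finset.sum_mul]
    _ = _ := by
        rw [h1]
        simp [Matrix.one_apply]

theorem differentiableAt_christoffel (k i j : Fin n) {u : Euc n} (hu : u ∈ U) :
    DifferentiableAt ℝ (christoffel g k i j) u := by
  have h : DifferentiableAt ℝ
      (fun w => ∑ l, (g w)⁻¹ k l * inner ℝ (d2 F i j w) (d1 F l w)) u := by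
    refine DifferentiableAt.fun_sum fun l _ => ?_
    refine (differentiableAt_inv_apply (fun a b => (hasFDerivAt_metric hU hF hg a b hu).1)
      (hdet u hu) k l).mul ?_
    exact (differentiableAt_d2 hU hF i j hu).inner ℝ (hasFDerivAt_d1 hU hF l hu).differentiableAt
  refine h.congr_of_eventuallyEq ?_
  filter_upwards [hU.mem_nhds hu] with w hw using christoffel_eq hU hF hg k i j hw

/-- Obtained by differentiating the identity with lowered index in `sum_metric_christoffel`, which
avoids an explicit derivative of the inverse metric. -/
theorem sum_metric_partialDeriv_christoffel (p i j k : Fin n) {u : Euc n} (hu : u ∈ U) :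
    ∑ l, g u p l * partialDeriv i (christoffel g l j k) u =
      inner ℝ (fderiv ℝ (d2 F j k) u (EuclideanSpace.single i 1)) (d1 F p u) +
      inner ℝ (d2 F j k u) (d2 F i p u) -
      ∑ l, (inner ℝ (d2 F i p u) (d1 F l u) + inner ℝ (d1 F p u) (d2 F i l u)) *
        christoffel g l j k u := by
  have h1 : HasFDerivAt (fun w => ∑ l, g w p l * christoffel g l j k w)
      (∑ l, (g u p l • fderiv ℝ (christoffel g l j k) u +
        christoffel g l j k u • fderiv ℝ (fun w => g w p l) u)) u := by
    refine HasFDerivAt.fun_sum fun l _ => ?_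
    exact (hasFDerivAt_metric hU hF hg p l hu).1.hasFDerivAt.mul
      (differentiableAt_christoffel hU hF hg hdet l j k hu).hasFDerivAt
  have h2 : HasFDerivAt (fun w => inner ℝ (d2 F j k w) (d1 F p w)) _ u :=
    (differentiableAt_d2 hU hF j k hu).hasFDerivAt.inner ℝ (hasFDerivAt_d1 hU hF p hu)
  have h3 := h1.congr_of_eventuallyEq (f₁ := fun w => inner ℝ (d2 F j k w) (d1 F p w)) (by
    filter_upwards [hU.mem_nhds hu] with w hw
    exact (sum_metric_christoffel hU hF hg hdet p j k hw).symm)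
  have h4 := DFunLike.congr_fun (h3.unique h2) (EuclideanSpace.single i (1 : ℝ))
  have h5 : ∀ l, fderiv ℝ (fun w => g w p l) u (EuclideanSpace.single i 1) =
      inner ℝ (d2 F i p u) (d1 F l u) + inner ℝ (d1 F p u) (d2 F i l u) :=
    fun l => (hasFDerivAt_metric hU hF hg p l hu).2 i
  simp only [_root_.sum_apply, _root_.add_apply, _root_.smul_apply, smul_eq_mul, h5,
    Finset.sum_add_distrib] at h4
  have h6 : (∑ l, (inner ℝ (d2 F i p u) (d1 F l u) + inner ℝ (d1 F p u) (d2 F i l u)) *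
        christoffel g l j k u) = ∑ l, christoffel g l j k u *
        (inner ℝ (d2 F i p u) (d1 F l u) + inner ℝ (d1 F p u) (d2 F i l u)) :=
    Finset.sum_congr rfl fun l _ => mul_comm _ _
  rw [h6, eq_sub_iff_add_eq]
  unfold partialDeriv
  rw [h4]
  simp [d2, add_comm]

/-- The Gauss equation for coordinate vectors, with the normal component written through the
Christoffel symbols. -/
theorem sum_metric_curvatureCoeff (p i j k : Fin n) {u : Euc n} (hu : u ∈ U) :
    ∑ l, g u p l * curvatureCoeff g l i j k u =
      inner ℝ (d2 F i p u) (d2 F j k u - ∑ l, christoffel g l j k u • d1 F l u) -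
      inner ℝ (d2 F j p u) (d2 F i k u - ∑ l, christoffel g l i k u • d1 F l u) := by
  have e : ∀ i j : Fin n, ∑ l, g u p l * ∑ q, christoffel g l i q u * christoffel g q j k u =
      ∑ q, inner ℝ (d1 F p u) (d2 F i q u) * christoffel g q j k u := by
    intro i j
    calc ∑ l, g u p l * ∑ q, christoffel g l i q u * christoffel g q j k u
        = ∑ q, (∑ l, g u p l * christoffel g l i q u) * christoffel g q j k u := by
          simp only [Finset.mul_sum, Finset.sum_mul]
          rw [Finset.sum_comm]
          exact Finset.sum_congr rfl fun q _ => Finset.sum_congr rfl fun l _ => by ring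
      _ = _ := by
          refine Finset.sum_congr rfl fun q _ => ?_
          rw [sum_metric_christoffel hU hF hg hdet p i q hu, real_inner_comm]
  have e2 : ∀ i j : Fin n, inner ℝ (d2 F i p u)
      (d2 F j k u - ∑ l, christoffel g l j k u • d1 F l u) =
      inner ℝ (d2 F j k u) (d2 F i p u) -
        ∑ l, inner ℝ (d2 F i p u) (d1 F l u) * christoffel g l j k u := by
    intro i j
    rw [inner_sub_right, inner_sum, real_inner_comm]
    congr 1
    exact Finset.sum_congr rfl fun l _ => by rw [inner_smul_right, mul_comm]
  have hsplit : ∑ l, g u p l * curvatureCoeff g l i j k u =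
      (∑ l, g u p l * partialDeriv i (christoffel g l j k) u) -
      (∑ l, g u p l * partialDeriv j (christoffel g l i k) u) +
      ((∑ l, g u p l * ∑ q, christoffel g l i q u * christoffel g q j k u) -
        ∑ l, g u p l * ∑ q, christoffel g l j q u * christoffel g q i k u) := by
    rw [← Finset.sum_sub_distrib, ← Finset.sum_sub_distrib, ← Finset.sum_add_distrib]
    refine Finset.sum_congr rfl fun l _ => ?_
    rw [curvatureCoeff, Finset.sum_sub_distrib]
    ring
  -- Antisymmetry in i, j cancels the third derivatives. The quadratic Christoffel terms cancel half
  -- of the terms coming from derivatives of the metric, and the rest assembles into the normal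
  -- components.
  rw [hsplit, e, e, sum_metric_partialDeriv_christoffel hU hF hg hdet p i j k hu,
    sum_metric_partialDeriv_christoffel hU hF hg hdet p j i k hu,
    fderiv_d2_comm hU hF i j k hu, e2, e2]
  simp only [add_mul, Finset.sum_add_distrib]
  ring

/-- The normal component of the second derivatives. -/
theorem starProjection_d2 (j k : Fin n) {u : Euc n} (hu : u ∈ U) :
    (LinearMap.range (fderiv ℝ F u).toLinearMap)ᗮ.starProjection (d2 F j k u) =
      d2 F j k u - ∑ l, christoffel g l j k u • d1 F l u := by
  refine Submodule.eq_starProjection_of_mem_of_inner_eq_zero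
    (K := (LinearMap.range (fderiv ℝ F u).toLinearMap)ᗮ) ?_ ?_
  · rw [Submodule.mem_orthogonal]
    rintro _ ⟨x, rfl⟩
    have hp : ∀ p, inner ℝ (d1 F p u) (d2 F j k u - ∑ l, christoffel g l j k u • d1 F l u) = 0 := by
      intro p
      rw [inner_sub_right, inner_sum, ← real_inner_comm,
        ← sum_metric_christoffel hU hF hg hdet p j k hu, sub_eq_zero]
      refine Finset.sum_congr rfl fun l _ => ?_
      rw [inner_smul_right, hg u hu, mul_comm]
    have hx : fderiv ℝ F u x = ∑ i, x i • d1 F i u := by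
      conv_lhs => rw [sum_smul_single x]
      simp [d1]
    change inner ℝ (fderiv ℝ F u x) _ = 0
    rw [hx, sum_inner]
    exact Finset.sum_eq_zero fun i _ => by rw [real_inner_smul_left, hp, mul_zero]
  · intro w hw
    have hmem : ∑ l, christoffel g l j k u • d1 F l u ∈
        LinearMap.range (fderiv ℝ F u).toLinearMap :=
      Submodule.sum_mem _ fun l _ => Submodule.smul_mem _ _ ⟨_, rfl⟩
    rw [sub_sub_cancel]
    exact (Submodule.mem_orthogonal _ _).1 hw _ hmem

omit hU hF hg hdet in
theorem inner_snd_expand (P : Euc m →L[ℝ] Euc m) (u x y z w : Euc n) :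
    inner ℝ (fderiv ℝ (fderiv ℝ F) u x y) (P (fderiv ℝ (fderiv ℝ F) u z w)) =
      ∑ i, ∑ p, ∑ j, ∑ k, x i * y p * z j * w k *
        inner ℝ (d2 F i p u) (P (d2 F j k u)) := by
  have ex : ∀ a b : Euc n, fderiv ℝ (fderiv ℝ F) u a b = ∑ i, ∑ p, (a i * b p) • d2 F i p u := by
    intro a b
    conv_lhs => rw [sum_smul_single a, sum_smul_single b]
    simp only [map_sum, map_smul, _root_.sum_apply, _root_.smul_apply, Finset.smul_sum, smul_smul]
    rw [Finset.sum_comm]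
    exact Finset.sum_congr rfl fun i _ => Finset.sum_congr rfl fun j _ => by rw [mul_comm]; rfl
  rw [ex x y, sum_inner]
  refine Finset.sum_congr rfl fun i _ => ?_
  rw [sum_inner]
  refine Finset.sum_congr rfl fun p _ => ?_
  rw [real_inner_smul_left, ex z w, map_sum, inner_sum, Finset.mul_sum]
  refine Finset.sum_congr rfl fun j _ => ?_
  rw [map_sum, inner_sum, Finset.mul_sum]
  refine Finset.sum_congr rfl fun k _ => ?_
  rw [map_smul, inner_smul_right]
  ring

/-- The Gauss equation. -/
theorem curvatureQuad_eq {u : Euc n} (hu : u ∈ U) (X Y : Euc n) :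
    curvatureQuad g u X Y =
      inner ℝ (fderiv ℝ (fderiv ℝ F) u X X)
        ((LinearMap.range (fderiv ℝ F u).toLinearMap)ᗮ.starProjection
          (fderiv ℝ (fderiv ℝ F) u Y Y)) -
      inner ℝ (fderiv ℝ (fderiv ℝ F) u Y X)
        ((LinearMap.range (fderiv ℝ F u).toLinearMap)ᗮ.starProjection
          (fderiv ℝ (fderiv ℝ F) u X Y)) := by
  set P := (LinearMap.range (fderiv ℝ F u).toLinearMap)ᗮ.starProjection with hP
  rw [inner_snd_expand, inner_snd_expand]
  have h1 : curvatureQuad g u X Y = ∑ i, ∑ j, ∑ k, ∑ p, X i * Y j * Y k * X p *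
      (inner ℝ (d2 F i p u) (P (d2 F j k u)) - inner ℝ (d2 F j p u) (P (d2 F i k u))) := by
    rw [curvatureQuad]
    refine Finset.sum_congr rfl fun i _ => Finset.sum_congr rfl fun j _ =>
      Finset.sum_congr rfl fun k _ => ?_
    rw [Finset.sum_comm]
    refine Finset.sum_congr rfl fun p _ => ?_
    rw [hP, starProjection_d2 hU hF hg hdet j k hu, starProjection_d2 hU hF hg hdet i k hu,
      ← sum_metric_curvatureCoeff hU hF hg hdet p i j k hu, Finset.mul_sum]
    refine Finset.sum_congr rfl fun l _ => ?_
    rw [hg u hu l p, hg u hu p l, real_inner_comm]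
    ring
  rw [h1]
  simp only [mul_sub, Finset.sum_sub_distrib]
  refine congrArg₂ (· - ·) ?_ ?_
  · refine Finset.sum_congr rfl fun i _ => ?_
    calc ∑ j, ∑ k, ∑ p, X i * Y j * Y k * X p * inner ℝ (d2 F i p u) (P (d2 F j k u))
        = ∑ j, ∑ p, ∑ k, X i * Y j * Y k * X p * inner ℝ (d2 F i p u) (P (d2 F j k u)) :=
          Finset.sum_congr rfl fun j _ => Finset.sum_comm
      _ = ∑ p, ∑ j, ∑ k, X i * Y j * Y k * X p * inner ℝ (d2 F i p u) (P (d2 F j k u)) :=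
          Finset.sum_comm
      _ = _ := Finset.sum_congr rfl fun p _ => Finset.sum_congr rfl fun j _ =>
          Finset.sum_congr rfl fun k _ => by ring
  · rw [Finset.sum_comm]
    refine Finset.sum_congr rfl fun j _ => ?_
    calc ∑ i, ∑ k, ∑ p, X i * Y j * Y k * X p * inner ℝ (d2 F j p u) (P (d2 F i k u))
        = ∑ i, ∑ p, ∑ k, X i * Y j * Y k * X p * inner ℝ (d2 F j p u) (P (d2 F i k u)) :=
          Finset.sum_congr rfl fun j _ => Finset.sum_comm
      _ = ∑ p, ∑ i, ∑ k, X i * Y j * Y k * X p * inner ℝ (d2 F j p u) (P (d2 F i k u)) :=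
          Finset.sum_comm
      _ = _ := Finset.sum_congr rfl fun p _ => Finset.sum_congr rfl fun j _ =>
          Finset.sum_congr rfl fun k _ => by ring

end Derivatives

end Gauss

/-! ### Planar sets with pairwise nonnegative inner products -/

section Quadrant

/-- Vectors of the plane with pairwise nonnegative inner products lie in a quadrant. -/
theorem exists_quadrant {C : Set (ℝ × ℝ)}
    (hC : ∀ c ∈ C, ∀ d ∈ C, 0 ≤ c.1 * d.1 + c.2 * d.2) :
    ∃ a b : ℝ, a ^ 2 + b ^ 2 = 1 ∧ ∀ c ∈ C, 0 ≤ a * c.1 + b * c.2 ∧ 0 ≤ -b * c.1 + a * c.2 := by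
  suffices h : ∃ a b : ℝ, 0 < a ^ 2 + b ^ 2 ∧
      ∀ c ∈ C, 0 ≤ a * c.1 + b * c.2 ∧ 0 ≤ -b * c.1 + a * c.2 by
    obtain ⟨a, b, hab, h⟩ := h
    have hs := Real.sqrt_pos.2 hab
    refine ⟨a / √(a ^ 2 + b ^ 2), b / √(a ^ 2 + b ^ 2), ?_, fun c hc => ?_⟩
    · rw [div_pow, div_pow, Real.sq_sqrt hab.le, ← add_div, div_self hab.ne']
    · have e1 : a / √(a ^ 2 + b ^ 2) * c.1 + b / √(a ^ 2 + b ^ 2) * c.2 =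
        (a * c.1 + b * c.2) / √(a ^ 2 + b ^ 2) := by ring
      have e2 : -(b / √(a ^ 2 + b ^ 2)) * c.1 + a / √(a ^ 2 + b ^ 2) * c.2 =
        (-b * c.1 + a * c.2) / √(a ^ 2 + b ^ 2) := by ring
      rw [e1, e2]
      exact ⟨div_nonneg (h c hc).1 hs.le, div_nonneg (h c hc).2 hs.le⟩
  by_cases h0 : ∀ c ∈ C, c = 0
  · exact ⟨1, 0, by norm_num, fun c hc => by simp [h0 c hc]⟩
  push Not at h0
  obtain ⟨⟨p, q⟩, hpq, hne⟩ := h0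
  have hpos : 0 < p ^ 2 + q ^ 2 := by
    rcases eq_or_ne p 0 with rfl | hp
    · have : q ≠ 0 := fun hq => hne (by rw [hq]; rfl)
      positivity
    · positivity
  -- Up to a common scale these are coordinates with first axis along the chosen nonzero vector (p,
  -- q) of C, so X ≥ 0 on C.
  let X : ℝ × ℝ → ℝ := fun c => p * c.1 + q * c.2
  let Y : ℝ × ℝ → ℝ := fun c => -q * c.1 + p * c.2
  have hX : ∀ c ∈ C, 0 ≤ X c := fun c hc => hC _ hpq c hc
  have hXY : ∀ c ∈ C, ∀ d ∈ C, 0 ≤ X c * X d + Y c * Y d := by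
    intro c hc d hd
    have : X c * X d + Y c * Y d = (p ^ 2 + q ^ 2) * (c.1 * d.1 + c.2 * d.2) := by
      simp only [X, Y]; ring
    rw [this]
    exact mul_nonneg hpos.le (hC c hc d hd)
  suffices h : ∃ α β : ℝ, 0 < α ^ 2 + β ^ 2 ∧
      ∀ c ∈ C, 0 ≤ α * X c + β * Y c ∧ 0 ≤ -β * X c + α * Y c by
    obtain ⟨α, β, hαβ, h⟩ := h
    refine ⟨α * p - β * q, α * q + β * p, ?_, fun c hc => ?_⟩
    · have : (α * p - β * q) ^ 2 + (α * q + β * p) ^ 2 = (α ^ 2 + β ^ 2) * (p ^ 2 + q ^ 2) := by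
        ring
      rw [this]; positivity
    · have e1 : (α * p - β * q) * c.1 + (α * q + β * p) * c.2 = α * X c + β * Y c := by
        simp only [X, Y]; ring
      have e2 : -(α * q + β * p) * c.1 + (α * p - β * q) * c.2 = -β * X c + α * Y c := by
        simp only [X, Y]; ring
      rw [e1, e2]
      exact h c hc
  by_cases hpos' : ∀ c ∈ C, 0 ≤ Y c
  · exact ⟨1, 0, by norm_num, fun c hc => ⟨by linarith [hX c hc], by linarith [hpos' c hc]⟩⟩
  by_cases hneg' : ∀ c ∈ C, Y c ≤ 0
  · exact ⟨0, -1, by norm_num, fun c hc => ⟨by linarith [hneg' c hc], by linarith [hX c hc]⟩⟩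
  push Not at hpos' hneg'
  obtain ⟨c₁, hc₁, hY₁⟩ := hneg'
  obtain ⟨c₂, hc₂, hY₂⟩ := hpos'
  -- A vector with X = 0 must pair nonnegatively with both c₁ (Y > 0) and c₂ (Y < 0), which forces Y
  -- = 0. Slopes are therefore defined for every nonzero vector of C.
  have hXpos : ∀ c ∈ C, Y c ≠ 0 → 0 < X c := by
    intro c hc hY
    refine lt_of_le_of_ne (hX c hc) fun h => ?_
    have h1 := hXY c hc c₁ hc₁
    have h2 := hXY c hc c₂ hc₂
    rw [← h, zero_mul, zero_add] at h1 h2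
    have h3 : 0 ≤ Y c := nonneg_of_mul_nonneg_left h1 hY₁
    have h4 : Y c ≤ 0 := by
      by_contra! h5
      nlinarith
    exact hY (le_antisymm h4 h3)
  -- The infimum m of the slopes gives the lower edge (1, m); the other edge is (−m, 1). Vectors
  -- with Y > 0 bound all slopes below by −X/Y, which is the inequality X + mY ≥ 0.
  let T : Set ℝ := {t | ∃ c ∈ C, 0 < X c ∧ t = Y c / X c}
  have hlow : ∀ c ∈ C, 0 < Y c → ∀ t ∈ T, -(X c / Y c) ≤ t := by
    rintro c hc hY _ ⟨d, hd, hXd, rfl⟩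
    have := hXY c hc d hd
    rw [neg_le_iff_add_nonneg, div_add_div _ _ hXd.ne' hY.ne']
    exact div_nonneg (by nlinarith) (mul_pos hXd hY).le
  have hbdd : BddBelow T := ⟨_, hlow c₁ hc₁ hY₁⟩
  have h2T : Y c₂ / X c₂ ∈ T := ⟨c₂, hc₂, hXpos c₂ hc₂ hY₂.ne, rfl⟩
  have hm0 : sInf T ≤ 0 := (csInf_le hbdd h2T).trans
    (div_nonpos_of_nonpos_of_nonneg hY₂.le (hX c₂ hc₂))
  refine ⟨1, sInf T, by positivity, fun c hc => ⟨?_, ?_⟩⟩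
  · rcases le_or_gt (Y c) 0 with hY | hY
    · have := mul_nonneg_of_nonpos_of_nonpos hm0 hY
      linarith [hX c hc]
    · have h1 : -(X c / Y c) ≤ sInf T := le_csInf ⟨_, h2T⟩ (hlow c hc hY)
      have h2 := mul_le_mul_of_nonneg_right h1 hY.le
      rw [neg_mul, div_mul_cancel₀ _ hY.ne'] at h2
      linarith
  · rcases eq_or_lt_of_le (hX c hc) with h | h
    · have hY0 : Y c = 0 := by
        by_contra hY
        exact (hXpos c hc hY).ne h
      rw [← h, hY0]; simp
    · have h1 : sInf T ≤ Y c / X c := csInf_le hbdd ⟨c, hc, h, rfl⟩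
      rw [le_div_iff₀ h] at h1
      linarith

/-- Vectors in a Euclidean plane with pairwise nonnegative inner products lie in a quadrant. -/
theorem exists_orthonormalBasis_quadrant {N : Type*} [NormedAddCommGroup N]
    [InnerProductSpace ℝ N] (b₀ : OrthonormalBasis (Fin 2) ℝ N) {C : Set N}
    (hC : ∀ c ∈ C, ∀ d ∈ C, (0 : ℝ) ≤ inner ℝ c d) :
    ∃ b : OrthonormalBasis (Fin 2) ℝ N, ∀ c ∈ C, 0 ≤ inner ℝ c (b 0) ∧ 0 ≤ inner ℝ c (b 1) := by
  have hexp : ∀ c : N, c = inner ℝ (b₀ 0) c • b₀ 0 + inner ℝ (b₀ 1) c • b₀ 1 := fun c => by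
    conv_lhs => rw [← b₀.sum_repr' c, Fin.sum_univ_two]
  have h00 : inner ℝ (b₀ 0) (b₀ 0) = (1 : ℝ) := by
    rw [real_inner_self_eq_norm_sq, b₀.norm_eq_one, one_pow]
  have h11 : inner ℝ (b₀ 1) (b₀ 1) = (1 : ℝ) := by
    rw [real_inner_self_eq_norm_sq, b₀.norm_eq_one, one_pow]
  have h01 : inner ℝ (b₀ 0) (b₀ 1) = (0 : ℝ) := b₀.inner_eq_zero (by decide)
  have h10 : inner ℝ (b₀ 1) (b₀ 0) = (0 : ℝ) := b₀.inner_eq_zero (by decide)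
  obtain ⟨α, β, hαβ, h⟩ := exists_quadrant
    (C := (fun c : N => ((inner ℝ (b₀ 0) c : ℝ), (inner ℝ (b₀ 1) c : ℝ))) '' C) (by
      rintro _ ⟨c, hc, rfl⟩ _ ⟨d, hd, rfl⟩
      have := hC c hc d hd
      rw [hexp c, hexp d] at this
      simp only [inner_add_left, inner_add_right, inner_smul_right, real_inner_smul_left, h00, h11,
        h01, h10] at this
      dsimp only
      linarith)
  let v : Fin 2 → N := ![α • b₀ 0 + β • b₀ 1, -β • b₀ 0 + α • b₀ 1]
  have hv : Orthonormal ℝ v := by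
    rw [orthonormal_iff_ite]
    intro i j
    fin_cases i <;> fin_cases j <;>
      simp only [v, Fin.zero_eta, Fin.mk_one, Matrix.cons_val_zero, Matrix.cons_val_one,
        inner_add_left, inner_add_right, inner_smul_right, real_inner_smul_left, h00, h11, h01,
        h10] <;> norm_num <;> linarith
  have hcard : Module.finrank ℝ N = 2 := by
    rw [Module.finrank_eq_card_basis b₀.toBasis, Fintype.card_fin]
  have hfin : FiniteDimensional ℝ N := b₀.toBasis.finiteDimensional_of_finite
  let b := OrthonormalBasis.mk hv (by
    rw [hv.linearIndependent.span_eq_top_of_card_eq_finrank (by rw [hcard, Fintype.card_fin])])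
  have hb : ⇑b = v := OrthonormalBasis.coe_mk hv _
  refine ⟨b, fun c hc => ?_⟩
  have := h _ ⟨c, hc, rfl⟩
  rw [hb]
  simp only [v, Matrix.cons_val_zero, Matrix.cons_val_one, inner_add_right, inner_smul_right,
    real_inner_comm (b₀ 0) c, real_inner_comm (b₀ 1) c]
  exact this

end Quadrant

/-! ### Passing from the manifold to coordinate patches -/

section SecondDerivative

open Set Filter Topology

variable {n m : ℕ}

theorem fderiv_of_eventuallyEq_comp {F G : Euc n → Euc m} {ψ : Euc n → Euc n} {u : Euc n}
    (h : F =ᶠ[𝓝 u] G ∘ ψ) (hψ : ContDiffAt ℝ ∞ ψ u) (hG : ContDiffAt ℝ ∞ G (ψ u)) :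
    fderiv ℝ F u = (fderiv ℝ G (ψ u)).comp (fderiv ℝ ψ u) := by
  rw [h.fderiv_eq]
  exact fderiv_comp u (hG.differentiableAt (by norm_num)) (hψ.differentiableAt (by norm_num))

/-- The second order chain rule. The last term is tangent to the image of G, so it drops out when
paired with a normal vector. -/
theorem fderiv_fderiv_of_eventuallyEq_comp {F G : Euc n → Euc m} {ψ : Euc n → Euc n} {u : Euc n}
    (h : F =ᶠ[𝓝 u] G ∘ ψ) (hψ : ContDiffAt ℝ ∞ ψ u) (hG : ContDiffAt ℝ ∞ G (ψ u)) (X Y : Euc n) :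
    fderiv ℝ (fderiv ℝ F) u X Y =
      fderiv ℝ (fderiv ℝ G) (ψ u) (fderiv ℝ ψ u X) (fderiv ℝ ψ u Y) +
        fderiv ℝ G (ψ u) (fderiv ℝ (fderiv ℝ ψ) u X Y) := by
  have hψ' : ∀ᶠ w in 𝓝 u, ContDiffAt ℝ (1 : ℕ) ψ w :=
    (hψ.of_le (by exact_mod_cast le_top)).eventually (by norm_num)
  have hG' : ∀ᶠ w in 𝓝 u, ContDiffAt ℝ (1 : ℕ) G (ψ w) :=
    hψ.continuousAt.eventually ((hG.of_le (by exact_mod_cast le_top)).eventually (by norm_num))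
  have h1 : fderiv ℝ F =ᶠ[𝓝 u] fun w => (fderiv ℝ G (ψ w)).comp (fderiv ℝ ψ w) := by
    filter_upwards [h.eventuallyEq_nhds, hψ', hG'] with w hw h1 h2
    rw [hw.fderiv_eq]
    exact fderiv_comp w (h2.differentiableAt (by norm_num)) (h1.differentiableAt (by norm_num))
  have h2 : HasFDerivAt (fderiv ℝ ψ) (fderiv ℝ (fderiv ℝ ψ) u) u :=
    ((hψ.fderiv_right (m := ∞) (by norm_num)).differentiableAt (by norm_num)).hasFDerivAt
  have h3 : HasFDerivAt (fderiv ℝ G) (fderiv ℝ (fderiv ℝ G) (ψ u)) (ψ u) :=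
    ((hG.fderiv_right (m := ∞) (by norm_num)).differentiableAt (by norm_num)).hasFDerivAt
  have h4 := (h3.comp u (hψ.differentiableAt (by norm_num)).hasFDerivAt).clm_comp h2
  rw [h1.fderiv_eq]
  erw [h4.fderiv]
  simp [add_comm]

theorem fderiv_inner_comp {F : Euc n → Euc m} {u : Euc n} (hF : ContDiffAt ℝ ∞ F u) (v : Euc m)
    (X : Euc n) :
    fderiv ℝ (fun w => inner ℝ v (F w)) u X = inner ℝ (fderiv ℝ F u X) v := by
  have h := ((innerSL ℝ v).hasFDerivAt.comp u (hF.differentiableAt (by norm_num)).hasFDerivAt)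
  have h' : HasFDerivAt (fun w => inner ℝ v (F w)) ((innerSL ℝ v).comp (fderiv ℝ F u)) u := h
  rw [h'.fderiv, real_inner_comm]; rfl

theorem fderiv_fderiv_inner_comp {F : Euc n → Euc m} {u : Euc n} (hF : ContDiffAt ℝ ∞ F u)
    (v : Euc m) (X Y : Euc n) :
    fderiv ℝ (fderiv ℝ (fun w => inner ℝ v (F w))) u X Y =
      inner ℝ (fderiv ℝ (fderiv ℝ F) u X Y) v := by
  have hF' : ∀ᶠ w in 𝓝 u, ContDiffAt ℝ (1 : ℕ) F w :=
    (hF.of_le (by exact_mod_cast le_top)).eventually (by norm_num)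
  have h1 : fderiv ℝ (fun w => inner ℝ v (F w)) =ᶠ[𝓝 u] fun w => (innerSL ℝ v).comp (fderiv ℝ F w) := by
    filter_upwards [hF'] with w h1
    exact ((innerSL ℝ v).hasFDerivAt.comp w (h1.differentiableAt (by norm_num)).hasFDerivAt).fderiv
  have h2 : HasFDerivAt (fderiv ℝ F) (fderiv ℝ (fderiv ℝ F) u) u :=
    ((hF.fderiv_right (m := ∞) (by norm_num)).differentiableAt (by norm_num)).hasFDerivAt
  have h3 := (hasFDerivAt_const (innerSL ℝ v) u).clm_comp h2
  rw [h1.fderiv_eq, h3.fderiv, real_inner_comm]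
  simp

end SecondDerivative

/-! ### Critical points and Hessians under a change of charts -/

section Patch

open Set Filter Topology

variable {n m : ℕ} {M : Type*} [TopologicalSpace M] [ChartedSpace (Euc n) M]

/-- The map `f` in the preferred chart at `q`. -/
def patch (f : M → Euc m) (q : M) : Euc n → Euc m := f ∘ (extChartAt (𝓡 n) q).symm

variable [IsManifold (𝓡 n) ∞ M] {f : M → Euc m} (hf : ContMDiff (𝓡 n) 𝓘(ℝ, Euc m) ∞ f)

include hf in
theorem contDiffOn_patch (q : M) : ContDiffOn ℝ ∞ (patch f q) (extChartAt (𝓡 n) q).target :=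
  contMDiffOn_iff_contDiffOn.1 (hf.comp_contMDiffOn (contMDiffOn_extChartAt_symm q))

include hf in
theorem contDiffAt_patch (q : M) {u : Euc n} (hu : u ∈ (extChartAt (𝓡 n) q).target) :
    ContDiffAt ℝ ∞ (patch f q) u :=
  (contDiffOn_patch hf q).contDiffAt ((isOpen_extChartAt_target q).mem_nhds hu)

variable (n) in
/-- The change from the preferred chart at `p` to the one at `q`. -/
def transition (p q : M) : Euc n → Euc n := extChartAt (𝓡 n) q ∘ (extChartAt (𝓡 n) p).symm

omit [IsManifold (𝓡 n) ∞ M] in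
theorem transition_apply {p q r : M} (hp : r ∈ (extChartAt (𝓡 n) p).source) :
    transition n p q (extChartAt (𝓡 n) p r) = extChartAt (𝓡 n) q r := by
  exact congrArg _ ((extChartAt (𝓡 n) p).left_inv hp)

omit [IsManifold (𝓡 n) ∞ M] in
theorem eventually_mem_source {p q r : M} (hp : r ∈ (extChartAt (𝓡 n) p).source)
    (hq : r ∈ (extChartAt (𝓡 n) q).source) :
    ∀ᶠ w in 𝓝 (extChartAt (𝓡 n) p r), w ∈ (extChartAt (𝓡 n) p).target ∧
      (extChartAt (𝓡 n) p).symm w ∈ (extChartAt (𝓡 n) q).source := by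
  have ht := (extChartAt (𝓡 n) p).map_source hp
  refine (show ∀ᶠ w in _, _ from (isOpen_extChartAt_target p).mem_nhds ht).and ?_
  have hc : ContinuousAt (extChartAt (𝓡 n) p).symm (extChartAt (𝓡 n) p r) :=
    (continuousOn_extChartAt_symm p).continuousAt ((isOpen_extChartAt_target p).mem_nhds ht)
  refine hc.eventually ((isOpen_extChartAt_source q).mem_nhds ?_)
  rwa [(extChartAt (𝓡 n) p).left_inv hp]

theorem contDiffAt_transition {p q r : M} (hp : r ∈ (extChartAt (𝓡 n) p).source)
    (hq : r ∈ (extChartAt (𝓡 n) q).source) :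
    ContDiffAt ℝ ∞ (transition n p q) (extChartAt (𝓡 n) p r) := by
  have ht := (extChartAt (𝓡 n) p).map_source hp
  have h1 : ContMDiffAt 𝓘(ℝ, Euc n) (𝓡 n) ∞ (extChartAt (𝓡 n) p).symm (extChartAt (𝓡 n) p r) :=
    (contMDiffOn_extChartAt_symm p).contMDiffAt ((isOpen_extChartAt_target p).mem_nhds ht)
  have h2 : ContMDiffAt (𝓡 n) 𝓘(ℝ, Euc n) ∞ (extChartAt (𝓡 n) q)
      ((extChartAt (𝓡 n) p).symm (extChartAt (𝓡 n) p r)) := by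
    rw [(extChartAt (𝓡 n) p).left_inv hp]
    exact contMDiffAt_extChartAt' (by rwa [extChartAt_source] at hq)
  exact contMDiffAt_iff_contDiffAt.1 (h2.comp _ h1)

omit [IsManifold (𝓡 n) ∞ M] in
theorem patch_eventuallyEq (f : M → Euc m) {p q r : M} (hp : r ∈ (extChartAt (𝓡 n) p).source)
    (hq : r ∈ (extChartAt (𝓡 n) q).source) :
    patch f p =ᶠ[𝓝 (extChartAt (𝓡 n) p r)] patch f q ∘ transition n p q := by
  filter_upwards [eventually_mem_source hp hq] with w hw
  exact congrArg f ((extChartAt (𝓡 n) q).left_inv hw.2).symm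

theorem fderiv_transition_comp {p q r : M} (hp : r ∈ (extChartAt (𝓡 n) p).source)
    (hq : r ∈ (extChartAt (𝓡 n) q).source) (X : Euc n) :
    fderiv ℝ (transition n q p) (extChartAt (𝓡 n) q r)
      (fderiv ℝ (transition n p q) (extChartAt (𝓡 n) p r) X) = X := by
  have h1 := (contDiffAt_transition hp hq).differentiableAt (by norm_num)
  have h2 := (contDiffAt_transition hq hp).differentiableAt (by norm_num)
  rw [← transition_apply hp] at h2 ⊢
  have h3 := h2.hasFDerivAt.comp _ h1.hasFDerivAt
  have h4 : transition n q p ∘ transition n p q =ᶠ[𝓝 (extChartAt (𝓡 n) p r)] id := by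
    filter_upwards [eventually_mem_source hp hq] with w hw
    exact (congrArg (extChartAt (𝓡 n) p) ((extChartAt (𝓡 n) q).left_inv hw.2)).trans
      ((extChartAt (𝓡 n) p).right_inv hw.1)
  have h5 := (h3.congr_of_eventuallyEq h4.symm).unique (hasFDerivAt_id _)
  exact congrArg (fun L : Euc n →L[ℝ] Euc n => L X) h5

variable (n) in
/-- The differential of a change of charts. -/
def transitionEquiv {p q r : M} (hp : r ∈ (extChartAt (𝓡 n) p).source)
    (hq : r ∈ (extChartAt (𝓡 n) q).source) : Euc n ≃ₗ[ℝ] Euc n where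
  toLinearMap := (fderiv ℝ (transition n p q) (extChartAt (𝓡 n) p r)).toLinearMap
  invFun := fderiv ℝ (transition n q p) (extChartAt (𝓡 n) q r)
  left_inv X := fderiv_transition_comp hp hq X
  right_inv X := fderiv_transition_comp hq hp X

include hf in
theorem fderiv_patch {p q r : M} (hp : r ∈ (extChartAt (𝓡 n) p).source)
    (hq : r ∈ (extChartAt (𝓡 n) q).source) (X : Euc n) :
    fderiv ℝ (patch f p) (extChartAt (𝓡 n) p r) X =
      fderiv ℝ (patch f q) (extChartAt (𝓡 n) q r) (transitionEquiv n hp hq X) := by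
  have h := fderiv_of_eventuallyEq_comp (patch_eventuallyEq f hp hq) (contDiffAt_transition hp hq)
    (by rw [transition_apply hp]; exact contDiffAt_patch hf q ((extChartAt (𝓡 n) q).map_source hq))
  rw [transition_apply hp] at h
  rw [h]; rfl

include hf in
theorem isCritVec_patch_iff {p q r : M} (hp : r ∈ (extChartAt (𝓡 n) p).source)
    (hq : r ∈ (extChartAt (𝓡 n) q).source) (v : Euc m) :
    IsCritVec (patch f p) (extChartAt (𝓡 n) p r) v ↔
      IsCritVec (patch f q) (extChartAt (𝓡 n) q r) v := by
  constructor
  · intro h X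
    have := h ((transitionEquiv n hp hq).symm X)
    rwa [fderiv_patch hf hp hq, LinearEquiv.apply_symm_apply] at this
  · intro h X
    rw [fderiv_patch hf hp hq]; exact h _

include hf in
-- At a critical point the Hessian is a tensor: the second derivative of the transition map enters
-- only through the differential of the immersion, whose image is orthogonal to v.
theorem inner_fderiv_fderiv_patch {p q r : M} (hp : r ∈ (extChartAt (𝓡 n) p).source)
    (hq : r ∈ (extChartAt (𝓡 n) q).source) {v : Euc m}
    (hv : IsCritVec (patch f q) (extChartAt (𝓡 n) q r) v) (X Y : Euc n) :
    inner ℝ (fderiv ℝ (fderiv ℝ (patch f p)) (extChartAt (𝓡 n) p r) X Y) v =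
      inner ℝ (fderiv ℝ (fderiv ℝ (patch f q)) (extChartAt (𝓡 n) q r)
        (transitionEquiv n hp hq X) (transitionEquiv n hp hq Y)) v := by
  have h := fderiv_fderiv_of_eventuallyEq_comp (patch_eventuallyEq f hp hq)
    (contDiffAt_transition hp hq)
    (by rw [transition_apply hp]; exact contDiffAt_patch hf q ((extChartAt (𝓡 n) q).map_source hq))
    X Y
  rw [transition_apply hp] at h
  rw [h, inner_add_left, hv, add_zero]; rfl

include hf in
theorem posSemidef_hess_patch {p q r : M} (hp : r ∈ (extChartAt (𝓡 n) p).source)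
    (hq : r ∈ (extChartAt (𝓡 n) q).source) {v : Euc m}
    (hv : IsCritVec (patch f q) (extChartAt (𝓡 n) q r) v)
    (h : (hess (patch f q) (extChartAt (𝓡 n) q r) v).PosSemidef) :
    (hess (patch f p) (extChartAt (𝓡 n) p r) v).PosSemidef := by
  refine Matrix.PosSemidef.of_dotProduct_mulVec_nonneg (isHermitian_hess
    (isOpen_extChartAt_target p) (contDiffOn_patch hf p) ((extChartAt (𝓡 n) p).map_source hp) v)
    fun x => ?_
  rw [star_trivial]
  have h1 := dotProduct_hess_mulVec (patch f p) (extChartAt (𝓡 n) p r) v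
    (WithLp.toLp 2 x) (WithLp.toLp 2 x)
  rw [inner_fderiv_fderiv_patch hf hp hq hv, ← dotProduct_hess_mulVec] at h1
  rw [show x ⬝ᵥ _ = _ from h1]
  simpa using h.dotProduct_mulVec_nonneg (transitionEquiv n hp hq (WithLp.toLp 2 x)).ofLp

include hf in
theorem IsNonnegFrame.change_chart {p q r : M} (hp : r ∈ (extChartAt (𝓡 n) p).source)
    (hq : r ∈ (extChartAt (𝓡 n) q).source) {ξ η : Euc m}
    (h : IsNonnegFrame (patch f q) (extChartAt (𝓡 n) q r) ξ η) :
    IsNonnegFrame (patch f p) (extChartAt (𝓡 n) p r) ξ η where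
  norm_left := h.norm_left
  norm_right := h.norm_right
  inner_eq := h.inner_eq
  crit_left := (isCritVec_patch_iff hf hp hq ξ).2 h.crit_left
  crit_right := (isCritVec_patch_iff hf hp hq η).2 h.crit_right
  span v hv := h.span v ((isCritVec_patch_iff hf hp hq v).1 hv)
  psd_left := posSemidef_hess_patch hf hp hq h.crit_left h.psd_left
  psd_right := posSemidef_hess_patch hf hp hq h.crit_right h.psd_right

include hf in
omit [IsManifold (𝓡 n) ∞ M] in
theorem mfderiv_eq_fderiv_patch (p : M) :
    (mfderiv (𝓡 n) 𝓘(ℝ, Euc m) f p : Euc n →L[ℝ] Euc m) =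
      fderiv ℝ (patch f p) (extChartAt (𝓡 n) p p) := by
  refine ((hf p).mdifferentiableAt (by norm_num)).mfderiv.trans ?_
  rw [show range (𝓡 n) = univ from (𝓡 n).range_eq_univ, fderivWithin_univ]
  rfl

include hf in
theorem isCriticalPoint_heightFunction_iff_self (v : Euc m) (p : M) :
    IsCriticalPoint n (heightFunction f v) p ↔
      IsCritVec (patch f p) (extChartAt (𝓡 n) p p) v := by
  have h1 : ContMDiff (𝓡 n) 𝓘(ℝ, ℝ) ∞ (heightFunction f v) :=
    ((innerSL ℝ v).contMDiff (n := ∞)).comp hf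
  have h2 : (mfderiv (𝓡 n) 𝓘(ℝ, ℝ) (heightFunction f v) p : Euc n →L[ℝ] ℝ) =
      fderiv ℝ (fun w => inner ℝ v (patch f p w)) (extChartAt (𝓡 n) p p) := by
    refine ((h1 p).mdifferentiableAt (by norm_num)).mfderiv.trans ?_
    rw [show range (𝓡 n) = univ from (𝓡 n).range_eq_univ, fderivWithin_univ]
    rfl
  have h3 := fderiv_inner_comp (contDiffAt_patch hf p (mem_extChartAt_target p)) v
  unfold IsCriticalPoint IsCritVec
  constructor
  · intro h X
    rw [← h3 X, ← h2]
    exact congrArg (fun L : Euc n →L[ℝ] ℝ => L X) h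
  · intro h
    refine ContinuousLinearMap.ext fun X => ?_
    refine (congrArg (fun L : Euc n →L[ℝ] ℝ => L X) h2).trans ?_
    exact (h3 X).trans (h X)

include hf in
theorem isCriticalPoint_heightFunction_iff {q r : M} (hq : r ∈ (extChartAt (𝓡 n) q).source)
    (v : Euc m) : IsCriticalPoint n (heightFunction f v) r ↔
      IsCritVec (patch f q) (extChartAt (𝓡 n) q r) v :=
  (isCriticalPoint_heightFunction_iff_self hf v r).trans
    (isCritVec_patch_iff hf (mem_extChartAt_source r) hq v)

/-- The quadratic form of second derivatives of `⟨F, v⟩`. -/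
def hessForm (F : Euc n → Euc m) (u : Euc n) (v : Euc m) : QuadraticForm ℝ (Euc n) :=
  LinearMap.BilinMap.toQuadraticMap
    (LinearMap.mk₂ ℝ (fun X Y => (inner ℝ (fderiv ℝ (fderiv ℝ F) u X Y) v : ℝ))
      (fun X X' Y => by simp [inner_add_left]) (fun c X Y => by simp [real_inner_smul_left])
      (fun X Y Y' => by simp [inner_add_left]) (fun c X Y => by simp [real_inner_smul_left]))

theorem hessForm_apply (F : Euc n → Euc m) (u : Euc n) (v : Euc m) (X : Euc n) :
    hessForm F u v X = inner ℝ (fderiv ℝ (fderiv ℝ F) u X X) v := rfl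

include hf in
-- The index is defined in the preferred chart of the point itself, while the counting uses one
-- chart for many points. The two Hessians are congruent and so have the same index.
theorem morseIndex_heightFunction {q r : M} (hq : r ∈ (extChartAt (𝓡 n) q).source)
    {v : Euc m} (hv : IsCritVec (patch f q) (extChartAt (𝓡 n) q r) v) :
    morseIndex n (heightFunction f v) r =
      sigNeg (hessForm (patch f q) (extChartAt (𝓡 n) q r) v) := by
  have hr := mem_extChartAt_source (I := 𝓡 n) r
  refine QuadraticMap.Equivalent.sigNeg_eq ⟨{ transitionEquiv n hr hq with map_app' := ?_ }⟩
  intro X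
  refine (inner_fderiv_fderiv_patch hf hr hq hv X X).symm.trans ?_
  exact (fderiv_fderiv_inner_comp (contDiffAt_patch hf r (mem_extChartAt_target r)) v X X).symm

include hf in
theorem morseIndex_eq_zero_iff {q r : M} (hq : r ∈ (extChartAt (𝓡 n) q).source)
    {v : Euc m} (hv : IsCritVec (patch f q) (extChartAt (𝓡 n) q r) v)
    (hdet : (hess (patch f q) (extChartAt (𝓡 n) q r) v).det ≠ 0) :
    morseIndex n (heightFunction f v) r = 0 ↔
      (hess (patch f q) (extChartAt (𝓡 n) q r) v).PosDef := by
  rw [morseIndex_heightFunction hf hq hv]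
  exact sigNeg_eq_zero_iff (isHermitian_hess (isOpen_extChartAt_target q) (contDiffOn_patch hf q)
    ((extChartAt (𝓡 n) q).map_source hq) v) hdet fun x => by
      rw [hessForm_apply, dotProduct_hess_mulVec]

include hf in
theorem morseIndex_eq_card_iff {q r : M} (hq : r ∈ (extChartAt (𝓡 n) q).source)
    {v : Euc m} (hv : IsCritVec (patch f q) (extChartAt (𝓡 n) q r) v) :
    morseIndex n (heightFunction f v) r = n ↔
      (-hess (patch f q) (extChartAt (𝓡 n) q r) v).PosDef := by
  rw [morseIndex_heightFunction hf hq hv]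
  exact sigNeg_eq_card_iff (isHermitian_hess (isOpen_extChartAt_target q) (contDiffOn_patch hf q)
    ((extChartAt (𝓡 n) q).map_source hq) v) fun x => by
      rw [hessForm_apply, dotProduct_hess_mulVec]

end Patch

/-! ### Shape operators in coordinates -/

section Shape

open Set Filter Topology

variable {n m : ℕ} {M : Type*} [TopologicalSpace M] [ChartedSpace (Euc n) M]
  [IsManifold (𝓡 n) ∞ M] {f : M → Euc m} (hf : ContMDiff (𝓡 n) 𝓘(ℝ, Euc m) ∞ f)

include hf in
omit [IsManifold (𝓡 n) ∞ M] in
theorem mem_normalSpace_iff (p : M) (v : Euc m) : v ∈ normalSpace (n := n) f p ↔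
    IsCritVec (patch f p) (extChartAt (𝓡 n) p p) v := by
  rw [normalSpace, mfderiv_eq_fderiv_patch hf, Submodule.mem_orthogonal]
  constructor
  · exact fun h X => h _ ⟨X, rfl⟩
  · rintro h _ ⟨X, rfl⟩; exact h X

variable [RiemannianBundle (fun q : M => TangentSpace (𝓡 n) q)]

omit [IsManifold (𝓡 n) ∞ M] in
-- The projection in α is invisible to a normal β. Coordinate vectors need not be orthonormal, so
-- the Hessian matrix represents the bilinear form and not the operator; positivity and kernel
-- depend only on the form.
theorem inner_shapeOperator_eq (p : M) (β : normalSpace (n := n) f p) (X Y : Euc n) :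
    inner ℝ (shapeOperator f p β (X : TangentSpace (𝓡 n) p)) (Y : TangentSpace (𝓡 n) p) =
      X.ofLp ⬝ᵥ (hess (patch f p) (extChartAt (𝓡 n) p p) (β : Euc m)).mulVec Y.ofLp := by
  rw [dotProduct_hess_mulVec]
  exact (inner_shapeOperator f p β X Y).trans
    (Submodule.inner_orthogonalProjectionOnto_eq_of_mem_right _ _)

include hf in
theorem isPositive_shapeOperator_iff (p : M) (β : normalSpace (n := n) f p) :
    (shapeOperator f p β).IsPositive ↔
      (hess (patch f p) (extChartAt (𝓡 n) p p) (β : Euc m)).PosSemidef := by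
  have hH := isHermitian_hess (isOpen_extChartAt_target p) (contDiffOn_patch hf p)
    (mem_extChartAt_target p) (β : Euc m)
  constructor
  · intro h
    refine Matrix.PosSemidef.of_dotProduct_mulVec_nonneg hH fun x => ?_
    have := h.2 (WithLp.toLp 2 x : Euc n)
    rw [inner_shapeOperator_eq (f := f) p β (WithLp.toLp 2 x) (WithLp.toLp 2 x)] at this
    simpa using this
  · intro h
    refine ⟨fun X Y => ?_, fun X => ?_⟩
    · rw [inner_shapeOperator_eq (f := f) p β X Y, real_inner_comm,
        inner_shapeOperator_eq (f := f) p β Y X, Matrix.dotProduct_mulVec,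
        ← Matrix.mulVec_transpose, dotProduct_comm]
      congr 2
    · rw [inner_shapeOperator_eq (f := f) p β X X]
      simpa using h.dotProduct_mulVec_nonneg (X : Euc n).ofLp

include hf in
theorem mem_ker_shapeOperator_iff (p : M) (β : normalSpace (n := n) f p) (X : Euc n) :
    (X : TangentSpace (𝓡 n) p) ∈ LinearMap.ker (shapeOperator f p β) ↔
      (hess (patch f p) (extChartAt (𝓡 n) p p) (β : Euc m)).mulVec X.ofLp = 0 := by
  have hH := isHermitian_hess (isOpen_extChartAt_target p) (contDiffOn_patch hf p)
    (mem_extChartAt_target p) (β : Euc m)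
  set H := hess (patch f p) (extChartAt (𝓡 n) p p) (β : Euc m)
  have key : ∀ Y : Euc n, inner ℝ (shapeOperator f p β (X : TangentSpace (𝓡 n) p))
      (Y : TangentSpace (𝓡 n) p) = H.mulVec X.ofLp ⬝ᵥ Y.ofLp := fun Y => by
    rw [inner_shapeOperator_eq (f := f) p β X Y, Matrix.dotProduct_mulVec, ← Matrix.mulVec_transpose]
    congr 2
  refine (LinearMap.mem_ker (f := shapeOperator f p β) (y := (X : TangentSpace (𝓡 n) p))).trans ?_
  constructor
  · intro h
    refine dotProduct_self_eq_zero.1 ?_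
    refine (key (WithLp.toLp 2 (H.mulVec X.ofLp))).symm.trans ?_
    exact (congrArg (fun Z => inner ℝ Z _) h).trans (inner_zero_left _)
  · intro h
    refine (inner_self_eq_zero (𝕜 := ℝ)).1 ?_
    refine (key (shapeOperator f p β (X : TangentSpace (𝓡 n) p))).trans ?_
    rw [h, zero_dotProduct]

include hf in
theorem isNonnegFrame_of_isPositive (p : M)
    (b : OrthonormalBasis (Fin 2) ℝ (normalSpace (n := n) f p))
    (h0 : (shapeOperator f p (b 0)).IsPositive) (h1 : (shapeOperator f p (b 1)).IsPositive) :
    IsNonnegFrame (patch f p) (extChartAt (𝓡 n) p p) (b 0 : Euc m) (b 1 : Euc m) where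
  norm_left := b.norm_eq_one 0
  norm_right := b.norm_eq_one 1
  inner_eq := b.inner_eq_zero (by decide)
  crit_left := (mem_normalSpace_iff hf p _).1 (b 0).2
  crit_right := (mem_normalSpace_iff hf p _).1 (b 1).2
  span v hv := by
    have h := b.sum_repr' ⟨v, (mem_normalSpace_iff hf p v).2 hv⟩
    rw [Fin.sum_univ_two] at h
    exact (congrArg Subtype.val h).symm
  psd_left := (isPositive_shapeOperator_iff hf p _).1 h0
  psd_right := (isPositive_shapeOperator_iff hf p _).1 h1

include hf in
/-- The alternative for shape operators, from the determinant identity. -/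
theorem shapeOperator_alternative (p : M)
    (b : OrthonormalBasis (Fin 2) ℝ (normalSpace (n := n) f p))
    (h0 : (shapeOperator f p (b 0)).IsPositive) (h1 : (shapeOperator f p (b 1)).IsPositive)
    (h : indefiniteDet (hess (patch f p) (extChartAt (𝓡 n) p p) (b 0 : Euc m) -
        hess (patch f p) (extChartAt (𝓡 n) p p) (b 1 : Euc m)) =
      definiteDet (hess (patch f p) (extChartAt (𝓡 n) p p) (b 0 : Euc m) +
        hess (patch f p) (extChartAt (𝓡 n) p p) (b 1 : Euc m))) :
    (IsCompl (LinearMap.ker (shapeOperator f p (b 0)))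
        (LinearMap.ker (shapeOperator f p (b 1))) ∧
      shapeOperator f p (b 0) ≠ 0 ∧ shapeOperator f p (b 1) ≠ 0) ∨
    LinearMap.ker (shapeOperator f p (b 0)) ⊓ LinearMap.ker (shapeOperator f p (b 1)) ≠ ⊥ := by
  have hmap : ∀ β : normalSpace (n := n) f p, LinearMap.ker (shapeOperator f p β) =
      (LinearMap.ker (hess (patch f p) (extChartAt (𝓡 n) p p) (β : Euc m)).mulVecLin).comap
        (WithLp.linearEquiv 2 ℝ (Fin n → ℝ) : Euc n ≃ₗ[ℝ] (Fin n → ℝ)).toLinearMap := fun β =>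
    Submodule.ext fun X => mem_ker_shapeOperator_iff hf p β X
  have hne : ∀ β : normalSpace (n := n) f p,
      hess (patch f p) (extChartAt (𝓡 n) p p) (β : Euc m) ≠ 0 → shapeOperator f p β ≠ 0 := by
    intro β hβ h0
    refine hβ (Matrix.ext_of_mulVec_single fun i => ?_)
    have := (mem_ker_shapeOperator_iff hf p β (WithLp.toLp 2 (Pi.single i 1))).1 (by
      rw [h0]; rfl)
    rw [Matrix.zero_mulVec]; exact this
  rcases ker_alternative ((isPositive_shapeOperator_iff hf p _).1 h0)
    ((isPositive_shapeOperator_iff hf p _).1 h1) h with ⟨hc, hA, hB⟩ | ⟨x, hx, hA, hB⟩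
  · refine Or.inl ⟨?_, hne _ hA, hne _ hB⟩
    rw [hmap, hmap]
    exact hc.map (Submodule.orderIsoMapComap
      (WithLp.linearEquiv 2 ℝ (Fin n → ℝ) : Euc n ≃ₗ[ℝ] (Fin n → ℝ))).symm
  · refine Or.inr fun hbot => hx ?_
    have hmem : ((WithLp.toLp 2 x : Euc n) : TangentSpace (𝓡 n) p) ∈
        LinearMap.ker (shapeOperator f p (b 0)) ⊓ LinearMap.ker (shapeOperator f p (b 1)) :=
      ⟨(mem_ker_shapeOperator_iff hf p _ _).2 hA, (mem_ker_shapeOperator_iff hf p _ _).2 hB⟩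
    rw [hbot] at hmem
    exact congrArg (WithLp.ofLp : Euc n → (Fin n → ℝ)) ((Submodule.mem_bot ℝ).1 hmem)

end Shape

/-! ### Nonnegative curvature and normal frames -/

section Frames

open Set Filter Topology

/-- Strict Cauchy–Schwarz: the squared norm of the nonzero vector |X|²Y − ⟨X, Y⟩X is |X|² times the
expression. -/
theorem inner_mul_inner_sub_sq_pos {E : Type*} [NormedAddCommGroup E] [InnerProductSpace ℝ E]
    {X Y : E} (h : LinearIndependent ℝ ![X, Y]) :
    (0 : ℝ) < inner ℝ X X * inner ℝ Y Y - inner ℝ X Y ^ 2 := by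
  have hX : X ≠ 0 := h.ne_zero 0
  have hXX : (0 : ℝ) < inner ℝ X X := real_inner_self_pos.2 hX
  have hZ : (inner ℝ X X : ℝ) • Y - (inner ℝ X Y : ℝ) • X ≠ 0 := fun h0 => by
    have := (LinearIndependent.pair_iff.1 h) (-(inner ℝ X Y : ℝ)) (inner ℝ X X) (by
      rw [← h0]; module)
    exact hXX.ne' this.2
  have h2 := real_inner_self_pos.2 hZ
  simp only [inner_sub_left, inner_sub_right, real_inner_smul_left, real_inner_smul_right] at h2
  rw [real_inner_comm X Y] at h2
  refine pos_of_mul_pos_right (b := (inner ℝ X X * inner ℝ Y Y - inner ℝ X Y ^ 2 : ℝ)) ?_ hXX.le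
  linarith [h2]

variable {n m : ℕ} {M : Type*} [TopologicalSpace M] [ChartedSpace (Euc n) M]
  [IsManifold (𝓡 n) ∞ M] [RiemannianBundle (fun q : M => TangentSpace (𝓡 n) q)]
  {f : M → Euc m} (hf : IsIsometricImmersion n f)
include hf

omit [IsManifold (𝓡 n) ∞ M] in
theorem IsIsometricImmersion.injective_mfderiv (p : M) : Function.Injective
    (mfderiv (𝓡 n) 𝓘(ℝ, Euc m) f p : Euc n →L[ℝ] Euc m) := by
  refine (injective_iff_map_eq_zero _).2 fun X hX => ?_
  have h := hf.isometric p X X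
  refine (inner_self_eq_zero (𝕜 := ℝ) (E := TangentSpace (𝓡 n) p)).1 ?_
  rw [← h]
  exact (congrArg (fun v : Euc m => inner ℝ v v) hX).trans (inner_zero_left _)

theorem IsIsometricImmersion.injective_fderiv_patch (q : M) {r : M}
    (hr : r ∈ (extChartAt (𝓡 n) q).source) :
    Function.Injective (fderiv ℝ (patch f q) (extChartAt (𝓡 n) q r)) := by
  have h := hf.injective_mfderiv r
  rw [mfderiv_eq_fderiv_patch hf.smooth] at h
  have h2 : ∀ X, fderiv ℝ (patch f q) (extChartAt (𝓡 n) q r) X =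
      fderiv ℝ (patch f r) (extChartAt (𝓡 n) r r)
        ((transitionEquiv n hr (mem_extChartAt_source r)) X) := fun X =>
    fderiv_patch hf.smooth hr (mem_extChartAt_source r) X
  intro X Y hXY
  rw [h2, h2] at hXY
  exact (transitionEquiv n hr (mem_extChartAt_source r)).injective (h hXY)

theorem IsIsometricImmersion.chartMetric_eq (p : M) {u : Euc n}
    (hu : u ∈ (extChartAt (𝓡 n) p).target) (i j : Fin n) :
    chartMetric p u i j = inner ℝ (d1 (patch f p) i u) (d1 (patch f p) j u) := by
  have h1 : MDifferentiableAt 𝓘(ℝ, Euc n) (𝓡 n) (extChartAt (𝓡 n) p).symm u :=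
    ((contMDiffOn_extChartAt_symm (n := ∞) p).contMDiffAt
      ((isOpen_extChartAt_target p).mem_nhds hu)).mdifferentiableAt (by norm_num)
  have h2 := mfderiv_comp (I := 𝓘(ℝ, Euc n)) (I' := 𝓡 n) (I'' := 𝓘(ℝ, Euc m)) u
    ((hf.smooth _).mdifferentiableAt (by norm_num)) h1
  rw [mfderiv_eq_fderiv] at h2
  have h3 : ∀ i, d1 (patch f p) i u = (mfderiv (𝓡 n) 𝓘(ℝ, Euc m) f ((extChartAt (𝓡 n) p).symm u)
      (coordVector p u i) : Euc m) := fun i =>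
    congrArg (fun L : Euc n →L[ℝ] Euc m => L (EuclideanSpace.single i 1)) h2
  rw [h3, h3]
  exact (hf.isometric _ (coordVector p u i) (coordVector p u j)).symm

theorem IsIsometricImmersion.det_chartMetric_ne_zero (p : M) {u : Euc n}
    (hu : u ∈ (extChartAt (𝓡 n) p).target) : (chartMetric p u).det ≠ 0 := by
  intro h0
  obtain ⟨x, hx, hgx⟩ := Matrix.exists_mulVec_eq_zero_iff.2 h0
  have hinj := hf.injective_fderiv_patch p ((extChartAt (𝓡 n) p).map_target hu)
  rw [(extChartAt (𝓡 n) p).right_inv hu] at hinj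
  refine hx ?_
  have h1 : fderiv ℝ (patch f p) u (WithLp.toLp 2 x) = ∑ i, x i • d1 (patch f p) i u := by
    rw [sum_smul_single (WithLp.toLp 2 x)]
    simp [d1]
  have h2 : inner ℝ (∑ i, x i • d1 (patch f p) i u) (∑ i, x i • d1 (patch f p) i u) = (0 : ℝ) := by
    have h3 : x ⬝ᵥ (chartMetric p u).mulVec x = 0 := by rw [hgx, dotProduct_zero]
    rw [← h3, sum_inner]
    simp only [inner_sum, real_inner_smul_left, real_inner_smul_right, dotProduct, Matrix.mulVec,
      hf.chartMetric_eq p hu, Finset.mul_sum]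
    refine Finset.sum_congr rfl fun i _ => Finset.sum_congr rfl fun j _ => by ring
  rw [inner_self_eq_zero, ← h1] at h2
  exact congrArg WithLp.ofLp ((injective_iff_map_eq_zero _).1 hinj _ h2)

/-- For independent vectors the Gauss equation gives ⟨α(X,X), α(Y,Y)⟩ ≥ |α(X,Y)|². Dependent vectors
span no plane and carry no curvature condition, but then both values are nonnegative multiples of a
single α(Z,Z). -/
theorem IsIsometricImmersion.inner_secondFundamentalForm_nonneg (hsec : NonnegSectionalCurvature n M)
    (p : M) (X Y : TangentSpace (𝓡 n) p) :
    (0 : ℝ) ≤ inner ℝ (secondFundamentalForm f p X X) (secondFundamentalForm f p Y Y) := by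
  by_cases h : LinearIndependent ℝ ![X, Y]
  · have h1 := hsec p X Y h
    rw [sectionalCurvature, le_div_iff₀ (inner_mul_inner_sub_sq_pos h), zero_mul] at h1
    replace h1 := h1.trans_eq (curvatureQuad_eq (isOpen_extChartAt_target p)
      (contDiffOn_patch hf.smooth p) (fun u hu i j => hf.chartMetric_eq p hu i j)
      (fun u hu => hf.det_chartMetric_ne_zero p hu) (mem_extChartAt_target p) X Y)
    rw [← mfderiv_eq_fderiv_patch hf.smooth] at h1
    have hsym : fderiv ℝ (fderiv ℝ (patch f p)) (extChartAt (𝓡 n) p p) Y X =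
        fderiv ℝ (fderiv ℝ (patch f p)) (extChartAt (𝓡 n) p p) X Y := by
      have hs : IsSymmSndFDerivAt ℝ (patch f p) (extChartAt (𝓡 n) p p) :=
        (contDiffAt_patch hf.smooth p (mem_extChartAt_target p)).isSymmSndFDerivAt (by
          rw [minSmoothness_of_isRCLikeNormedField]
          exact WithTop.coe_le_coe.2 (le_top : (2 : ℕ∞) ≤ ⊤))
      exact hs Y X
    replace h1 := h1.trans_eq (congrArg₂ (fun a b => a - inner ℝ b _) rfl hsym)
    have key : ∀ a b : Euc m, inner ℝ a ((normalSpace (n := n) f p).starProjection b) =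
        inner ℝ ((normalSpace (n := n) f p).orthogonalProjectionOnto a)
          ((normalSpace (n := n) f p).orthogonalProjectionOnto b) := fun a b => by
      rw [Submodule.inner_orthogonalProjectionOnto_eq_of_mem_right]; rfl
    have h2 := sub_nonneg.1 h1
    exact (real_inner_self_nonneg.trans_eq (key _ _).symm).trans (h2.trans_eq (key _ _))
  · have hcol : ∃ (Z : TangentSpace (𝓡 n) p) (a b : ℝ), X = a • Z ∧ Y = b • Z := by
      by_cases hX : X = 0
      · exact ⟨Y, 0, 1, by simp [hX], by simp⟩
      · rw [LinearIndependent.pair_iff' hX] at h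
        push Not at h
        obtain ⟨a, ha⟩ := h
        exact ⟨X, 1, a, by simp, ha.symm⟩
    obtain ⟨Z, a, b, rfl, rfl⟩ := hcol
    have hs : ∀ c : ℝ, secondFundamentalForm f p (c • Z) (c • Z) =
        (c * c) • secondFundamentalForm f p Z Z := fun c => by
      have h1 : (chartHessian f p (c • Z) (c • Z) : Euc m) = (c * c) • chartHessian f p Z Z := by
        rw [map_smul, map_smul, mul_smul]; rfl
      exact (congrArg _ h1).trans (map_smul _ _ _)
    rw [hs, hs]
    generalize secondFundamentalForm f p Z Z = W
    refine le_of_le_of_eq (mul_nonneg (mul_self_nonneg a) (mul_nonneg (mul_self_nonneg b)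
      (real_inner_self_nonneg (x := (W : Euc m))))) ?_
    exact ((real_inner_smul_left (W : Euc m) _ (a * a)).trans
      (congrArg _ (real_inner_smul_right (W : Euc m) _ (b * b)))).symm

end Frames

/-! ### Nonnegative frames in codimension two -/

section FramesTwo

variable {n : ℕ} {M : Type*} [TopologicalSpace M] [ChartedSpace (Euc n) M]
  [IsManifold (𝓡 n) ∞ M] [RiemannianBundle (fun q : M => TangentSpace (𝓡 n) q)]
  {f : M → Euc (n + 2)} (hf : IsIsometricImmersion n f)
include hf

omit [IsManifold (𝓡 n) ∞ M] in
theorem IsIsometricImmersion.finrank_normalSpace (p : M) :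
    Module.finrank ℝ (normalSpace (n := n) f p) = 2 := by
  have h1 : Module.finrank ℝ (LinearMap.range (mfderiv (𝓡 n) 𝓘(ℝ, Euc (n + 2)) f p :
      Euc n →L[ℝ] Euc (n + 2)).toLinearMap) + Module.finrank ℝ (normalSpace (n := n) f p) =
      Module.finrank ℝ (Euc (n + 2)) := Submodule.finrank_add_finrank_orthogonal _
  have h2 : Module.finrank ℝ (LinearMap.range (mfderiv (𝓡 n) 𝓘(ℝ, Euc (n + 2)) f p :
      Euc n →L[ℝ] Euc (n + 2)).toLinearMap) = Module.finrank ℝ (Euc n) :=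
    LinearMap.finrank_range_of_inj (hf.injective_mfderiv p)
  rw [h2, finrank_euclideanSpace_fin,
    finrank_euclideanSpace_fin] at h1
  exact Nat.add_left_cancel h1

/-- The values α(X,X) have pairwise nonnegative inner products in a plane, so the edges of a
quadrant containing them serve as ξ and η. -/
theorem IsIsometricImmersion.exists_isPositive (hsec : NonnegSectionalCurvature n M) (p : M) :
    ∃ b : OrthonormalBasis (Fin 2) ℝ (normalSpace (n := n) f p),
      (shapeOperator f p (b 0)).IsPositive ∧ (shapeOperator f p (b 1)).IsPositive := by
  obtain ⟨b, hb⟩ := exists_orthonormalBasis_quadrant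
    ((stdOrthonormalBasis ℝ (normalSpace (n := n) f p)).reindex
      (finCongr (hf.finrank_normalSpace p)))
    (C := Set.range fun X : TangentSpace (𝓡 n) p => secondFundamentalForm f p X X) (by
      rintro _ ⟨X, rfl⟩ _ ⟨Y, rfl⟩
      exact hf.inner_secondFundamentalForm_nonneg hsec p X Y)
  have key : ∀ β : normalSpace (n := n) f p,
      (∀ X : TangentSpace (𝓡 n) p, 0 ≤ (inner ℝ (secondFundamentalForm f p X X) β : ℝ)) →
      (shapeOperator f p β).IsPositive := fun β h => by
    refine (isPositive_shapeOperator_iff hf.smooth p β).2 ?_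
    refine Matrix.PosSemidef.of_dotProduct_mulVec_nonneg (isHermitian_hess
      (isOpen_extChartAt_target p) (contDiffOn_patch hf.smooth p) (mem_extChartAt_target p) _)
      fun x => ?_
    have := (h (WithLp.toLp 2 x : Euc n)).trans_eq ((inner_shapeOperator f p β _ _).symm.trans
      (inner_shapeOperator_eq (f := f) p β (WithLp.toLp 2 x) (WithLp.toLp 2 x)))
    simpa using this
  exact ⟨b, key _ fun X => (hb _ ⟨X, rfl⟩).1, key _ fun X => (hb _ ⟨X, rfl⟩).2⟩

theorem IsIsometricImmersion.exists_isNonnegFrame (hsec : NonnegSectionalCurvature n M) (q : M)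
    {u : Euc n} (hu : u ∈ (extChartAt (𝓡 n) q).target) :
    ∃ ξ η, IsNonnegFrame (patch f q) u ξ η := by
  have hr := (extChartAt (𝓡 n) q).map_target hu
  obtain ⟨b, h0, h1⟩ := hf.exists_isPositive hsec ((extChartAt (𝓡 n) q).symm u)
  have h := (isNonnegFrame_of_isPositive hf.smooth _ b h0 h1).change_chart hf.smooth hr
    (mem_extChartAt_source _)
  rw [(extChartAt (𝓡 n) q).right_inv hu] at h
  exact ⟨_, _, h⟩

end FramesTwo

/-! ### Counting critical points of height functions -/

section Counting

open Set Filter Topology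

variable {n m : ℕ} {M : Type*} [TopologicalSpace M] [ChartedSpace (Euc n) M]

variable (n) in
/-- The critical points of `h_v` in `S` whose index satisfies `K`. -/
def indexSet (f : M → Euc m) (K : ℕ → Prop) (S : Set M) (v : Euc m) : Set M :=
  {r | r ∈ S ∧ IsCriticalPoint n (heightFunction f v) r ∧
    K (morseIndex n (heightFunction f v) r)}

variable (n) in
/-- The number of critical points of `h_v` in `S` whose index satisfies `K`. -/
def indexCount (f : M → Euc m) (K : ℕ → Prop) (S : Set M) (v : Euc m) : ℝ≥0∞ :=
  (((indexSet n f K S v).encard : ℕ∞) : ℝ≥0∞)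

theorem indexCount_empty (f : M → Euc m) (K : ℕ → Prop) : indexCount n f K ∅ = fun _ => 0 := by
  funext v
  simp [indexCount, indexSet]

theorem indexCount_union (f : M → Euc m) (K : ℕ → Prop) {S T : Set M} (h : Disjoint S T) :
    indexCount n f K (S ∪ T) = fun v => indexCount n f K S v + indexCount n f K T v := by
  funext v
  have hu : indexSet n f K (S ∪ T) v = indexSet n f K S v ∪ indexSet n f K T v := by
    ext r; simp only [indexSet, mem_union, mem_ofPred_eq]; tauto
  have hd : Disjoint (indexSet n f K S v) (indexSet n f K T v) :=
    h.mono (fun _ hr => hr.1) fun _ hr => hr.1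
  rw [indexCount, hu, encard_union_eq hd]
  push_cast
  rfl

theorem indexCount_mono (f : M → Euc m) {K L : ℕ → Prop} (h : ∀ k, K k → L k) (S : Set M)
    (v : Euc m) : indexCount n f K S v ≤ indexCount n f L S v :=
  ENat.toENNReal_mono (encard_le_encard fun _ hr => ⟨hr.1, hr.2.1, h _ hr.2.2⟩)

theorem indexCount_add_le (f : M → Euc m) (k : ℕ) (s : Finset ℕ) (hk : k ∉ s) (S : Set M)
    (v : Euc m) : indexCount n f (· = k) S v + indexCount n f (· ∈ s) S v ≤
      indexCount n f (· ∈ insert k s) S v := by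
  have hd : Disjoint (indexSet n f (· = k) S v) (indexSet n f (· ∈ s) S v) := by
    rw [Set.disjoint_left]
    rintro r ⟨_, _, h1⟩ ⟨_, _, h2⟩
    exact hk (h1 ▸ h2)
  have h : (indexSet n f (· = k) S v).encard + (indexSet n f (· ∈ s) S v).encard ≤
      (indexSet n f (· ∈ insert k s) S v).encard := by
    rw [← encard_union_eq hd]
    refine encard_le_encard ?_
    rintro r (⟨h1, h2, h3⟩ | ⟨h1, h2, h3⟩)
    · exact ⟨h1, h2, Finset.mem_insert.2 (Or.inl h3)⟩
    · exact ⟨h1, h2, Finset.mem_insert_of_mem h3⟩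
  have := ENat.toENNReal_mono h
  push_cast at this
  exact this

/-- Only superadditivity of the lower integral is used, so the counts for single intermediate
indices need no measurability; this is the direction that wideness requires. -/
theorem sum_lintegral_indexCount_le {α : Type*} [MeasurableSpace α] (μ : Measure α)
    (g : α → Euc m) (f : M → Euc m) (S : Set M) (s : Finset ℕ) :
    ∑ k ∈ s, ∫⁻ a, indexCount n f (· = k) S (g a) ∂μ ≤
      ∫⁻ a, indexCount n f (· ∈ s) S (g a) ∂μ := by
  classical
  induction s using Finset.induction_on with
  | empty => simp
  | insert k s hk ih =>
    rw [Finset.sum_insert hk]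
    calc _ ≤ (∫⁻ a, indexCount n f (· = k) S (g a) ∂μ) +
          ∫⁻ a, indexCount n f (· ∈ s) S (g a) ∂μ := by gcongr
      _ ≤ ∫⁻ a, (indexCount n f (· = k) S (g a) + indexCount n f (· ∈ s) S (g a)) ∂μ :=
        le_lintegral_add _ _
      _ ≤ _ := lintegral_mono fun a => indexCount_add_le f k s hk S (g a)

variable (n) in
/-- The counts of critical points in `S` are measurable, and the weighted number of those of
intermediate index is at most that of the extrema, which is finite. -/
structure IsBalanced (f : M → Euc m) (S : Set M) : Prop where
  aemeasurable_min : AEMeasurable (indexCount n f (· = 0) S) volume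
  aemeasurable_max : AEMeasurable (indexCount n f (· = n) S) volume
  aemeasurable_mid : AEMeasurable (indexCount n f (fun k => k ≠ 0 ∧ k ≠ n) S) volume
  le : ∫⁻ v, weight v * indexCount n f (fun k => k ≠ 0 ∧ k ≠ n) S v ≤
    (∫⁻ v, weight v * indexCount n f (· = 0) S v) + ∫⁻ v, weight v * indexCount n f (· = n) S v
  lt_top : (∫⁻ v, weight v * indexCount n f (· = 0) S v) +
    ∫⁻ v, weight v * indexCount n f (· = n) S v < ⊤

theorem isBalanced_empty (f : M → Euc m) : IsBalanced n f ∅ := by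
  constructor <;> simp [indexCount_empty]

theorem lintegral_indexCount_union {f : M → Euc m} {K : ℕ → Prop} {S T : Set M}
    (h : Disjoint S T) (hS : AEMeasurable (indexCount n f K S) volume) :
    ∫⁻ v, weight v * indexCount n f K (S ∪ T) v =
      (∫⁻ v, weight v * indexCount n f K S v) + ∫⁻ v, weight v * indexCount n f K T v := by
  simp only [indexCount_union f K h, mul_add]
  exact lintegral_add_left' (measurable_weight.aemeasurable.mul hS) _

theorem IsBalanced.union {f : M → Euc m} {S T : Set M} (hS : IsBalanced n f S)
    (hT : IsBalanced n f T) (h : Disjoint S T) : IsBalanced n f (S ∪ T) where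
  aemeasurable_min := by
    rw [indexCount_union f _ h]; exact hS.aemeasurable_min.add hT.aemeasurable_min
  aemeasurable_max := by
    rw [indexCount_union f _ h]; exact hS.aemeasurable_max.add hT.aemeasurable_max
  aemeasurable_mid := by
    rw [indexCount_union f _ h]; exact hS.aemeasurable_mid.add hT.aemeasurable_mid
  le := by
    rw [lintegral_indexCount_union h hS.aemeasurable_min,
      lintegral_indexCount_union h hS.aemeasurable_max,
      lintegral_indexCount_union h hS.aemeasurable_mid, add_add_add_comm]
    exact add_le_add hS.le hT.le
  lt_top := by
    rw [lintegral_indexCount_union h hS.aemeasurable_min,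
      lintegral_indexCount_union h hS.aemeasurable_max, add_add_add_comm]
    exact ENNReal.add_lt_top.2 ⟨hS.lt_top, hT.lt_top⟩

/-- A strict inequality on S would, added to the finite inequality on T, give a strict inequality on
the union. Finiteness on T is what preserves strictness. -/
theorem IsBalanced.eq_left {f : M → Euc m} {S T : Set M} (hS : IsBalanced n f S)
    (hT : IsBalanced n f T) (h : Disjoint S T)
    (heq : (∫⁻ v, weight v * indexCount n f (· = 0) (S ∪ T) v) +
        ∫⁻ v, weight v * indexCount n f (· = n) (S ∪ T) v ≤
      ∫⁻ v, weight v * indexCount n f (fun k => k ≠ 0 ∧ k ≠ n) (S ∪ T) v) :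
    ∫⁻ v, weight v * indexCount n f (fun k => k ≠ 0 ∧ k ≠ n) S v =
      (∫⁻ v, weight v * indexCount n f (· = 0) S v) +
        ∫⁻ v, weight v * indexCount n f (· = n) S v := by
  refine hS.le.antisymm (le_of_not_gt fun hlt => ?_)
  rw [lintegral_indexCount_union h hS.aemeasurable_min,
    lintegral_indexCount_union h hS.aemeasurable_max,
    lintegral_indexCount_union h hS.aemeasurable_mid, add_add_add_comm] at heq
  exact (heq.trans_lt (ENNReal.add_lt_add_of_lt_of_le
    (hT.le.trans_lt hT.lt_top).ne hlt hT.le)).ne rfl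

theorem measurableSet_image_extChartAt [MeasurableSpace M] [BorelSpace M] (q : M) {S : Set M}
    (hS : MeasurableSet S) (hsub : S ⊆ (extChartAt (𝓡 n) q).source) :
    MeasurableSet (extChartAt (𝓡 n) q '' S) := by
  have h1 : extChartAt (𝓡 n) q '' S = Subtype.val ''
      ((extChartAt (𝓡 n) q).target.domRestrict (extChartAt (𝓡 n) q).symm ⁻¹' S) := by
    ext u
    constructor
    · rintro ⟨r, hr, rfl⟩
      refine ⟨⟨_, (extChartAt (𝓡 n) q).map_source (hsub hr)⟩, ?_, rfl⟩
      change (extChartAt (𝓡 n) q).symm (extChartAt (𝓡 n) q r) ∈ S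
      rwa [(extChartAt (𝓡 n) q).left_inv (hsub hr)]
    · rintro ⟨⟨w, hw⟩, hr, rfl⟩
      exact ⟨_, hr, (extChartAt (𝓡 n) q).right_inv hw⟩
  rw [h1]
  exact (isOpen_extChartAt_target q).measurableSet.subtype_image
    ((continuousOn_iff_continuous_domRestrict.1 (continuousOn_extChartAt_symm q)).measurable hS)

variable [IsManifold (𝓡 n) ∞ M] {f : M → Euc m} (hf : ContMDiff (𝓡 n) 𝓘(ℝ, Euc m) ∞ f)

include hf in
theorem indexCount_eq_encard_critSet (q : M) {S : Set M}
    (hsub : S ⊆ (extChartAt (𝓡 n) q).source) {v : Euc m} {K : ℕ → Prop}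
    {L : Matrix (Fin n) (Fin n) ℝ → Prop}
    (h : ∀ r ∈ S, IsCritVec (patch f q) (extChartAt (𝓡 n) q r) v →
      (K (morseIndex n (heightFunction f v) r) ↔
        L (hess (patch f q) (extChartAt (𝓡 n) q r) v))) :
    indexCount n f K S v =
      (((critSet (patch f q) L (extChartAt (𝓡 n) q '' S) v).encard : ℕ∞) : ℝ≥0∞) := by
  have h1 : critSet (patch f q) L (extChartAt (𝓡 n) q '' S) v =
      extChartAt (𝓡 n) q '' indexSet n f K S v := by
    ext u
    constructor
    · rintro ⟨⟨r, hr, rfl⟩, h2, h3⟩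
      exact ⟨r, ⟨hr, (isCriticalPoint_heightFunction_iff hf (hsub hr) v).2 h2,
        (h r hr h2).2 h3⟩, rfl⟩
    · rintro ⟨r, ⟨hr, h2, h3⟩, rfl⟩
      have h4 := (isCriticalPoint_heightFunction_iff hf (hsub hr) v).1 h2
      exact ⟨⟨r, hr, rfl⟩, h4, (h r hr h4).1 h3⟩
  rw [indexCount, h1, InjOn.encard_image]
  exact (extChartAt (𝓡 n) q).injOn.mono fun r hr => hsub hr.1

include hf in
-- Away from the null set of directions with a degenerate critical point over S, the extreme indices
-- mean definite Hessians and every other index means a nondegenerate indefinite one.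
theorem indexCount_ae_eq (q : M) {S : Set M}
    (hsub : S ⊆ (extChartAt (𝓡 n) q).source)
    (hZ : volume {v : Euc m | ∃ u ∈ extChartAt (𝓡 n) q '' S, IsCritVec (patch f q) u v ∧
      (hess (patch f q) u v).det = 0} = 0) :
    ∀ᵐ v : Euc m, indexCount n f (· = 0) S v = (((critSet (patch f q) (fun H => H.PosDef)
        (extChartAt (𝓡 n) q '' S) v).encard : ℕ∞) : ℝ≥0∞) ∧
      indexCount n f (· = n) S v = (((critSet (patch f q) (fun H => (-H).PosDef)
        (extChartAt (𝓡 n) q '' S) v).encard : ℕ∞) : ℝ≥0∞) ∧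
      indexCount n f (fun k => k ≠ 0 ∧ k ≠ n) S v = (((critSet (patch f q) IsIndefinite
        (extChartAt (𝓡 n) q '' S) v).encard : ℕ∞) : ℝ≥0∞) := by
  filter_upwards [measure_eq_zero_iff_ae_notMem.1 hZ] with v hv
  have hdet : ∀ r ∈ S, IsCritVec (patch f q) (extChartAt (𝓡 n) q r) v →
      (hess (patch f q) (extChartAt (𝓡 n) q r) v).det ≠ 0 := fun r hr hc h0 =>
    hv ⟨_, ⟨r, hr, rfl⟩, hc, h0⟩
  refine ⟨indexCount_eq_encard_critSet hf q hsub fun r hr hc =>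
      morseIndex_eq_zero_iff hf (hsub hr) hc (hdet r hr hc),
    indexCount_eq_encard_critSet hf q hsub fun r hr hc => morseIndex_eq_card_iff hf (hsub hr) hc,
    indexCount_eq_encard_critSet hf q hsub fun r hr hc => ?_⟩
  rw [ne_eq, ne_eq, morseIndex_eq_zero_iff hf (hsub hr) hc (hdet r hr hc),
    morseIndex_eq_card_iff hf (hsub hr) hc, IsIndefinite, IsDefinite, not_or,
    and_iff_left (hdet r hr hc)]

include hf in
-- Positive scaling keeps the critical points and multiplies the Hessian by c; the substitution X ↦
-- √c X shows that the index is unchanged.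
theorem indexCount_smul (K : ℕ → Prop) (S : Set M) {c : ℝ} (hc : 0 < c) (v : Euc m) :
    indexCount n f K S (c • v) = indexCount n f K S v := by
  have hcrit : ∀ r, IsCriticalPoint n (heightFunction f (c • v)) r ↔
      IsCriticalPoint n (heightFunction f v) r := fun r => by
    rw [isCriticalPoint_heightFunction_iff hf (mem_extChartAt_source r),
      isCriticalPoint_heightFunction_iff hf (mem_extChartAt_source r)]
    simp [IsCritVec, real_inner_smul_right, hc.ne']
  have hidx : ∀ r, IsCriticalPoint n (heightFunction f v) r →
      morseIndex n (heightFunction f (c • v)) r = morseIndex n (heightFunction f v) r := by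
    intro r hr
    rw [morseIndex_heightFunction hf (mem_extChartAt_source r)
        ((isCriticalPoint_heightFunction_iff hf (mem_extChartAt_source r) _).1 ((hcrit r).2 hr)),
      morseIndex_heightFunction hf (mem_extChartAt_source r)
        ((isCriticalPoint_heightFunction_iff hf (mem_extChartAt_source r) _).1 hr)]
    refine QuadraticMap.Equivalent.sigNeg_eq ⟨{ LinearEquiv.smulOfNeZero ℝ (Euc n) (√c)
      (Real.sqrt_pos.2 hc).ne' with map_app' := fun X => ?_ }⟩
    change hessForm _ _ v (√c • X) = _
    rw [QuadraticMap.map_smul, hessForm_apply, hessForm_apply, real_inner_smul_right,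
      Real.mul_self_sqrt hc.le, smul_eq_mul]
  have : indexSet n f K S (c • v) = indexSet n f K S v := by
    ext r
    constructor
    · rintro ⟨h1, h2, h3⟩
      have h4 := (hcrit r).1 h2
      exact ⟨h1, h4, hidx r h4 ▸ h3⟩
    · rintro ⟨h1, h2, h3⟩
      exact ⟨h1, (hcrit r).2 h2, (hidx r h2).symm ▸ h3⟩
  rw [indexCount, indexCount, this]

theorem lintegral_cutoff_lt_top (d : ℕ) :
    ∫⁻ r : Ioi (0 : ℝ), ENNReal.ofReal (cutoff r) ∂(Measure.volumeIoiPow d) < ⊤ := by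
  have h4 : Measure.volumeIoiPow d (Iio (⟨4, by norm_num⟩ : Ioi (0 : ℝ))) < ⊤ := by
    rw [Measure.volumeIoiPow_apply_Iio]; exact ENNReal.ofReal_lt_top
  calc _ ≤ ∫⁻ r : Ioi (0 : ℝ), (Iio (⟨4, by norm_num⟩ : Ioi (0 : ℝ))).indicator
        (fun _ => (4 : ℝ≥0∞)) r ∂(Measure.volumeIoiPow d) := by
        refine lintegral_mono fun r => ?_
        by_cases hr : (r : ℝ) < 4
        · rw [indicator_of_mem (show r ∈ Iio (⟨4, by norm_num⟩ : Ioi (0 : ℝ)) from hr)]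
          refine ENNReal.ofReal_le_of_le_toReal ?_
          have := r.2.out
          simp only [cutoff, ENNReal.toReal_ofNat]
          exact max_le (by norm_num) (by linarith)
        · have : cutoff r = 0 := max_eq_left (by linarith)
          rw [this]; simp
    _ = 4 * Measure.volumeIoiPow d (Iio (⟨4, by norm_num⟩ : Ioi (0 : ℝ))) :=
        lintegral_indicator_const measurableSet_Iio _
    _ < ⊤ := ENNReal.mul_lt_top (by norm_num) h4

include hf in
-- The bridge from averages over the sphere to weighted integrals over the ambient space: polar
-- coordinates split off a finite factor independent of the index class.
theorem lintegral_weight_indexCount [Nontrivial (Euc m)] (K : ℕ → Prop) (S : Set M)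
    (h : AEMeasurable (indexCount n f K S) volume) :
    ∫⁻ v, weight v * indexCount n f K S v =
      (∫⁻ r : Ioi (0 : ℝ), ENNReal.ofReal (cutoff r)
        ∂(Measure.volumeIoiPow (Module.finrank ℝ (Euc m) - 1))) *
      ∫⁻ v : Metric.sphere (0 : Euc m) 1, indexCount n f K S v
        ∂(volume : Measure (Euc m)).toSphere :=
  lintegral_radial_mul (volume : Measure (Euc m)) (ρ := fun r => ENNReal.ofReal (cutoff r))
    (continuous_cutoff.measurable.ennreal_ofReal) h
    (fun _ v hr => indexCount_smul hf K S hr v) (lintegral_cutoff_lt_top _).ne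

end Counting

/-! ### Global comparison for wide immersions -/

section Global

open Set Filter Topology

variable {n : ℕ} {M : Type*} [TopologicalSpace M] [ChartedSpace (Euc n) M]
  [IsManifold (𝓡 n) ∞ M] [RiemannianBundle (fun q : M => TangentSpace (𝓡 n) q)]
  {f : M → Euc (n + 2)}

/-- The patch comparison transported to M. Counts by index agree with counts by Hessian class for
almost every v, which suffices for measurability almost everywhere and for the integrals. -/
theorem IsIsometricImmersion.exists_balanced_nhds (hf : IsIsometricImmersion n f) (hn : 0 < n)
    (hsec : NonnegSectionalCurvature n M) [MeasurableSpace M] [BorelSpace M] (q : M) :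
    ∃ O : Set M, IsOpen O ∧ q ∈ O ∧ (∀ S, MeasurableSet S → S ⊆ O → IsBalanced n f S) ∧
      (∫⁻ v, weight v * indexCount n f (fun k => k ≠ 0 ∧ k ≠ n) O v =
          (∫⁻ v, weight v * indexCount n f (· = 0) O v) +
            ∫⁻ v, weight v * indexCount n f (· = n) O v →
        ∀ ξ η, IsNonnegFrame (patch f q) (extChartAt (𝓡 n) q q) ξ η →
          indefiniteDet (hess (patch f q) (extChartAt (𝓡 n) q q) ξ -
              hess (patch f q) (extChartAt (𝓡 n) q q) η) =
            definiteDet (hess (patch f q) (extChartAt (𝓡 n) q q) ξ +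
              hess (patch f q) (extChartAt (𝓡 n) q q) η)) := by
  obtain ⟨V, hVo, hqV, hVU, hV, hVeq⟩ := exists_patch (isOpen_extChartAt_target q)
    (contDiffOn_patch hf.smooth q) hn (mem_extChartAt_target q)
    (hf.injective_fderiv_patch q (mem_extChartAt_source q))
    (fun u hu => hf.exists_isNonnegFrame hsec q hu)
  set O := (extChartAt (𝓡 n) q).source ∩ extChartAt (𝓡 n) q ⁻¹' V with hO
  have hOo : IsOpen O :=
    (continuousOn_extChartAt q).isOpen_inter_preimage (isOpen_extChartAt_source q) hVo
  have himg : extChartAt (𝓡 n) q '' O = V := by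
    ext u
    constructor
    · rintro ⟨r, hr, rfl⟩; exact hr.2
    · intro hu
      refine ⟨(extChartAt (𝓡 n) q).symm u, ⟨(extChartAt (𝓡 n) q).map_target (hVU hu), ?_⟩,
        (extChartAt (𝓡 n) q).right_inv (hVU hu)⟩
      rw [mem_preimage, (extChartAt (𝓡 n) q).right_inv (hVU hu)]; exact hu
  have hsubV : ∀ S ⊆ O, extChartAt (𝓡 n) q '' S ⊆ V := fun S hS =>
    (image_mono hS).trans himg.subset
  have hmeas : ∀ S, MeasurableSet S → S ⊆ O → MeasurableSet (extChartAt (𝓡 n) q '' S) :=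
    fun S hS hSO => measurableSet_image_extChartAt q hS (hSO.trans inter_subset_left)
  have hae := fun S hS hSO => indexCount_ae_eq hf.smooth q (S := S) (hSO.trans inter_subset_left)
    (hV _ (hmeas S hS hSO) (hsubV S hSO)).2.2.2.1
  have hint : ∀ S, MeasurableSet S → S ⊆ O →
      (∫⁻ v, weight v * indexCount n f (· = 0) S v = ∫⁻ v, weight v *
        (((critSet (patch f q) (fun H => H.PosDef) (extChartAt (𝓡 n) q '' S) v).encard : ℕ∞) :
          ℝ≥0∞)) ∧
      (∫⁻ v, weight v * indexCount n f (· = n) S v = ∫⁻ v, weight v *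
        (((critSet (patch f q) (fun H => (-H).PosDef) (extChartAt (𝓡 n) q '' S) v).encard : ℕ∞) :
          ℝ≥0∞)) ∧
      (∫⁻ v, weight v * indexCount n f (fun k => k ≠ 0 ∧ k ≠ n) S v = ∫⁻ v, weight v *
        (((critSet (patch f q) IsIndefinite (extChartAt (𝓡 n) q '' S) v).encard : ℕ∞) :
          ℝ≥0∞)) := by
    intro S hS hSO
    refine ⟨lintegral_congr_ae ?_, lintegral_congr_ae ?_, lintegral_congr_ae ?_⟩
    · filter_upwards [hae S hS hSO] with v hv using congrArg _ hv.1
    · filter_upwards [hae S hS hSO] with v hv using congrArg _ hv.2.1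
    · filter_upwards [hae S hS hSO] with v hv using congrArg _ hv.2.2
  refine ⟨O, hOo, ⟨mem_extChartAt_source q, hqV⟩, fun S hS hSO => ?_, fun heq => ?_⟩
  · obtain ⟨m0, m1, m2, -, hle, hlt⟩ := hV _ (hmeas S hS hSO) (hsubV S hSO)
    obtain ⟨i0, i1, i2⟩ := hint S hS hSO
    refine ⟨m0.aemeasurable.congr ?_, m1.aemeasurable.congr ?_, m2.aemeasurable.congr ?_, ?_, ?_⟩
    · filter_upwards [hae S hS hSO] with v hv using hv.1.symm
    · filter_upwards [hae S hS hSO] with v hv using hv.2.1.symm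
    · filter_upwards [hae S hS hSO] with v hv using hv.2.2.symm
    · rw [i0, i1, i2]; exact hle
    · rw [i0, i1]; exact hlt
  · obtain ⟨i0, i1, i2⟩ := hint O hOo.measurableSet subset_rfl
    rw [i0, i1, i2, himg] at heq
    exact hVeq heq

/-- Compactness reduces the claim to small neighbourhoods. The property is carried for all
measurable subsets of an open set, so a subset of O ∪ P can be cut into the disjoint pieces S ∩ O
and S \ O. -/
theorem IsIsometricImmersion.isBalanced (hf : IsIsometricImmersion n f) (hn : 0 < n)
    (hsec : NonnegSectionalCurvature n M) [MeasurableSpace M] [BorelSpace M] [CompactSpace M]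
    {S : Set M} (hS : MeasurableSet S) : IsBalanced n f S := by
  have key : ∃ O : Set M, IsOpen O ∧ univ ⊆ O ∧
      ∀ S, MeasurableSet S → S ⊆ O → IsBalanced n f S := by
    refine isCompact_univ.induction_on (p := fun K => ∃ O : Set M, IsOpen O ∧ K ⊆ O ∧
      ∀ S, MeasurableSet S → S ⊆ O → IsBalanced n f S) ?_ ?_ ?_ ?_
    · refine ⟨∅, isOpen_empty, subset_rfl, fun S _ hS => ?_⟩
      rw [subset_empty_iff.1 hS]
      exact isBalanced_empty f
    · rintro K L hKL ⟨O, h1, h2, h3⟩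
      exact ⟨O, h1, hKL.trans h2, h3⟩
    · rintro K L ⟨O, h1, h2, h3⟩ ⟨P, h4, h5, h6⟩
      refine ⟨O ∪ P, h1.union h4, union_subset_union h2 h5, fun S hS hSO => ?_⟩
      have h7 := (h3 (S ∩ O) (hS.inter h1.measurableSet) inter_subset_right).union
        (h6 (S \ O) (hS.diff h1.measurableSet) fun r hr => (hSO hr.1).resolve_left hr.2)
        disjoint_inf_sdiff
      rwa [inter_union_sdiff] at h7
    · intro q _
      obtain ⟨O, h1, h2, h3, -⟩ := hf.exists_balanced_nhds hn hsec q
      exact ⟨O, mem_nhdsWithin_of_mem_nhds (h1.mem_nhds h2), O, h1, subset_rfl, h3⟩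
  obtain ⟨O, -, h2, h3⟩ := key
  exact h3 S hS ((subset_univ S).trans h2)

omit [IsManifold (𝓡 n) ∞ M] [RiemannianBundle (fun q : M => TangentSpace (𝓡 n) q)] in
theorem typeNumber_eq (k : ℕ) : typeNumber n f k =
    (∫⁻ v : Metric.sphere (0 : Euc (n + 2)) 1, indexCount n f (· = k) univ v
      ∂(volume : Measure (Euc (n + 2))).toSphere) *
      ((volume : Measure (Euc (n + 2))).toSphere univ)⁻¹ := by
  rw [typeNumber, laverage_eq, div_eq_mul_inv]
  simp [indexCount, indexSet, numCritical]

omit [IsManifold (𝓡 n) ∞ M] [RiemannianBundle (fun q : M => TangentSpace (𝓡 n) q)] in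
/-- For a wide immersion the critical points of intermediate index are, on average, at least as
numerous as the extrema. -/
theorem IsWide.lintegral_le (hwide : IsWide n f) :
    (∫⁻ v : Metric.sphere (0 : Euc (n + 2)) 1, indexCount n f (· = 0) univ v
        ∂(volume : Measure (Euc (n + 2))).toSphere) +
      ∫⁻ v : Metric.sphere (0 : Euc (n + 2)) 1, indexCount n f (· = n) univ v
        ∂(volume : Measure (Euc (n + 2))).toSphere ≤
    ∫⁻ v : Metric.sphere (0 : Euc (n + 2)) 1, indexCount n f (fun k => k ≠ 0 ∧ k ≠ n) univ v
      ∂(volume : Measure (Euc (n + 2))).toSphere := by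
  have hs0 : ((volume : Measure (Euc (n + 2))).toSphere univ)⁻¹ ≠ 0 :=
    ENNReal.inv_ne_zero.2 (measure_ne_top _ _)
  have hs1 : ((volume : Measure (Euc (n + 2))).toSphere univ)⁻¹ ≠ ⊤ :=
    ENNReal.inv_ne_top.2 ((Measure.measure_univ_ne_zero).2 (Measure.toSphere_ne_zero _))
  rw [IsWide] at hwide
  simp only [typeNumber_eq] at hwide
  rw [← add_mul, ← Finset.sum_mul, ENNReal.mul_left_inj hs0 hs1] at hwide
  rw [hwide]
  -- The indices strictly between 0 and n all belong to the class k ≠ 0, n, so enlarging to that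
  -- class keeps the inequality in the needed direction.
  refine (sum_lintegral_indexCount_le (n := n) (volume : Measure (Euc (n + 2))).toSphere
    Subtype.val f univ _).trans ?_
  refine lintegral_mono fun v => indexCount_mono (n := n) f (fun k hk => ?_) _ _
  have := Finset.mem_Ioo.1 hk
  omega

end Global

end NonnegCodimTwo

end

/-! ### The alternative for wide immersions -/

theorem mainTheorem7 {n : ℕ} (hn : 3 ≤ n) {M : Type*} [TopologicalSpace M] [T2Space M]
    [CompactSpace M] [ChartedSpace (Euc n) M] [IsManifold (𝓡 n) ∞ M]
    [RiemannianBundle (fun q : M => TangentSpace (𝓡 n) q)]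
    [IsContMDiffRiemannianBundle (𝓡 n) ∞ (Euc n) (fun q : M => TangentSpace (𝓡 n) q)]
    (hsec : NonnegSectionalCurvature n M)
    (f : M → Euc (n + 2)) (hf : IsIsometricImmersion n f) (hwide : IsWide n f) (p : M) :
    (∃ b : OrthonormalBasis (Fin 2) ℝ (normalSpace (n := n) f p),
      (shapeOperator f p (b 0)).IsPositive ∧ (shapeOperator f p (b 1)).IsPositive) ∧
    ∀ b : OrthonormalBasis (Fin 2) ℝ (normalSpace (n := n) f p),
      (shapeOperator f p (b 0)).IsPositive → (shapeOperator f p (b 1)).IsPositive →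
      (IsCompl (LinearMap.ker (shapeOperator f p (b 0)))
          (LinearMap.ker (shapeOperator f p (b 1))) ∧
        shapeOperator f p (b 0) ≠ 0 ∧ shapeOperator f p (b 1) ≠ 0) ∨
      LinearMap.ker (shapeOperator f p (b 0)) ⊓ LinearMap.ker (shapeOperator f p (b 1)) ≠ ⊥ := by
  have hn' : 0 < n := by omega
  refine ⟨hf.exists_isPositive hsec p, fun b h0 h1 => ?_⟩
  let _ : MeasurableSpace M := borel M
  have _ : BorelSpace M := ⟨rfl⟩
  -- M is split into O and its complement. Equality over M forces equality over O, and hence the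
  -- determinant identity at p.
  obtain ⟨O, hO, -, -, hdet⟩ := hf.exists_balanced_nhds hn' hsec p
  have hOb := hf.isBalanced hn' hsec hO.measurableSet
  have hOc := hf.isBalanced hn' hsec hO.measurableSet.compl
  have hM := hf.isBalanced hn' hsec MeasurableSet.univ
  refine shapeOperator_alternative hf.smooth p b h0 h1 (hdet (hOb.eq_left hOc
    disjoint_compl_right ?_) _ _ (isNonnegFrame_of_isPositive hf.smooth p b h0 h1))
  -- All three weighted integrals carry the same radial factor, which leaves the inequality between
  -- sphere integrals given by wideness.
  rw [Set.union_compl_self, lintegral_weight_indexCount hf.smooth _ _ hM.aemeasurable_min,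
    lintegral_weight_indexCount hf.smooth _ _ hM.aemeasurable_max,
    lintegral_weight_indexCount hf.smooth _ _ hM.aemeasurable_mid, ← mul_add]
  gcongr
  exact hwide.lintegral_le
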